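/- Let $p$ be a prime, $\Bbbk$ a field of characteristic $p$ and $a\in\mathbb F_p$ with $a\neq 0$. Let $H=\Bbbk[\partial]/(\partial^p)$, graded by $\deg\partial=2$. A $p$-DG algebra is a $\mathbb Z$-graded $\Bbbk$-algebra with a $\Bbbk$-linear derivation $\partial$ of degree $2$ such that $\partial^p=0$; a (left) $p$-DG module over it is a graded module with a compatible $\partial$ of degree $2$, $\partial^p=0$. A morphism of $p$-DG modules is a degree-zero module map commuting with $\partial$. It is null-homotopic if it equals $\sum_{j=0}^{p-1}\partial^{p-1-j}h\partial^{j}$ for some module map $h$ of degree $2-2p$, and it is a quasi-isomorphism if it is a homotopy equivalence of the underlying graded $H$-modules (that is, with $\Bbbk$-linear inverse and homotopies). A $p$-DG module $M$ is acyclic if $0\to M$ is a quasi-isomorphism; a $p$-DG algebra is acyclic if it is so as a module over itself. The derived category $\mathcal D(A)$ is the localization of the homotopy category of $p$-DG modules at the quasi-isomorphisms; its shift is $M[1]=(H\{2-2p\}\otimes M)/(\partial^{p-1}\otimes M)$, and its exact triangles are those isomorphic to images of the standard triangles $M\xrightarrow{u}N\to C_u\to M[1]$, where $C_u$ is the push-out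 of $u$ and $\lambda_M: M\to H\{2-2p\}\otimes M$, $m\mapsto\partial^{p-1}\otimes m$. The group $K_0(A)$ is generated by the symbols $[M]$ of isomorphism classes of compact objects of $\mathcal D(A)$, with the relations $[M]=[L]+[N]$ for all exact triangles $L\to M\to N\to L[1]$ of compact objects. Let $NH_n$ be the nilHecke algebra over $\Bbbk$: generators $x_1,\dots,x_n$ of degree $2$ and $\delta_1,\dots,\delta_{n-1}$ of degree $-2$, with relations $\delta_i^2=0$, $\delta_i\delta_{i+1}\delta_i=\delta_{i+1}\delta_i\delta_{i+1}$, $\delta_i\delta_j=\delta_j\delta_i$ for $|i-j|>1$, $x_ix_j=x_jx_i$, $x_i\delta_j=\delta_jx_i$ for $i\ne j,j+1$, and $x_i\delta_i-\delta_ix_{i+1}=1=\delta_ix_i-x_{i+1}\delta_i$. Let $\partial_a$ be the derivation of $NH_n$ with $$\partial_a(x_i)=x_i^2,\qquad \partial_a(\delta_i)=a-(a+1)x_i\delta_i+(a-1)x_{i+1}\delta_i ;$$ then $(NH_n,\partial_a)$ is a $p$-DG algebra. Let $\mathrm{Sym}_p\subset\Bbbk[x_1,\dots,x_p]$ be the symmetric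 polynomials with the differential $x_i\mapsto x_i^2$, $\deg x_i=2$. For $\alpha\in\mathbb F_p^p$ let $\mathrm{Pol}_p(\alpha)=\Bbbk[x_1,\dots,x_p]\cdot 1_\alpha$, with $1_\alpha$ in degree $p(1-p)/2$ and $\partial_\alpha(f1_\alpha)=(\partial f+f\sum_t\alpha_tx_t)1_\alpha$, where $\partial$ is the derivation with $\partial x_i=x_i^2$. For $s\in S_p$ let $U_{p,s}\subset \mathrm{Pol}_p(\alpha)$ be the span of the monomials $x^b$ with $0\le b_{s(t)}\le p-t$ for $t=1,\dots,p$. The following hold. 1. For every $n\ge p$ the $p$-DG algebra $(NH_n,\partial_a)$ is acyclic, $\mathcal D(NH_n,\partial_a)\cong 0$ (it is equivalent to the category with one object and one morphism), and $K_0(NH_n,\partial_a)=0$. 2. For every $\alpha_1\in\mathbb F_p$ put $\alpha=(\alpha_1,\alpha_1+a,\dots,\alpha_1+(p-1)a)$. There is $s\in S_p$ such that $U_{p,s}$ is $\partial_\alpha$-stable and is a free graded $H$-module, the map $U_{p,s}\otimes_\Bbbk \mathrm{Sym}_p\to \mathrm{Pol}_p$, $u\otimes f\mapsto fu$, is bijective,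 and there is an isomorphism of $p$-DG algebras $$(NH_p,\partial_a)\;\cong\;\mathrm{END}_\Bbbk(U_{p,s})\otimes_\Bbbk \mathrm{Sym}_p$$ (graded, and commuting with the differentials, where $\mathrm{END}_\Bbbk(U_{p,s})$ carries $\varphi\mapsto\partial_\alpha\varphi-\varphi\partial_\alpha$), which is compatible, through $u\otimes f\mapsto fu$, with the action of $NH_p$ on polynomials in which $x_i$ acts by multiplication and $\delta_i$ by $f\mapsto (f-s_if)/(x_i-x_{i+1})$, where $s_i$ exchanges $x_i$ and $x_{i+1}$. -/

import Mathlib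

open CategoryTheory TensorProduct

universe u

namespace PDG

section Operators

/-! ### Characteristic `p` identities for commuting operators -/

variable (p : ℕ) [Fact p.Prime]

theorem add_pow_prime (k : Type u) [Field k] [CharP k p] {R : Type*} [Ring R]
    [Algebra k R] {x y : R} (h : Commute x y) :
    (x + y) ^ p = x ^ p + y ^ p := by
  rcases subsingleton_or_nontrivial R with hR | hR
  · exact Subsingleton.elim _ _
  · have : CharP R p := charP_of_injective_algebraMap (algebraMap k R).injective p
    exact add_pow_char_of_commute p h

theorem sub_pow_prime (k : Type u) [Field k] [CharP k p] {R : Type*} [Ring R]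
    [Algebra k R] {x y : R} (h : Commute x y) :
    (x - y) ^ p = x ^ p - y ^ p := by
  have := add_pow_prime p k (x := x - y) (y := y) (h.sub_left (Commute.refl y))
  rw [sub_add_cancel] at this
  rw [this, add_sub_cancel_right]

theorem choose_pred_prime (k : Type u) [Field k] [CharP k p] (j : ℕ) (hj : j < p) :
    (((p - 1).choose j : ℕ) : k) = (-1) ^ j := by
  have hp : p.Prime := Fact.out
  induction j with
  | zero => simp
  | succ j ih =>
    have h1 : p.choose (j + 1) = (p - 1).choose j + (p - 1).choose (j + 1) := by
      conv_lhs => rw [← Nat.succ_pred_eq_of_pos hp.pos]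
      exact Nat.choose_succ_succ _ _
    have h2 : ((p.choose (j + 1) : ℕ) : k) = 0 :=
      (CharP.cast_eq_zero_iff k p _).2 (hp.dvd_choose_self (by omega) hj)
    rw [h1, Nat.cast_add, ih (by omega)] at h2
    rw [pow_succ]
    linear_combination h2

theorem sum_pow_mul_pow (k : Type u) [Field k] [CharP k p] {R : Type*} [Ring R]
    [Algebra k R] {x y : R} (h : Commute x y) :
    ∑ j ∈ Finset.range p, x ^ (p - 1 - j) * y ^ j = (x - y) ^ (p - 1) := by
  have hp : p.Prime := Fact.out
  have hpp : p - 1 + 1 = p := Nat.sub_add_cancel hp.pos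
  rw [sub_eq_add_neg, add_comm, (h.symm.neg_left).add_pow, hpp]
  refine Finset.sum_congr rfl fun j hj => ?_
  have hc := choose_pred_prime p k j (Finset.mem_range.1 hj)
  have hc' : (((p - 1).choose j : ℕ) : R) = (-1) ^ j := by
    have := congrArg (algebraMap k R) hc
    simpa using this
  rw [hc', neg_pow y j]
  have e1 : Commute ((-1 : R) ^ j) (y ^ j * x ^ (p - 1 - j)) :=
    ((Commute.neg_one_left _).pow_left j)
  rw [mul_assoc, mul_assoc, ← mul_assoc (y ^ j), ← e1.eq, ← mul_assoc, ← pow_add,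
    Even.neg_one_pow ⟨j, rfl⟩, one_mul, (h.pow_pow (p - 1 - j) j).eq]

variable {k : Type u} [Field k]

/-- The operator `h ↦ dN ∘ h - h ∘ dM` on linear maps. -/
def hd {M N : Type*} [AddCommGroup M] [AddCommGroup N] [Module k M] [Module k N]
    (dM : Module.End k M) (dN : Module.End k N) : Module.End k (M →ₗ[k] N) :=
  LinearMap.llcomp k M N N dN - LinearMap.lcomp k N dM

theorem hd_apply {M N : Type*} [AddCommGroup M] [AddCommGroup N] [Module k M] [Module k N]
    (dM : Module.End k M) (dN : Module.End k N) (h : M →ₗ[k] N) (m : M) :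
    hd dM dN h m = dN (h m) - h (dM m) := rfl

section
variable {M N : Type*} [AddCommGroup M] [AddCommGroup N] [Module k M] [Module k N]
    (dM : Module.End k M) (dN : Module.End k N)

theorem llcomp_pow (n : ℕ) (h : M →ₗ[k] N) (m : M) :
    (LinearMap.llcomp k M N N dN ^ n : Module.End k (M →ₗ[k] N)) h m = (dN ^ n) (h m) := by
  induction n generalizing h with
  | zero => rfl
  | succ n ih => rw [pow_succ, pow_succ, Module.End.mul_apply, ih]; rfl

theorem lcomp_pow (n : ℕ) (h : M →ₗ[k] N) (m : M) :
    (LinearMap.lcomp k N dM ^ n : Module.End k (M →ₗ[k] N)) h m = h ((dM ^ n) m) := by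
  induction n generalizing m with
  | zero => rfl
  | succ n ih =>
    rw [pow_succ', pow_succ, Module.End.mul_apply, LinearMap.lcomp_apply, ih]; rfl

theorem comp_commute : Commute (LinearMap.llcomp k M N N dN : Module.End k (M →ₗ[k] N))
    (LinearMap.lcomp k N dM) := by
  ext h m; rfl

theorem homotopy_sum [CharP k p] (h : M →ₗ[k] N) (m : M) :
    ∑ j ∈ Finset.range p, (dN ^ (p - 1 - j)) (h ((dM ^ j) m)) = (hd dM dN ^ (p - 1)) h m := by
  rw [hd, ← sum_pow_mul_pow p k (comp_commute dM dN)]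
  simp [LinearMap.sum_apply, llcomp_pow, lcomp_pow, Module.End.mul_apply]

theorem hd_pow_prime [CharP k p] (h : M →ₗ[k] N) (m : M) :
    (hd dM dN ^ p) h m = (dN ^ p) (h m) - h ((dM ^ p) m) := by
  rw [hd, sub_pow_prime p k (comp_commute dM dN)]
  simp [llcomp_pow, lcomp_pow]

end

/-- If `D` is a derivation of `R` and `E` a compatible operator on an `R`-module, then `D ^ p` is
a derivation and `E ^ p` is compatible with it. -/
theorem leibniz_pow_prime [CharP k p] {R M : Type*} [Ring R] [Algebra k R] [AddCommGroup M] [Module k M]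
    [Module R M] [IsScalarTower k R M] (D : Module.End k R) (E : Module.End k M)
    (hDE : ∀ r m, E (r • m) = D r • m + r • E m) (r : R) (m : M) :
    (E ^ p) (r • m) = (D ^ p) r • m + r • (E ^ p) m := by
  let l : R → (M →ₗ[k] M) := fun r => Algebra.lsmul k k M r
  have key : ∀ n : ℕ, (hd E E ^ n) (l r) = l ((D ^ n) r) := by
    intro n
    induction n with
    | zero => rfl
    | succ n ih =>
      rw [pow_succ', Module.End.mul_apply, ih, pow_succ', Module.End.mul_apply]
      ext x
      rw [hd_apply]
      simp [l, hDE]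
  have h1 := hd_pow_prime p E E (l r) m
  rw [key p] at h1
  simp only [l, Algebra.lsmul_coe] at h1
  rw [h1]; abel

end Operators

/-! ### `p`-DG algebras and `p`-DG modules -/

/-- A `p`-DG algebra over `k`: a `ℤ`-graded `k`-algebra with a `k`-linear derivation of degree `2`
whose `p`-th power vanishes. -/
structure PDGAlgebra (p : ℕ) (k : Type u) [Field k] where
  carrier : Type u
  [ring : Ring carrier]
  [algebra : Algebra k carrier]
  gr : ℤ → Submodule k carrier
  internal : DirectSum.IsInternal gr
  one_mem : (1 : carrier) ∈ gr 0
  mul_mem : ∀ {i j : ℤ} {a b : carrier}, a ∈ gr i → b ∈ gr j → a * b ∈ gr (i + j)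
  d : Module.End k carrier
  d_mem : ∀ {i : ℤ} {a : carrier}, a ∈ gr i → d a ∈ gr (i + 2)
  leibniz : ∀ a b : carrier, d (a * b) = d a * b + a * d b
  d_pow : d ^ p = 0

attribute [instance] PDGAlgebra.ring PDGAlgebra.algebra

/-- A left `p`-DG module over the `p`-DG algebra `A`. -/
structure PDGModule {p : ℕ} {k : Type u} [Field k] (A : PDGAlgebra p k) where
  carrier : Type u
  [addCommGroup : AddCommGroup carrier]
  [moduleBase : Module k carrier]
  [module : Module A.carrier carrier]
  [scalarTower : IsScalarTower k A.carrier carrier]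
  gr : ℤ → Submodule k carrier
  internal : DirectSum.IsInternal gr
  smul_mem : ∀ {i j : ℤ} {a : A.carrier} {m : carrier}, a ∈ A.gr i → m ∈ gr j → a • m ∈ gr (i + j)
  d : Module.End k carrier
  d_mem : ∀ {i : ℤ} {m : carrier}, m ∈ gr i → d m ∈ gr (i + 2)
  leibniz : ∀ (a : A.carrier) (m : carrier), d (a • m) = A.d a • m + a • d m
  d_pow : d ^ p = 0

attribute [instance] PDGModule.addCommGroup PDGModule.moduleBase PDGModule.module
  PDGModule.scalarTower

variable {p : ℕ} {k : Type u} [Field k] {A : PDGAlgebra p k}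

namespace PDGModule

/-- A morphism of `p`-DG modules: an `A`-linear map of degree zero commuting with `d`. -/
@[ext]
structure Hom (M N : PDGModule A) where
  lin : M.carrier →ₗ[A.carrier] N.carrier
  deg : ∀ i : ℤ, ∀ m ∈ M.gr i, lin m ∈ N.gr i
  comm : ∀ m, lin (M.d m) = N.d (lin m)

instance : Category (PDGModule A) where
  Hom := Hom
  id M := ⟨LinearMap.id, fun _ _ h => h, fun _ => rfl⟩
  comp f g := ⟨g.lin.comp f.lin, fun i m h => g.deg i _ (f.deg i m h), fun m => by
    simp [f.comm, g.comm]⟩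

/-- The zero morphism. -/
instance (M N : PDGModule A) : Zero (M ⟶ N) :=
  ⟨⟨0, fun i _ _ => (N.gr i).zero_mem, fun _ => by simp⟩⟩

/-- `f` is null-homotopic over the ring `R`: there is an `R`-linear map `h` of degree `2 - 2p` with
`f = ∑ dᵖ⁻¹⁻ʲ ∘ h ∘ dʲ`. It is used for `R = A` and for `R = k`. -/
def NullHomotopic (R : Type u) [Ring R] (M N : PDGModule A) [Module R M.carrier]
    [Module R N.carrier] (f : M.carrier → N.carrier) : Prop :=
  ∃ h : M.carrier →ₗ[R] N.carrier, (∀ i : ℤ, ∀ m ∈ M.gr i, h m ∈ N.gr (i + (2 - 2 * p))) ∧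
    ∀ m, f m = ∑ j ∈ Finset.range p, (N.d ^ (p - 1 - j)) (h ((M.d ^ j) m))

/-- Two morphisms are homotopic if their difference is null-homotopic over `A`. -/
def homotopic : HomRel (PDGModule A) := fun M N f g =>
  NullHomotopic A.carrier M N (fun m => f.lin m - g.lin m)

/-- A quasi-isomorphism: a morphism which is an isomorphism of the underlying `p`-complexes
(of `k`-vector spaces) up to homotopy. -/
def IsQuasiIso {M N : PDGModule A} (f : M ⟶ N) : Prop :=
  ∃ g : N.carrier →ₗ[k] M.carrier,
    (∀ i : ℤ, ∀ n ∈ N.gr i, g n ∈ M.gr i) ∧ (∀ n, g (N.d n) = M.d (g n)) ∧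
    NullHomotopic k M M (fun m => g (f.lin m) - m) ∧
    NullHomotopic k N N (fun n => f.lin (g n) - n)

theorem isInternal_of_subsingleton {V : Type*} [AddCommGroup V] [Module k V] [Subsingleton V]
    (gr : ℤ → Submodule k V) : DirectSum.IsInternal gr := by
  rw [DirectSum.isInternal_submodule_iff_iSupIndep_and_iSup_eq_top,
    iSupIndep_iff_finsetSum_eq_zero_imp_eq_zero]
  exact ⟨fun _ _ _ _ _ _ => Subsingleton.elim _ _, Subsingleton.elim _ _⟩

/-- The zero `p`-DG module. -/
def zero (A : PDGAlgebra p k) : PDGModule A where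
  carrier := PUnit
  gr _ := ⊥
  internal := isInternal_of_subsingleton _
  smul_mem _ _ := by simp
  d := 0
  d_mem _ := by simp
  leibniz _ _ := by simp
  d_pow := by ext

/-- `M` is acyclic if `0 ⟶ M` is a quasi-isomorphism. -/
def IsAcyclic (M : PDGModule A) : Prop := IsQuasiIso (0 : zero A ⟶ M)

/-- The left regular `p`-DG module. -/
def regular (A : PDGAlgebra p k) : PDGModule A where
  carrier := A.carrier
  gr := A.gr
  internal := A.internal
  smul_mem := A.mul_mem
  d := A.d
  d_mem := A.d_mem
  leibniz := A.leibniz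
  d_pow := A.d_pow

/-! ### Tensor products `V ⊗ M` with `V = k[∂]/(∂ᵐ)` -/

section Tens

variable {V : Type*} [AddCommGroup V] [Module k V]

/-- The coefficients of `∂ · ∑ ∂ʲ ⊗ f j` in `k[∂]/(∂ᵐ) ⊗ V`, without the part that differentiates
the `f j`. -/
def up (m : ℕ) : Module.End k (Fin m → V) where
  toFun f j := if h : j.val = 0 then 0 else f ⟨j.val - 1, by omega⟩
  map_add' f g := by ext j; by_cases h : j.val = 0 <;> simp [h]
  map_smul' c f := by ext j; by_cases h : j.val = 0 <;> simp [h]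

theorem up_pow (m n : ℕ) (f : Fin m → V) (j : Fin m) :
    (up (k := k) m ^ n) f j = if j.val < n then 0 else f ⟨j.val - n, by omega⟩ := by
  induction n generalizing f j with
  | zero => simp
  | succ n ih =>
    rw [pow_succ, Module.End.mul_apply, ih]
    by_cases h1 : j.val < n
    · simp [h1, Nat.lt_succ_of_lt h1]
    · by_cases h2 : j.val = n
      · simp [up, h2]
      · have h3 : ¬ j.val < n + 1 := by omega
        have h4 : j.val - n ≠ 0 := by omega
        simp only [h1, h3, if_false, up, LinearMap.coe_mk, AddHom.coe_mk, h4, dif_neg,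
          not_false_eq_true]
        congr 1

theorem up_pow_eq_zero {m n : ℕ} (h : m ≤ n) : (up m ^ n : Module.End k (Fin m → V)) = 0 := by
  ext f j
  simp only [LinearMap.coe_comp, Function.comp_apply, up_pow]
  rw [if_pos (by omega)]; rfl

theorem up_compLeft {W : Type*} [AddCommGroup W] [Module k W] (m : ℕ) (h : V →ₗ[k] W)
    (f : Fin m → V) : up (k := k) m (h.compLeft (Fin m) f) = h.compLeft (Fin m) (up (k := k) m f) := by
  ext j; by_cases hj : j.val = 0 <;> simp [up, hj]

theorem compLeft_pow (m n : ℕ) (d : Module.End k V) (f : Fin m → V) :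
    ((d.compLeft (Fin m) : Module.End k (Fin m → V)) ^ n) f = (d ^ n).compLeft (Fin m) f := by
  induction n generalizing f with
  | zero => rfl
  | succ n ih => rw [pow_succ, Module.End.mul_apply, ih, pow_succ]; rfl

/-- The grading of `V ⊗ M`, where `∂ʲ ⊗ x` has degree `s + 2j + deg x`. -/
def tensGr (m : ℕ) (s : ℤ) (gr : ℤ → Submodule k V) (i : ℤ) : Submodule k (Fin m → V) where
  carrier := {f | ∀ j : Fin m, f j ∈ gr (i - s - 2 * (j.val : ℤ))}
  add_mem' hf hg j := add_mem (hf j) (hg j)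
  zero_mem' _ := zero_mem _
  smul_mem' c _ hf j := Submodule.smul_mem _ c (hf j)

theorem tensGr_internal (m : ℕ) (s : ℤ) {gr : ℤ → Submodule k V} (h : DirectSum.IsInternal gr) :
    DirectSum.IsInternal (tensGr m s gr) := by
  rw [DirectSum.isInternal_submodule_iff_iSupIndep_and_iSup_eq_top] at h ⊢
  constructor
  · rw [iSupIndep_iff_finsetSum_eq_zero_imp_eq_zero]
    intro t v hv h0 i hi
    ext j
    have h1 : iSupIndep fun i : ℤ => gr (i - s - 2 * (j.val : ℤ)) :=
      h.1.comp (f := fun i : ℤ => i - s - 2 * (j.val : ℤ)) fun a b hab => by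
        simp only at hab; omega
    rw [iSupIndep_iff_finsetSum_eq_zero_imp_eq_zero] at h1
    refine h1 t (fun i => v i j) (fun i hi => hv i hi j) ?_ i hi
    have := congrFun h0 j
    simpa using this
  · rw [eq_top_iff]
    intro f _
    rw [← Finset.univ_sum_single f]
    refine Submodule.sum_mem _ fun j _ => ?_
    have hmem : f j ∈ ⨆ i, gr i := h.2 ▸ Submodule.mem_top
    generalize f j = y at hmem
    induction hmem using Submodule.iSup_induction' with
    | mem i x hx =>
      refine Submodule.mem_iSup_of_mem (i + s + 2 * (j.val : ℤ)) fun j' => ?_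
      by_cases hj : j' = j
      · subst hj
        rw [Pi.single_eq_same]
        convert hx using 2
        ring
      · rw [Pi.single_eq_of_ne hj]; exact zero_mem _
    | zero => rw [Pi.single_zero]; exact zero_mem _
    | add x y _ _ hx hy => rw [Pi.single_add]; exact add_mem hx hy

/-- The operator `d` on `k[∂]/(∂ᵐ) ⊗ V`: `d (∂ʲ ⊗ x) = ∂ʲ⁺¹ ⊗ x + ∂ʲ ⊗ d x`. -/
def tensD (m : ℕ) (d : Module.End k V) : Module.End k (Fin m → V) := d.compLeft (Fin m) + up m

theorem tensD_apply (m : ℕ) (d : Module.End k V) (f : Fin m → V) (j : Fin m) :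
    tensD m d f j = d (f j) + if h : j.val = 0 then 0 else f ⟨j.val - 1, by omega⟩ := rfl

theorem tensD_map {W : Type*} [AddCommGroup W] [Module k W] (m : ℕ) {dV : Module.End k V}
    {dW : Module.End k W} {h : V → W} (h0 : h 0 = 0) (hh : ∀ x, h (dV x) = dW (h x))
    (ha : ∀ x y, h (x + y) = h x + h y) (f : Fin m → V) (j : Fin m) :
    h (tensD m dV f j) = tensD m dW (fun l => h (f l)) j := by
  rw [tensD_apply, tensD_apply, ha, hh]
  by_cases hj : j.val = 0 <;> simp [hj, h0]

theorem tens_homotopy (p : ℕ) [Fact p.Prime] [CharP k p] {W : Type*} [AddCommGroup W] [Module k W]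
    (m : ℕ) (dV : Module.End k V) (dW : Module.End k W) (h : V →ₗ[k] W) (f : Fin m → V)
    (l : Fin m) :
    (∑ j ∈ Finset.range p, (tensD m dW ^ (p - 1 - j))
      (h.compLeft (Fin m) ((tensD m dV ^ j) f)) : Fin m → W) l =
    ∑ j ∈ Finset.range p, (dW ^ (p - 1 - j)) (h ((dV ^ j) (f l))) := by
  have key : ∀ n : ℕ, (hd (tensD m dV) (tensD m dW) ^ n) (h.compLeft (Fin m)) =
      ((hd dV dW ^ n) h).compLeft (Fin m) := by
    intro n
    induction n with
    | zero => rfl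
    | succ n ih =>
      rw [pow_succ', Module.End.mul_apply, ih, pow_succ', Module.End.mul_apply]
      generalize (hd dV dW ^ n) h = g
      apply LinearMap.ext
      intro f
      rw [hd_apply, tensD, tensD, LinearMap.add_apply, LinearMap.add_apply, map_add, up_compLeft]
      ext j
      simp [hd_apply]
  rw [homotopy_sum p dV dW h (f l), homotopy_sum p (tensD m dV) (tensD m dW) (h.compLeft (Fin m)) f,
    key]
  rfl

theorem tensD_pow_prime (p : ℕ) [Fact p.Prime] [CharP k p] {m : ℕ} (hm : m ≤ p)
    {d : Module.End k V} (h : d ^ p = 0) : tensD m d ^ p = 0 := by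
  have hc : Commute (d.compLeft (Fin m) : Module.End k (Fin m → V)) (up m) := by
    apply LinearMap.ext
    intro f
    exact (up_compLeft m d f).symm
  rw [tensD, add_pow_prime p k hc, up_pow_eq_zero hm, add_zero]
  apply LinearMap.ext
  intro f
  rw [compLeft_pow, h]
  rfl

end Tens

variable [Fact p.Prime] [CharP k p]

/-- The `p`-DG module `V{s} ⊗ M` for the `p`-complex `V = k[∂]/(∂ᵐ)`, `m ≤ p`. The function
`f : Fin m → M` stands for `∑ ∂ʲ ⊗ f j`. The algebra acts on `M` only, and
`d (∂ʲ ⊗ x) = ∂ʲ⁺¹ ⊗ x + ∂ʲ ⊗ d x`. -/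
abbrev tens (m : ℕ) (hm : m ≤ p) (s : ℤ) (M : PDGModule A) : PDGModule A where
  carrier := Fin m → M.carrier
  gr := tensGr m s M.gr
  internal := tensGr_internal m s M.internal
  smul_mem {i j a f} ha hf l := by
    have := M.smul_mem ha (hf l)
    rw [show i + j - s - 2 * (l.val : ℤ) = i + (j - s - 2 * (l.val : ℤ)) by ring]
    exact this
  d := tensD m M.d
  d_mem {i f} hf l := by
    refine add_mem ?_ ?_
    · have := M.d_mem (hf l)
      rw [show i + 2 - s - 2 * (l.val : ℤ) = i - s - 2 * (l.val : ℤ) + 2 by ring]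
      exact this
    · by_cases h : l.val = 0
      · simp [up, h]
      · have := hf ⟨l.val - 1, by omega⟩
        simp only [up, LinearMap.coe_mk, AddHom.coe_mk, h, dif_neg, not_false_eq_true]
        convert this using 2
        have : ((l.val - 1 : ℕ) : ℤ) = (l.val : ℤ) - 1 := by omega
        rw [this]; ring
  leibniz a f := by
    ext l
    by_cases h : l.val = 0 <;> simp [tensD_apply, h, M.leibniz, add_assoc]
  d_pow := tensD_pow_prime p hm M.d_pow

theorem tens_homotopy_deg {m : ℕ} (hm : m ≤ p) (s t : ℤ) {M N : PDGModule A}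
    {h : M.carrier → N.carrier} (hdeg : ∀ i : ℤ, ∀ x ∈ M.gr i, h x ∈ N.gr (i + t)) (i : ℤ)
    (x : Fin m → M.carrier) (hx : x ∈ (tens m hm s M).gr i) :
    (fun l => h (x l)) ∈ (tens m hm s N).gr (i + t) := fun l => by
  have := hdeg _ _ (hx l)
  rw [show i + t - s - 2 * (l.val : ℤ) = i - s - 2 * (l.val : ℤ) + t by ring]
  exact this

theorem tens_nullHomotopic_alg {m : ℕ} (hm : m ≤ p) (s : ℤ) {M N : PDGModule A}
    {f : M.carrier → N.carrier} (hf : NullHomotopic A.carrier M N f) :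
    NullHomotopic A.carrier (tens m hm s M) (tens m hm s N) (fun x l => f (x l)) := by
  obtain ⟨h, hdeg, hh⟩ := hf
  refine ⟨h.compLeft (Fin m), tens_homotopy_deg hm s _ hdeg, fun x => ?_⟩
  funext l
  exact (hh (x l)).trans (tens_homotopy p m M.d N.d (h.restrictScalars k) x l).symm

theorem tens_nullHomotopic_base {m : ℕ} (hm : m ≤ p) (s : ℤ) {M N : PDGModule A}
    {f : M.carrier → N.carrier} (hf : NullHomotopic k M N f) :
    NullHomotopic k (tens m hm s M) (tens m hm s N) (fun x l => f (x l)) := by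
  obtain ⟨h, hdeg, hh⟩ := hf
  refine ⟨h.compLeft (Fin m), tens_homotopy_deg hm s _ hdeg, fun x => ?_⟩
  funext l
  exact (hh (x l)).trans (tens_homotopy p m M.d N.d h x l).symm

/-- The functor `M ↦ V{s} ⊗ M` on `p`-DG modules. -/
abbrev tensFunctor (A : PDGAlgebra p k) (m : ℕ) (hm : m ≤ p) (s : ℤ) :
    PDGModule A ⥤ PDGModule A where
  obj M := tens m hm s M
  map f :=
    { lin := f.lin.compLeft (Fin m)
      deg := fun _ _ hx l => f.deg _ _ (hx l)
      comm := fun x => funext fun l =>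
        tensD_map m (map_zero f.lin) f.comm (map_add f.lin) x l }
  map_id _ := rfl
  map_comp _ _ := rfl

/-- `H{2 - 2p} ⊗ M` for `H = k[∂]/(∂ᵖ)`. -/
abbrev hTens (M : PDGModule A) : PDGModule A := tens p le_rfl (2 - 2 * p) M

/-- The shift `M[1] = (H{2 - 2p} ⊗ M) / im λ`: dividing by `∂ᵖ⁻¹ ⊗ M` leaves
`k[∂]/(∂ᵖ⁻¹){2 - 2p} ⊗ M`. -/
abbrev moduleShift (A : PDGAlgebra p k) : PDGModule A ⥤ PDGModule A :=
  tensFunctor A (p - 1) (Nat.sub_le p 1) (2 - 2 * p)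

/-- The embedding `M ⟶ H{2 - 2p} ⊗ M`, `x ↦ ∂ᵖ⁻¹ ⊗ x`. -/
def lam (M : PDGModule A) : M ⟶ hTens M where
  lin := LinearMap.pi fun j => if j.val = p - 1 then LinearMap.id else 0
  deg i x hx j := by
    have hp : 0 < p := (Fact.out : p.Prime).pos
    rw [LinearMap.pi_apply]
    by_cases h : j.val = p - 1
    · rw [if_pos h, show i - (2 - 2 * p) - 2 * (j.val : ℤ) = i by omega]
      exact hx
    · rw [if_neg h]; exact zero_mem _
  comm x := by
    funext j
    rw [LinearMap.pi_apply, tensD_apply]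
    simp only [LinearMap.pi_apply]
    by_cases h : j.val = p - 1
    · by_cases h0 : j.val = 0
      · rw [if_pos h, dif_pos h0]; simp
      · rw [if_pos h, dif_neg h0, if_neg (by omega)]; simp
    · rw [if_neg h, if_neg (by omega)]; simp

/-- The quotient map `H{2 - 2p} ⊗ M ⟶ M[1]`, which forgets `∂ᵖ⁻¹ ⊗ M`. -/
def lamBar (M : PDGModule A) : hTens M ⟶ (moduleShift A).obj M where
  lin := LinearMap.funLeft A.carrier M.carrier (Fin.castLE (Nat.sub_le p 1))
  deg _ _ hf j := hf (Fin.castLE (Nat.sub_le p 1) j)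
  comm _ := rfl

end PDGModule

/-! ### The homotopy category, the derived category and the Grothendieck group -/

section Derived

open PDGModule

/-- The homotopy category of `p`-DG modules over `A`. -/
abbrev HomotopyCat (A : PDGAlgebra p k) := CategoryTheory.Quotient (PDGModule.homotopic (A := A))

/-- The functor from `p`-DG modules to the homotopy category. -/
abbrev toHomotopyCat (A : PDGAlgebra p k) : PDGModule A ⥤ HomotopyCat A :=
  CategoryTheory.Quotient.functor _

/-- The quasi-isomorphisms in the homotopy category. -/
def quasiIso (A : PDGAlgebra p k) : MorphismProperty (HomotopyCat A) := fun X Y f =>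
  ∃ g : X.as ⟶ Y.as, (toHomotopyCat A).map g = f ∧ IsQuasiIso g

/-- The derived category: the localization of the homotopy category at the quasi-isomorphisms. -/
abbrev DerivedCat (A : PDGAlgebra p k) := (quasiIso A).Localization

/-- The localization functor. -/
abbrev toDerivedCat (A : PDGAlgebra p k) : HomotopyCat A ⥤ DerivedCat A := (quasiIso A).Q

variable [Fact p.Prime] [CharP k p]

/-- The shift functor `[1]` of the homotopy category. -/
abbrev homotopyShift (A : PDGAlgebra p k) : HomotopyCat A ⥤ HomotopyCat A :=
  CategoryTheory.Quotient.lift _ (moduleShift A ⋙ toHomotopyCat A) fun _ _ _ _ h =>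
    CategoryTheory.Quotient.sound _ (tens_nullHomotopic_alg (Nat.sub_le p 1) (2 - 2 * p) h)

theorem homotopyShift_inverts (A : PDGAlgebra p k) :
    (quasiIso A).IsInvertedBy (homotopyShift A ⋙ toDerivedCat A) := by
  rintro X Y _ ⟨f, rfl, g, hdeg, hcomm, h1, h2⟩
  refine (quasiIso A).Q_inverts _ ⟨(moduleShift A).map f, rfl, g.compLeft (Fin (p - 1)),
    fun i x hx l => hdeg _ _ (hx l), fun x => funext fun l =>
      tensD_map (p - 1) (map_zero g) hcomm (map_add g) x l,
    tens_nullHomotopic_base (Nat.sub_le p 1) (2 - 2 * p) h1,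
    tens_nullHomotopic_base (Nat.sub_le p 1) (2 - 2 * p) h2⟩

/-- The shift functor `[1]` of the derived category. -/
noncomputable def derivedShift (A : PDGAlgebra p k) : DerivedCat A ⥤ DerivedCat A :=
  Localization.Construction.lift (homotopyShift A ⋙ toDerivedCat A) (homotopyShift_inverts A)

/-- A sextuple `X ⟶ Y ⟶ Z ⟶ X[1]` in a category with an endofunctor `S = [1]`. -/
structure Sextuple {C : Type*} [Category C] (S : C ⥤ C) where
  {X Y Z : C}
  f : X ⟶ Y
  g : Y ⟶ Z
  h : Z ⟶ S.obj X

/-- Isomorphism of sextuples. -/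
def Sextuple.IsIsomorphic {C : Type*} [Category C] {S : C ⥤ C} (T T' : Sextuple S) : Prop :=
  ∃ (a : T.X ≅ T'.X) (b : T.Y ≅ T'.Y) (c : T.Z ≅ T'.Z),
    T.f ≫ b.hom = a.hom ≫ T'.f ∧ T.g ≫ c.hom = b.hom ≫ T'.g ∧
      T.h ≫ S.map a.hom = c.hom ≫ T'.h

/-- Exact triangles in the homotopy category: the sextuples isomorphic to a standard one. The
standard ones come from the push-out `C` of `u : M ⟶ N` and `λ : M ⟶ H{2 - 2p} ⊗ M`, with the map
`w : C ⟶ M[1]` induced by `0` on `N` and by the quotient map on `H{2 - 2p} ⊗ M`. -/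
def IsExactHomotopy {A : PDGAlgebra p k} (T : Sextuple (homotopyShift A)) : Prop :=
  ∃ (M N C : PDGModule A) (u : M ⟶ N) (v : N ⟶ C) (u' : hTens M ⟶ C)
    (w : C ⟶ (moduleShift A).obj M),
    IsPushout u (lam M) v u' ∧ v ≫ w = 0 ∧ u' ≫ w = lamBar M ∧
      T.IsIsomorphic (S := homotopyShift A)
        { f := (toHomotopyCat A).map u
          g := (toHomotopyCat A).map v
          h := (toHomotopyCat A).map w }

/-- Exact triangles in the derived category: the sextuples isomorphic to the image of an exact
triangle of the homotopy category. -/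
def IsExactDerived {A : PDGAlgebra p k} (T : Sextuple (derivedShift A)) : Prop :=
  ∃ T' : Sextuple (homotopyShift A), IsExactHomotopy T' ∧
    T.IsIsomorphic (S := derivedShift A)
      { f := (toDerivedCat A).map T'.f
        g := (toDerivedCat A).map T'.g
        h := (toDerivedCat A).map T'.h }

/-- Compact objects of the derived category: `Hom(M, -)` commutes with arbitrary direct sums. The
canonical map `⨁ Hom(M, N i) → Hom(M, ⨁ N i)` is always injective, and it is onto if and only if
every morphism from `M` to a direct sum factors through the sum of finitely many of the `N i`. -/
def isCompact (A : PDGAlgebra p k) : ObjectProperty (DerivedCat A) := fun M =>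
  ∀ (J : Type u) (N : J → DerivedCat A) (c : Limits.Cofan N) (_ : Limits.IsColimit c)
    (f : M ⟶ c.pt), ∃ (F : Finset J) (c' : Limits.Cofan fun i : F => N i)
      (hc' : Limits.IsColimit c') (g : M ⟶ c'.pt),
        g ≫ Limits.Cofan.IsColimit.desc hc' (fun i => c.inj i.1) = f

/-- The full subcategory of compact objects of the derived category. -/
abbrev CompactCat (A : PDGAlgebra p k) := (isCompact A).FullSubcategory

/-- The free abelian group on the isomorphism classes of compact objects. -/
abbrev FreeK0 (A : PDGAlgebra p k) :=
  FreeAbelianGroup (_root_.Quotient (isIsomorphicSetoid (CompactCat A)))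

/-- The generator given by the isomorphism class of a compact object. -/
noncomputable def symbol {A : PDGAlgebra p k} {M : DerivedCat A} (hM : isCompact A M) : FreeK0 A :=
  FreeAbelianGroup.of (_root_.Quotient.mk _ ⟨M, hM⟩)

/-- The Grothendieck group: generated by the symbols of the isomorphism classes of compact objects,
with `[M] = [L] + [N]` for every exact triangle `L ⟶ M ⟶ N ⟶ L[1]`. -/
abbrev K0 (A : PDGAlgebra p k) :=
  FreeK0 A ⧸ AddSubgroup.closure
    {r : FreeK0 A | ∃ (T : Sextuple (derivedShift A)) (_ : IsExactDerived T)
      (hX : isCompact A T.X) (hY : isCompact A T.Y) (hZ : isCompact A T.Z),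
      r = symbol hY - (symbol hX + symbol hZ)}

end Derived

/-! ### Polynomials -/

section Polynomials

open MvPolynomial

variable (p : ℕ) [Fact p.Prime] (k : Type u) [Field k] [CharP k p]

/-- The derivation `x_i ↦ x_i ^ 2` of `k[x_1, …, x_n]`. -/
noncomputable def polD (k : Type u) [Field k] (n : ℕ) :
    Derivation k (MvPolynomial (Fin n) k) (MvPolynomial (Fin n) k) :=
  mkDerivation k fun i => X i ^ 2

/-- The differential `f ↦ ∂ f + f ∑ α_t x_t` on the module generated by `1_α`. -/
noncomputable def twistD {n : ℕ} (α : Fin n → ZMod p) : Module.End k (MvPolynomial (Fin n) k) :=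
  (polD k n).toLinearMap +
    LinearMap.mulRight k (∑ t, C (ZMod.castHom (dvd_refl p) k (α t)) * X t)

/-- The grading of `k[x_1, …, x_n]` with `deg x_i = 2` and `1` in degree `n(1 - n)/2`. -/
noncomputable def balancedGr (n : ℕ) (d : ℤ) : Submodule k (MvPolynomial (Fin n) k) :=
  Submodule.span k {f | ∃ b : Fin n →₀ ℕ,
    2 * (b.degree : ℤ) + (n : ℤ) * (1 - n) / 2 = d ∧ f = monomial b 1}

variable {p k}

theorem pow_apply_mul {R : Type*} [Ring R] [Algebra k R] (D : Module.End k R)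
    (hD : ∀ a b, D (a * b) = D a * b + a * D b) (a b : R) :
    (D ^ p) (a * b) = (D ^ p) a * b + a * (D ^ p) b :=
  leibniz_pow_prime p D D hD a b

theorem pow_apply_generator {R : Type*} [Ring R] [Algebra k R] (D : Module.End k R)
    (hD : ∀ a b, D (a * b) = D a * b + a * D b) {x : R} (hx : D x = x ^ 2) : (D ^ p) x = 0 := by
  have h1 : ∀ n : ℕ, D (x ^ (n + 1)) = (n + 1 : ℕ) • x ^ (n + 2) := by
    intro n
    induction n with
    | zero => simp [hx]
    | succ n ih =>
      rw [pow_succ, hD, ih, hx, smul_mul_assoc, ← pow_succ, ← pow_add, ← succ_nsmul]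
  have h2 : ∀ n : ℕ, (D ^ n) x = n.factorial • x ^ (n + 1) := by
    intro n
    induction n with
    | zero => simp
    | succ n ih =>
      rw [pow_succ', Module.End.mul_apply, ih, map_nsmul, h1, smul_smul, Nat.factorial_succ,
        mul_comm]
  rw [h2, ← Nat.cast_smul_eq_nsmul k,
    (CharP.cast_eq_zero_iff k p _).2 (Nat.dvd_factorial (Fact.out : p.Prime).pos le_rfl), zero_smul]

theorem polD_pow (n : ℕ) : ((polD k n).toLinearMap : Module.End k _) ^ p = 0 := by
  have hl : ∀ a b, (polD k n).toLinearMap (a * b) =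
      (polD k n).toLinearMap a * b + a * (polD k n).toLinearMap b := fun a b => by
    simp [mul_comm, add_comm]
  apply LinearMap.ext
  intro f
  induction f using MvPolynomial.induction_on with
  | C c =>
    have hp : p = (p - 1) + 1 := (Nat.succ_pred_eq_of_pos (Fact.out : p.Prime).pos).symm
    rw [hp, pow_succ, Module.End.mul_apply]
    simp
  | add f g hf hg => rw [map_add, hf, hg]; simp
  | mul_X f i hf =>
    rw [pow_apply_mul _ hl, hf,
      pow_apply_generator _ hl (by simp [polD] : (polD k n).toLinearMap (X i) = X i ^ 2)]
    simp

theorem twistD_apply {n : ℕ} (α : Fin n → ZMod p) (f : MvPolynomial (Fin n) k) :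
    twistD p k α f = polD k n f + f * ∑ t, C (ZMod.castHom (dvd_refl p) k (α t)) * X t := rfl

theorem polD_prod_pow {n : ℕ} (b : Fin n → ℕ) (s : Finset (Fin n)) :
    polD k n (∏ t ∈ s, X t ^ b t) =
      (∏ t ∈ s, X t ^ b t) * ∑ t ∈ s, C (b t : k) * X t := by
  classical
  induction s using Finset.induction_on with
  | empty => simp
  | insert i s hi ih =>
    rw [Finset.prod_insert hi, Finset.sum_insert hi, Derivation.leibniz, ih,
      Derivation.leibniz_pow]
    rcases Nat.eq_zero_or_pos (b i) with h0 | h0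
    · simp [h0]
    · have : b i = b i - 1 + 1 := by omega
      simp only [polD, mkDerivation_X, smul_eq_mul, nsmul_eq_mul, map_natCast]
      rw [show (X i : MvPolynomial (Fin n) k) ^ b i = X i ^ (b i - 1) * X i by
        rw [← pow_succ, ← this]]
      ring

theorem twistD_pow {n : ℕ} (α : Fin n → ZMod p) : twistD p k α ^ p = 0 := by
  let g : MvPolynomial (Fin n) k := ∏ t, X t ^ (α t).val
  have hg : g ≠ 0 := Finset.prod_ne_zero_iff.2 fun t _ => pow_ne_zero _ (X_ne_zero t)
  have h1 : ∀ f, g * twistD p k α f = polD k n (g * f) := by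
    intro f
    have h2 := polD_prod_pow (k := k) (fun t => (α t).val) Finset.univ
    have h3 : ∀ t, ((α t).val : k) = ZMod.castHom (dvd_refl p) k (α t) := fun t => by
      rw [ZMod.castHom_apply, ZMod.cast_eq_val]
    simp only [h3] at h2
    rw [Derivation.leibniz, h2, twistD_apply]
    simp only [smul_eq_mul]
    ring
  have h4 : ∀ (m : ℕ) f, g * (twistD p k α ^ m) f =
      ((polD k n).toLinearMap ^ m : Module.End k _) (g * f) := by
    intro m
    induction m with
    | zero => intro f; rfl
    | succ m ih =>
      intro f
      rw [pow_succ, pow_succ, Module.End.mul_apply, Module.End.mul_apply, ih, h1]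
      rfl
  apply LinearMap.ext
  intro f
  have h5 := h4 p f
  rw [polD_pow] at h5
  exact (mul_eq_zero.1 h5).resolve_left hg

end Polynomials

/-! ### The nilHecke algebra -/

/-- Generators `x_1, …, x_n` and `δ_1, …, δ_{n-1}` (indexed from `0`). -/
inductive NHGen (n : ℕ) : Type
  | x (i : Fin n) : NHGen n
  | δ (i : Fin (n - 1)) : NHGen n

namespace NilHecke

/-- The index `i` of the left strand at the crossing `δ_i`. -/
def lo {n : ℕ} (i : Fin (n - 1)) : Fin n := ⟨i.val, by omega⟩

/-- The index `i + 1` of the right strand at the crossing `δ_i`. -/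
def hi {n : ℕ} (i : Fin (n - 1)) : Fin n := ⟨i.val + 1, by omega⟩

section Relations

variable (k : Type u) [Field k] (n : ℕ)

/-- The generator `x_i` of the free algebra. -/
abbrev fx (i : Fin n) : FreeAlgebra k (NHGen n) := FreeAlgebra.ι k (NHGen.x i)

/-- The generator `δ_i` of the free algebra. -/
abbrev fδ (i : Fin (n - 1)) : FreeAlgebra k (NHGen n) := FreeAlgebra.ι k (NHGen.δ i)

/-- The defining relations of the nilHecke algebra. -/
inductive Rel : FreeAlgebra k (NHGen n) → FreeAlgebra k (NHGen n) → Prop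
  | δ_sq (i : Fin (n - 1)) : Rel (fδ k n i * fδ k n i) 0
  | braid (i j : Fin (n - 1)) (h : i.val + 1 = j.val) :
      Rel (fδ k n i * fδ k n j * fδ k n i) (fδ k n j * fδ k n i * fδ k n j)
  | δ_comm (i j : Fin (n - 1)) (h : i.val + 1 < j.val ∨ j.val + 1 < i.val) :
      Rel (fδ k n i * fδ k n j) (fδ k n j * fδ k n i)
  | x_δ_comm (i : Fin n) (j : Fin (n - 1)) (h₁ : i ≠ lo j) (h₂ : i ≠ hi j) :
      Rel (fx k n i * fδ k n j) (fδ k n j * fx k n i)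
  | x_comm (i j : Fin n) : Rel (fx k n i * fx k n j) (fx k n j * fx k n i)
  | x_δ (i : Fin (n - 1)) : Rel (fx k n (lo i) * fδ k n i - fδ k n i * fx k n (hi i)) 1
  | δ_x (i : Fin (n - 1)) : Rel (fδ k n i * fx k n (lo i) - fx k n (hi i) * fδ k n i) 1

end Relations

end NilHecke

/-- The nilHecke algebra on `n` strands over `k`. -/
abbrev NilHecke (k : Type u) [Field k] (n : ℕ) := RingQuot (NilHecke.Rel k n)

namespace NilHecke

variable {k : Type u} [Field k] {n : ℕ}

/-- The image of a generator in the nilHecke algebra. -/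
noncomputable def gen (g : NHGen n) : NilHecke k n :=
  RingQuot.mkAlgHom k (Rel k n) (FreeAlgebra.ι k g)

/-- The element `x_i`. -/
noncomputable abbrev x (i : Fin n) : NilHecke k n := gen (NHGen.x i)

/-- The element `δ_i`. -/
noncomputable abbrev δ (i : Fin (n - 1)) : NilHecke k n := gen (NHGen.δ i)

theorem δ_sq (i : Fin (n - 1)) : (δ i : NilHecke k n) * δ i = 0 := by
  simpa [gen] using RingQuot.mkAlgHom_rel k (Rel.δ_sq (k := k) i)

theorem braid (i j : Fin (n - 1)) (h : i.val + 1 = j.val) :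
    (δ i : NilHecke k n) * δ j * δ i = δ j * δ i * δ j := by
  simpa [gen] using RingQuot.mkAlgHom_rel k (Rel.braid (k := k) i j h)

theorem δ_comm (i j : Fin (n - 1)) (h : i.val + 1 < j.val ∨ j.val + 1 < i.val) :
    (δ i : NilHecke k n) * δ j = δ j * δ i := by
  simpa [gen] using RingQuot.mkAlgHom_rel k (Rel.δ_comm (k := k) i j h)

theorem x_δ_comm (i : Fin n) (j : Fin (n - 1)) (h₁ : i ≠ lo j) (h₂ : i ≠ hi j) :
    (x i : NilHecke k n) * δ j = δ j * x i := by
  simpa [gen] using RingQuot.mkAlgHom_rel k (Rel.x_δ_comm (k := k) i j h₁ h₂)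

theorem x_comm (i j : Fin n) : (x i : NilHecke k n) * x j = x j * x i := by
  simpa [gen] using RingQuot.mkAlgHom_rel k (Rel.x_comm (k := k) i j)

theorem x_δ (i : Fin (n - 1)) : (x (lo i) : NilHecke k n) * δ i - δ i * x (hi i) = 1 := by
  simpa [gen] using RingQuot.mkAlgHom_rel k (Rel.x_δ (k := k) i)

theorem δ_x (i : Fin (n - 1)) : (δ i : NilHecke k n) * x (lo i) - x (hi i) * δ i = 1 := by
  simpa [gen] using RingQuot.mkAlgHom_rel k (Rel.δ_x (k := k) i)

/-- Elements of an algebra that satisfy the defining relations of the nilHecke algebra. -/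
structure Satisfies {B : Type*} [Ring B] (X : Fin n → B) (Δ : Fin (n - 1) → B) : Prop where
  δ_sq : ∀ i, Δ i * Δ i = 0
  braid : ∀ i j, i.val + 1 = j.val → Δ i * Δ j * Δ i = Δ j * Δ i * Δ j
  δ_comm : ∀ i j, i.val + 1 < j.val ∨ j.val + 1 < i.val → Δ i * Δ j = Δ j * Δ i
  x_δ_comm : ∀ i j, i ≠ lo j → i ≠ hi j → X i * Δ j = Δ j * X i
  x_comm : ∀ i j, X i * X j = X j * X i
  x_δ : ∀ i, X (lo i) * Δ i - Δ i * X (hi i) = 1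
  δ_x : ∀ i, Δ i * X (lo i) - X (hi i) * Δ i = 1

/-- The universal property of the nilHecke algebra. -/
noncomputable def lift {B : Type*} [Ring B] [Algebra k B] {X : Fin n → B} {Δ : Fin (n - 1) → B}
    (h : Satisfies X Δ) : NilHecke k n →ₐ[k] B :=
  RingQuot.liftAlgHom k ⟨FreeAlgebra.lift k (fun g => match g with | .x i => X i | .δ i => Δ i), by
    intro a b hab
    cases hab with
    | δ_sq i => simpa using h.δ_sq i
    | braid i j hij => simpa using h.braid i j hij
    | δ_comm i j hij => simpa using h.δ_comm i j hij
    | x_δ_comm i j h₁ h₂ => simpa using h.x_δ_comm i j h₁ h₂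
    | x_comm i j => simpa using h.x_comm i j
    | x_δ i => simpa using h.x_δ i
    | δ_x i => simpa using h.δ_x i⟩

theorem lift_x {B : Type*} [Ring B] [Algebra k B] {X : Fin n → B} {Δ : Fin (n - 1) → B}
    (h : Satisfies X Δ) (i : Fin n) : lift (k := k) h (x i) = X i := by
  simp [lift, gen]

theorem lift_δ {B : Type*} [Ring B] [Algebra k B] {X : Fin n → B} {Δ : Fin (n - 1) → B}
    (h : Satisfies X Δ) (i : Fin (n - 1)) : lift (k := k) h (δ i) = Δ i := by
  simp [lift, gen]

theorem algHom_ext {B : Type*} [Ring B] [Algebra k B] {f g : NilHecke k n →ₐ[k] B}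
    (h : ∀ s, f (gen s) = g (gen s)) : f = g := by
  apply RingQuot.ringQuot_ext'
  apply FreeAlgebra.hom_ext
  funext s
  exact h s

/-! #### The grading -/

/-- `deg x_i = 2` and `deg δ_i = -2`. -/
def degree : NHGen n → ℤ
  | .x _ => 2
  | .δ _ => -2

/-- The grading: degree `d` is spanned by the words of degree `d` in the generators. -/
noncomputable def gr (k : Type u) [Field k] (n : ℕ) (d : ℤ) : Submodule k (NilHecke k n) :=
  Submodule.span k {w | ∃ l : List (NHGen n), (l.map degree).sum = d ∧ w = (l.map gen).prod}

theorem one_mem_gr : (1 : NilHecke k n) ∈ gr k n 0 :=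
  Submodule.subset_span ⟨[], by simp, by simp⟩

theorem gen_mem_gr (g : NHGen n) : (gen g : NilHecke k n) ∈ gr k n (degree g) :=
  Submodule.subset_span ⟨[g], by simp, by simp⟩

theorem mul_mem_gr {i j : ℤ} {a b : NilHecke k n} (ha : a ∈ gr k n i) (hb : b ∈ gr k n j) :
    a * b ∈ gr k n (i + j) := by
  have : gr k n i * gr k n j ≤ gr k n (i + j) := by
    rw [gr, gr, Submodule.span_mul_span]
    refine Submodule.span_le.2 ?_
    rintro _ ⟨_, ⟨l, hl, rfl⟩, _, ⟨l', hl', rfl⟩, rfl⟩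
    exact Submodule.subset_span ⟨l ++ l', by simp [hl, hl'], by simp⟩
  exact this (Submodule.mul_mem_mul ha hb)

theorem iSup_gr : ⨆ d, gr k n d = ⊤ := by
  have key : ∀ a : FreeAlgebra k (NHGen n),
      RingQuot.mkAlgHom k (Rel k n) a ∈ ⨆ d, gr k n d := by
    have hmul : ∀ a b : NilHecke k n, a ∈ (⨆ d, gr k n d) → b ∈ (⨆ d, gr k n d) →
        a * b ∈ ⨆ d, gr k n d := by
      intro a b ha hb
      have h := Submodule.mul_mem_mul ha hb
      rw [Submodule.iSup_mul] at h
      simp only [Submodule.mul_iSup] at h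
      have hle : ⨆ i, ⨆ j, gr k n i * gr k n j ≤ ⨆ d, gr k n d :=
        iSup_le fun i => iSup_le fun j => ?_
      · exact hle h
      exact le_trans (Submodule.mul_le.2 fun a ha b hb => mul_mem_gr ha hb)
        (le_iSup (gr k n) (i + j))
    intro a
    induction a using FreeAlgebra.induction with
    | grade0 c =>
      rw [AlgHom.commutes, Algebra.algebraMap_eq_smul_one]
      exact Submodule.smul_mem _ _ (Submodule.mem_iSup_of_mem 0 one_mem_gr)
    | grade1 g => exact Submodule.mem_iSup_of_mem _ (gen_mem_gr g)
    | mul a b ha hb => rw [map_mul]; exact hmul _ _ ha hb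
    | add a b ha hb => rw [map_add]; exact add_mem ha hb
  rw [eq_top_iff]
  intro w _
  obtain ⟨a, rfl⟩ := RingQuot.mkAlgHom_surjective k (Rel k n) w
  exact key a

theorem satisfies_single :
    Satisfies (n := n) (B := AddMonoidAlgebra (NilHecke k n) ℤ)
      (fun i => AddMonoidAlgebra.single 2 (x i)) (fun i => AddMonoidAlgebra.single (-2) (δ i)) where
  δ_sq i := by simp only [AddMonoidAlgebra.single_mul_single, δ_sq, AddMonoidAlgebra.single_zero]
  braid i j h := by simp only [AddMonoidAlgebra.single_mul_single, braid i j h]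
  δ_comm i j h := by simp only [AddMonoidAlgebra.single_mul_single, δ_comm i j h]
  x_δ_comm i j h₁ h₂ := by
    simp only [AddMonoidAlgebra.single_mul_single, x_δ_comm i j h₁ h₂, add_comm (2 : ℤ)]
  x_comm i j := by simp only [AddMonoidAlgebra.single_mul_single, x_comm i j]
  x_δ i := by
    rw [AddMonoidAlgebra.single_mul_single, AddMonoidAlgebra.single_mul_single,
      add_comm (-2 : ℤ) 2, ← AddMonoidAlgebra.single_sub, x_δ]
    rfl
  δ_x i := by
    rw [AddMonoidAlgebra.single_mul_single, AddMonoidAlgebra.single_mul_single,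
      add_comm (-2 : ℤ) 2, ← AddMonoidAlgebra.single_sub, δ_x]
    rfl

theorem lift_single {d : ℤ} {w : NilHecke k n} (hw : w ∈ gr k n d) :
    lift (k := k) (satisfies_single (k := k) (n := n)) w = AddMonoidAlgebra.single d w := by
  induction hw using Submodule.span_induction with
  | mem w h =>
    obtain ⟨l, rfl, rfl⟩ := h
    induction l with
    | nil => rw [List.map_nil, List.prod_nil, map_one]; rfl
    | cons g l ih =>
      rw [List.map_cons, List.prod_cons, map_mul, ih, List.map_cons, List.sum_cons,
        ← AddMonoidAlgebra.single_mul_single]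
      congr 1
      cases g with
      | x i => exact lift_x _ i
      | δ i => exact lift_δ _ i
  | zero => rw [map_zero, AddMonoidAlgebra.single_zero]
  | add a b _ _ ha hb => rw [map_add, ha, hb, AddMonoidAlgebra.single_add]
  | smul c a _ ha => rw [map_smul, ha, AddMonoidAlgebra.smul_single]

theorem gr_internal : DirectSum.IsInternal (gr k n) := by
  rw [DirectSum.isInternal_submodule_iff_iSupIndep_and_iSup_eq_top]
  refine ⟨?_, iSup_gr⟩
  rw [iSupIndep_iff_finsetSum_eq_zero_imp_eq_zero]
  intro s v hv h0 i hi
  have h1 := congrArg (lift (k := k) (satisfies_single (k := k) (n := n))) h0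
  rw [map_sum, map_zero, Finset.sum_congr rfl fun j hj => lift_single (hv j hj)] at h1
  have h2 := congrArg (fun f : AddMonoidAlgebra (NilHecke k n) ℤ => f.coeff i) h1
  simpa [-LaurentPolynomial.single_eq_C_mul_T, AddMonoidAlgebra.coeff_sum,
    Finsupp.single_apply, Finset.sum_ite_eq', hi] using h2

/-! #### The differential -/

/-- The value `a - (a + 1) x_i δ_i + (a - 1) x_{i+1} δ_i` of the differential on `δ_i`. -/
noncomputable def dδ (c : k) (i : Fin (n - 1)) : NilHecke k n :=
  algebraMap k _ c - (c + 1) • (x (lo i) * δ i) + (c - 1) • (x (hi i) * δ i)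

theorem lo_ne_hi (i : Fin (n - 1)) : lo i ≠ hi i := by
  simp [lo, hi, Fin.ext_iff]

theorem δ_mul_lo (i : Fin (n - 1)) :
    (δ i : NilHecke k n) * x (lo i) = x (hi i) * δ i + 1 := by
  rw [← δ_x i]; abel

theorem δ_mul_hi (i : Fin (n - 1)) :
    (δ i : NilHecke k n) * x (hi i) = x (lo i) * δ i - 1 := by
  rw [← x_δ i]; abel

/-- Rewriting a product inside a longer product. -/
theorem reassoc {R : Type*} [Ring R] {a b c : R} (h : a * b = c) (z : R) : a * (b * z) = c * z := by
  rw [← mul_assoc, h]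

theorem satisfies_dual (c : k) :
    Satisfies (n := n) (B := TrivSqZeroExt (NilHecke k n) (NilHecke k n))
      (fun i => (x i, x i ^ 2)) (fun i => (δ i, dδ c i)) where
  δ_sq i := by
    apply TrivSqZeroExt.ext
    · exact δ_sq i
    · change δ i * dδ c i + dδ c i * δ i = 0
      simp only [dδ, mul_add, add_mul, mul_sub, sub_mul, smul_mul_assoc, mul_smul_comm, mul_assoc,
        δ_sq, reassoc (δ_mul_lo i), reassoc (δ_mul_hi i), Algebra.algebraMap_eq_smul_one, mul_one,
        one_mul, mul_zero, smul_zero, zero_add]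
      module
  braid i j h := by
    apply TrivSqZeroExt.ext
    · exact braid i j h
    · change δ i * δ j * dδ c i + (δ i * dδ c j + dδ c i * δ j) * δ i =
        δ j * δ i * dδ c j + (δ j * dδ c i + dδ c j * δ i) * δ j
      have e : lo j = hi i := Fin.ext h.symm
      have h1 := (x_δ_comm (k := k) (hi j) i (by simp [lo, hi, Fin.ext_iff]; omega)
        (by simp [hi, Fin.ext_iff]; omega)).symm
      have h2 := (x_δ_comm (k := k) (lo i) j (by simp [lo, Fin.ext_iff]; omega)
        (by simp [lo, hi, Fin.ext_iff]; omega)).symm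
      have h3 := δ_mul_lo (k := k) j
      rw [e] at h3
      have h4 := δ_mul_hi (k := k) j
      rw [e] at h4
      have h5 := braid (k := k) i j h
      rw [mul_assoc, mul_assoc] at h5
      simp only [dδ, e, mul_add, add_mul, mul_sub, sub_mul, smul_mul_assoc, mul_smul_comm,
        mul_assoc, δ_sq, reassoc (δ_mul_lo i), reassoc (δ_mul_hi i), reassoc h1, reassoc h2,
        reassoc h3, reassoc h4, h5, Algebra.algebraMap_eq_smul_one, mul_one, one_mul, mul_zero,
        smul_zero]
      module
  δ_comm i j h := by
    apply TrivSqZeroExt.ext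
    · exact δ_comm i j h
    · change δ i * dδ c j + dδ c i * δ j = δ j * dδ c i + dδ c j * δ i
      have h1 := (x_δ_comm (k := k) (lo j) i (by simp [lo, Fin.ext_iff]; omega)
        (by simp [lo, hi, Fin.ext_iff]; omega)).symm
      have h2 := (x_δ_comm (k := k) (hi j) i (by simp [lo, hi, Fin.ext_iff]; omega)
        (by simp [hi, Fin.ext_iff]; omega)).symm
      have h3 := (x_δ_comm (k := k) (lo i) j (by simp [lo, Fin.ext_iff]; omega)
        (by simp [lo, hi, Fin.ext_iff]; omega)).symm
      have h4 := (x_δ_comm (k := k) (hi i) j (by simp [lo, hi, Fin.ext_iff]; omega)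
        (by simp [hi, Fin.ext_iff]; omega)).symm
      simp only [dδ, mul_add, add_mul, mul_sub, sub_mul, smul_mul_assoc, mul_smul_comm, mul_assoc,
        reassoc h1, reassoc h2, reassoc h3, reassoc h4, δ_comm i j h,
        Algebra.algebraMap_eq_smul_one, mul_one, one_mul]
      module
  x_δ_comm i j h₁ h₂ := by
    apply TrivSqZeroExt.ext
    · exact x_δ_comm i j h₁ h₂
    · change x i * dδ c j + x i ^ 2 * δ j = δ j * x i ^ 2 + dδ c j * x i
      have h := (x_δ_comm (k := k) i j h₁ h₂).symm
      simp only [dδ, mul_add, add_mul, mul_sub, sub_mul, smul_mul_assoc, mul_smul_comm, mul_assoc,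
        Algebra.algebraMap_eq_smul_one, mul_one, one_mul, pow_two, h, reassoc h,
        reassoc (x_comm i (lo j)), reassoc (x_comm i (hi j))]
      module
  x_comm i j := by
    apply TrivSqZeroExt.ext
    · exact x_comm i j
    · change x i * x j ^ 2 + x i ^ 2 * x j = x j * x i ^ 2 + x j ^ 2 * x i
      have h : Commute (x i : NilHecke k n) (x j) := x_comm i j
      rw [(h.pow_right 2).eq, (h.pow_left 2).eq, add_comm]
  x_δ i := by
    apply TrivSqZeroExt.ext
    · exact x_δ i
    · change (x (lo i) * dδ c i + x (lo i) ^ 2 * δ i) - (δ i * x (hi i) ^ 2 + dδ c i * x (hi i)) = 0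
      simp only [dδ, mul_add, add_mul, mul_sub, sub_mul, smul_mul_assoc, mul_smul_comm, mul_assoc,
        Algebra.algebraMap_eq_smul_one, mul_one, one_mul, pow_two, δ_mul_hi, reassoc (δ_mul_hi i),
        reassoc (x_comm (hi i) (lo i))]
      module
  δ_x i := by
    apply TrivSqZeroExt.ext
    · exact δ_x i
    · change (δ i * x (lo i) ^ 2 + dδ c i * x (lo i)) - (x (hi i) * dδ c i + x (hi i) ^ 2 * δ i) = 0
      simp only [dδ, mul_add, add_mul, mul_sub, sub_mul, smul_mul_assoc, mul_smul_comm, mul_assoc,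
        Algebra.algebraMap_eq_smul_one, mul_one, one_mul, pow_two, δ_mul_lo, reassoc (δ_mul_lo i),
        reassoc (x_comm (hi i) (lo i))]
      module

theorem fst_lift_dual (c : k) (w : NilHecke k n) :
    (lift (k := k) (satisfies_dual (n := n) c) w).fst = w := by
  have : (TrivSqZeroExt.fstHom k (NilHecke k n) (NilHecke k n)).comp
      (lift (k := k) (satisfies_dual (n := n) c)) = AlgHom.id k _ := by
    apply algHom_ext
    rintro (i | i)
    · exact congrArg TrivSqZeroExt.fst (lift_x (satisfies_dual c) i)
    · exact congrArg TrivSqZeroExt.fst (lift_δ (satisfies_dual c) i)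
  exact DFunLike.congr_fun this w

/-- The derivation of the nilHecke algebra with `x_i ↦ x_i ^ 2` and
`δ_i ↦ c - (c + 1) x_i δ_i + (c - 1) x_{i+1} δ_i`. -/
noncomputable def diff (c : k) : Module.End k (NilHecke k n) :=
  (TrivSqZeroExt.sndHom (NilHecke k n) (NilHecke k n)).restrictScalars k ∘ₗ
    (lift (k := k) (satisfies_dual (n := n) c)).toLinearMap

theorem diff_x (c : k) (i : Fin n) : diff c (x i : NilHecke k n) = x i ^ 2 :=
  congrArg TrivSqZeroExt.snd (lift_x (satisfies_dual c) i)

theorem diff_δ (c : k) (i : Fin (n - 1)) : diff c (δ i : NilHecke k n) = dδ c i :=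
  congrArg TrivSqZeroExt.snd (lift_δ (satisfies_dual c) i)

theorem diff_apply (c : k) (w : NilHecke k n) :
    diff c w = (lift (k := k) (satisfies_dual (n := n) c) w).snd := rfl

theorem diff_mul (c : k) (a b : NilHecke k n) : diff c (a * b) = diff c a * b + a * diff c b := by
  rw [diff_apply, diff_apply, diff_apply, map_mul, TrivSqZeroExt.snd_mul, fst_lift_dual,
    fst_lift_dual, smul_eq_mul, op_smul_eq_mul, add_comm]

theorem diff_one (c : k) : diff c (1 : NilHecke k n) = 0 := by
  have h := diff_mul c (1 : NilHecke k n) 1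
  rw [mul_one, mul_one, one_mul] at h
  simpa using h

theorem x_mem_gr (i : Fin n) : (x i : NilHecke k n) ∈ gr k n 2 :=
  Submodule.subset_span ⟨[NHGen.x i], by simp [degree], by simp⟩

theorem δ_mem_gr (i : Fin (n - 1)) : (δ i : NilHecke k n) ∈ gr k n (-2) :=
  Submodule.subset_span ⟨[NHGen.δ i], by simp [degree], by simp⟩

theorem diff_gen_mem (c : k) (g : NHGen n) :
    diff c (gen g : NilHecke k n) ∈ gr k n (degree g + 2) := by
  cases g with
  | x i =>
    rw [diff_x, pow_two]
    simp only [degree]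
    exact mul_mem_gr (x_mem_gr i) (x_mem_gr i)
  | δ i =>
    rw [diff_δ, dδ, Algebra.algebraMap_eq_smul_one]
    have hd : degree (NHGen.δ i) + 2 = 0 := by simp [degree]
    have h : ∀ j, (x j * δ i : NilHecke k n) ∈ gr k n 0 := fun j => by
      have := mul_mem_gr (x_mem_gr (k := k) j) (δ_mem_gr i)
      rwa [add_neg_cancel] at this
    rw [hd]
    exact add_mem (sub_mem (Submodule.smul_mem _ _ one_mem_gr) (Submodule.smul_mem _ _ (h _)))
      (Submodule.smul_mem _ _ (h _))

theorem diff_mem (c : k) {d : ℤ} {w : NilHecke k n} (hw : w ∈ gr k n d) :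
    diff c w ∈ gr k n (d + 2) := by
  induction hw using Submodule.span_induction with
  | mem w h =>
    obtain ⟨l, rfl, rfl⟩ := h
    induction l with
    | nil => simp only [List.map_nil, List.prod_nil, diff_one]; exact zero_mem _
    | cons g l ih =>
      simp only [List.map_cons, List.prod_cons, List.sum_cons]
      rw [diff_mul]
      have hl : ((l.map gen).prod : NilHecke k n) ∈ gr k n (l.map degree).sum :=
        Submodule.subset_span ⟨l, rfl, rfl⟩
      refine add_mem ?_ ?_
      · have := mul_mem_gr (diff_gen_mem c g) hl
        rwa [show degree g + 2 + (l.map degree).sum = degree g + (l.map degree).sum + 2 by ring]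
          at this
      · have := mul_mem_gr (gen_mem_gr (k := k) g) ih
        rwa [← add_assoc] at this
  | zero => rw [map_zero]; exact zero_mem _
  | add a b _ _ ha hb => rw [map_add]; exact add_mem ha hb
  | smul c a _ ha => rw [map_smul]; exact Submodule.smul_mem _ _ ha

/-! #### Nilpotency of the differential -/

section Nilpotent

variable {p : ℕ} [Fact p.Prime] [CharP k p]

open MvPolynomial in
/-- The operator on `k[X, Y]δ ⊕ k[X, Y]` that models the differential on the span of `δ_i` and `1`
over `k[x_i, x_{i+1}]`. -/
noncomputable def model (c : k) :
    Module.End k (MvPolynomial (Fin 2) k × MvPolynomial (Fin 2) k) where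
  toFun f := (polD k 2 f.1 + f.1 * (C (c - 1) * X 1 - C (c + 1) * X 0), polD k 2 f.2 + C c * f.1)
  map_add' f g := by ext1 <;> simp <;> ring
  map_smul' r f := by ext1 <;> simp [smul_eq_C_mul] <;> ring

open MvPolynomial in
theorem model_smul (c : k) (r : MvPolynomial (Fin 2) k) (f) :
    model c (r • f) = (polD k 2).toLinearMap r • f + r • model c f := by
  ext1 <;> simp [model] <;> ring

open MvPolynomial in
theorem model_pow (a : ZMod p) :
    ((model (ZMod.castHom (dvd_refl p) k a)) ^ p) (1, 0) = 0 := by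
  set c := ZMod.castHom (dvd_refl p) k a with hc
  let s : MvPolynomial (Fin 2) k × MvPolynomial (Fin 2) k := (-(X 0 - X 1), 1)
  let α : Fin 2 → ZMod p := ![-a, a]
  have h1 : ∀ r : MvPolynomial (Fin 2) k, model c (r • s) = twistD p k α r • s := by
    intro r
    have e0 : ZMod.castHom (dvd_refl p) k (α 0) = -c := by rw [hc, ← map_neg]; rfl
    have e1 : ZMod.castHom (dvd_refl p) k (α 1) = c := rfl
    rw [twistD_apply, Fin.sum_univ_two, e0, e1]
    clear_value c
    ext1 <;> simp [model, s, polD] <;> ring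
  have h2 : ∀ (m : ℕ) (r : MvPolynomial (Fin 2) k),
      (model c ^ m) (r • s) = (twistD p k α ^ m) r • s := by
    intro m
    induction m with
    | zero => intro r; rfl
    | succ m ih =>
      intro r
      rw [pow_succ, pow_succ, Module.End.mul_apply, Module.End.mul_apply, h1, ih]
  have h3 : (model c ^ p) s = 0 := by
    have := h2 p 1
    rwa [twistD_pow, one_smul, LinearMap.zero_apply, zero_smul] at this
  have h4 : (model c ^ p) (0, 1) = 0 := by
    have h0 : model c (0, 1) = 0 := by ext1 <;> simp [model]
    have hp : p = (p - 1) + 1 := (Nat.succ_pred_eq_of_pos (Fact.out : p.Prime).pos).symm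
    rw [hp, pow_succ, Module.End.mul_apply, h0, map_zero]
  have h5 : ((X 0 - X 1 : MvPolynomial (Fin 2) k)) •
      ((1, 0) : MvPolynomial (Fin 2) k × MvPolynomial (Fin 2) k) = (0, 1) - s := by
    ext1 <;> simp [s]
  have h6 := leibniz_pow_prime p _ (model c) (model_smul c) (X 0 - X 1) (1, 0)
  rw [h5, map_sub, h4, h3, polD_pow] at h6
  simp only [LinearMap.zero_apply, zero_smul, zero_add, sub_zero] at h6
  have h7 : (X 0 - X 1 : MvPolynomial (Fin 2) k) ≠ 0 := by
    rw [sub_ne_zero]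
    intro h
    exact absurd (X_injective h) (by decide)
  exact (smul_eq_zero.1 h6.symm).resolve_left h7

open MvPolynomial in
/-- The substitution `X ↦ x_i`, `Y ↦ x_{i+1}`. -/
theorem exists_subst (i : Fin (n - 1)) :
    ∃ φ : MvPolynomial (Fin 2) k →ₐ[k] NilHecke k n, φ (X 0) = x (lo i) ∧ φ (X 1) = x (hi i) := by
  let S : Subalgebra k (NilHecke k n) := Algebra.adjoin k (Set.range fun j => x j)
  have hS : ∀ a b : S, a * b = b * a := by
    have := Algebra.isMulCommutative_adjoin k (s := Set.range fun j => (x j : NilHecke k n))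
      (by rintro _ ⟨i, rfl⟩ _ ⟨j, rfl⟩; exact x_comm i j)
    exact fun a b => this.is_comm.comm a b
  let _ : CommRing S := { (inferInstance : Ring S) with mul_comm := hS }
  let g : Fin 2 → S := ![⟨x (lo i), Algebra.subset_adjoin ⟨_, rfl⟩⟩,
    ⟨x (hi i), Algebra.subset_adjoin ⟨_, rfl⟩⟩]
  refine ⟨S.val.comp (aeval g), ?_, ?_⟩
  · rw [AlgHom.comp_apply, aeval_X]; rfl
  · rw [AlgHom.comp_apply, aeval_X]; rfl

open MvPolynomial in
theorem diff_subst (c : k) (i : Fin (n - 1)) (φ : MvPolynomial (Fin 2) k →ₐ[k] NilHecke k n)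
    (h0 : φ (X 0) = x (lo i)) (h1 : φ (X 1) = x (hi i)) (f : MvPolynomial (Fin 2) k) :
    diff c (φ f) = φ (polD k 2 f) := by
  induction f using MvPolynomial.induction_on with
  | C r =>
    have : φ (C r) = r • 1 := by
      rw [← algebraMap_eq, AlgHom.commutes, Algebra.algebraMap_eq_smul_one]
    rw [this, map_smul, diff_one, smul_zero, derivation_C, map_zero]
  | add f g hf hg => rw [map_add, map_add, map_add, map_add, hf, hg]
  | mul_X f j hf =>
    have hX : diff c (φ (X j)) = φ (X j ^ 2) := by
      rw [map_pow]
      fin_cases j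
      · exact (congrArg (diff c) h0).trans ((diff_x c _).trans (congrArg (· ^ 2) h0.symm))
      · exact (congrArg (diff c) h1).trans ((diff_x c _).trans (congrArg (· ^ 2) h1.symm))
    have e : polD k 2 (X j) = X j ^ 2 := mkDerivation_X _ _ _
    rw [map_mul, diff_mul, hf, hX, Derivation.leibniz, e, smul_eq_mul, smul_eq_mul, map_add,
      mul_comm (X j), map_mul, map_mul, add_comm]

open MvPolynomial in
theorem diff_pow_δ (a : ZMod p) (i : Fin (n - 1)) :
    (diff (ZMod.castHom (dvd_refl p) k a) ^ p) (δ i : NilHecke k n) = 0 := by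
  have hm := model_pow (k := k) a
  generalize ZMod.castHom (dvd_refl p) k a = c at hm ⊢
  obtain ⟨φ, h0, h1⟩ := exists_subst (k := k) i
  let ψ : MvPolynomial (Fin 2) k × MvPolynomial (Fin 2) k → NilHecke k n :=
    fun f => φ f.1 * δ i + φ f.2
  have hC : ∀ r : k, φ (C r) = r • 1 := fun r => by
    rw [← algebraMap_eq, AlgHom.commutes, Algebra.algebraMap_eq_smul_one]
  have hψ : ∀ f, diff c (ψ f) = ψ (model c f) := by
    intro f
    change diff c (φ f.1 * δ i + φ f.2) =
      φ (polD k 2 f.1 + f.1 * (C (c - 1) * X 1 - C (c + 1) * X 0)) * δ i +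
        φ (polD k 2 f.2 + C c * f.1)
    rw [map_add, diff_mul, diff_subst c i φ h0 h1, diff_subst c i φ h0 h1, diff_δ, dδ,
      mul_comm (C c)]
    simp only [map_add, map_mul, map_sub, h0, h1]
    simp only [hC, Algebra.algebraMap_eq_smul_one]
    simp only [mul_add, add_mul, mul_sub, sub_mul, smul_mul_assoc, mul_smul_comm, mul_one, one_mul,
      mul_assoc]
    module
  have key : ∀ (m : ℕ) f, (diff c ^ m) (ψ f) = ψ ((model c ^ m) f) := by
    intro m
    induction m with
    | zero => intro f; rfl
    | succ m ih =>
      intro f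
      rw [pow_succ, pow_succ, Module.End.mul_apply, Module.End.mul_apply, hψ, ih]
  have e : (δ i : NilHecke k n) = ψ (1, 0) := by simp [ψ]
  rw [e, key, hm]
  simp [ψ]

theorem diff_pow (a : ZMod p) :
    (diff (ZMod.castHom (dvd_refl p) k a) : Module.End k (NilHecke k n)) ^ p = 0 := by
  set c := ZMod.castHom (dvd_refl p) k a with hc
  have h1 : ∀ l : List (NHGen n), (diff c ^ p) ((l.map gen).prod : NilHecke k n) = 0 := by
    intro l
    induction l with
    | nil =>
      have hp : p = (p - 1) + 1 := (Nat.succ_pred_eq_of_pos (Fact.out : p.Prime).pos).symm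
      rw [List.map_nil, List.prod_nil, hp, pow_succ, Module.End.mul_apply, diff_one, map_zero]
    | cons g l ih =>
      rw [List.map_cons, List.prod_cons, pow_apply_mul _ (diff_mul c), ih, mul_zero, add_zero]
      cases g with
      | x i => rw [pow_apply_generator _ (diff_mul c) (diff_x c i), zero_mul]
      | δ i => rw [hc, diff_pow_δ, zero_mul]
  apply LinearMap.ext
  intro w
  have hw : w ∈ ⨆ d, gr k n d := iSup_gr (k := k) (n := n) ▸ Submodule.mem_top
  induction hw using Submodule.iSup_induction' with
  | mem d w hw =>
    induction hw using Submodule.span_induction with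
    | mem w h => obtain ⟨l, _, rfl⟩ := h; exact h1 l
    | zero => simp
    | add a b _ _ ha hb => rw [map_add, ha, hb]; simp
    | smul r a _ ha => rw [map_smul, ha]; simp
  | zero => simp
  | add a b _ _ ha hb => rw [map_add, ha, hb]; simp

end Nilpotent

end NilHecke

/-- The `p`-DG algebra `(NH_n, ∂_a)`. -/
noncomputable def nilHeckePDG (p : ℕ) [Fact p.Prime] (k : Type u) [Field k] [CharP k p] (n : ℕ)
    (a : ZMod p) : PDGAlgebra p k where
  carrier := NilHecke k n
  gr := NilHecke.gr k n
  internal := NilHecke.gr_internal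
  one_mem := NilHecke.one_mem_gr
  mul_mem := NilHecke.mul_mem_gr
  d := NilHecke.diff (ZMod.castHom (dvd_refl p) k a)
  d_mem := NilHecke.diff_mem _
  leibniz := NilHecke.diff_mul _
  d_pow := NilHecke.diff_pow a

/-! ### The matrix presentation of the nilHecke algebra -/

section Matrices

open MvPolynomial

/-- `(V, gr, d)` is a free graded module over `H = k[∂]/(∂ᵖ)`, where `∂` acts by `d`: it has
homogeneous free generators `e j`, in other words, the `∂ⁱ e j` with `i < p` are a basis of `V`. -/
def IsFreeGradedH (p : ℕ) {k V : Type*} [Field k] [AddCommGroup V] [Module k V]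
    (gr : ℤ → Submodule k V) (d : Module.End k V) : Prop :=
  d ^ p = 0 ∧ ∃ (ι : Type) (deg : ι → ℤ) (e : ι → V) (b : Module.Basis (ι × Fin p) k V),
    (∀ j, e j ∈ gr (deg j)) ∧ ∀ j i, b (j, i) = (d ^ i.val) (e j)

/-- The grading of `END_k(V)`: degree `m` consists of the maps that raise degrees by `m`. -/
def endGr {k V : Type*} [Field k] [AddCommGroup V] [Module k V] (gr : ℤ → Submodule k V) (m : ℤ) :
    Submodule k (Module.End k V) where
  carrier := {f | ∀ i, ∀ v ∈ gr i, f v ∈ gr (i + m)}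
  add_mem' hf hg i v hv := add_mem (hf i v hv) (hg i v hv)
  zero_mem' _ _ _ := zero_mem _
  smul_mem' c _ hf i v hv := Submodule.smul_mem _ c (hf i v hv)

/-- The grading of a tensor product. -/
def tensorGr {k V W : Type*} [Field k] [AddCommGroup V] [Module k V] [AddCommGroup W] [Module k W]
    (gV : ℤ → Submodule k V) (gW : ℤ → Submodule k W) (m : ℤ) : Submodule k (V ⊗[k] W) :=
  Submodule.span k {t | ∃ i j : ℤ, i + j = m ∧ ∃ v ∈ gV i, ∃ w ∈ gW j, t = v ⊗ₜ[k] w}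

/-- The differential `v ⊗ w ↦ d v ⊗ w + v ⊗ d w` of a tensor product. -/
noncomputable def tensorD {k V W : Type*} [Field k] [AddCommGroup V] [Module k V] [AddCommGroup W]
    [Module k W] (dV : Module.End k V) (dW : Module.End k W) : Module.End k (V ⊗[k] W) :=
  dV.rTensor W + dW.lTensor V

/-- The space `U_{n,s}` spanned by the `x^b` with `b_{s(t)} ≤ n - t` for `t = 1, …, n` (the index
`t` starts from `0` here). -/
noncomputable def U (k : Type*) [Field k] (n : ℕ) (s : Equiv.Perm (Fin n)) :
    Submodule k (MvPolynomial (Fin n) k) :=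
  Submodule.span k {f | ∃ b : Fin n →₀ ℕ,
    (∀ t : Fin n, b (s t) ≤ n - (t.val + 1)) ∧ f = monomial b 1}

/-- The grading of `U_{n,s}` as a subspace of `k[x_1, …, x_n] 1_α`. -/
noncomputable def uGr (k : Type u) [Field k] (n : ℕ) (s : Equiv.Perm (Fin n)) (m : ℤ) :
    Submodule k (U k n s) := (balancedGr k n m).comap (U k n s).subtype

/-- The algebra of symmetric polynomials. -/
abbrev Sym (k : Type u) [Field k] (n : ℕ) := MvPolynomial.symmetricSubalgebra (Fin n) k

/-- The grading of the symmetric polynomials, with `deg x_i = 2`. -/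
noncomputable def symGr (k : Type u) [Field k] (n : ℕ) (m : ℤ) : Submodule k (Sym k n) :=
  (Submodule.span k {f : MvPolynomial (Fin n) k | ∃ b : Fin n →₀ ℕ,
    2 * (b.degree : ℤ) = m ∧ f = monomial b 1}).comap (Sym k n).val.toLinearMap

theorem rename_polD {k : Type u} [Field k] {n : ℕ} (e : Equiv.Perm (Fin n))
    (f : MvPolynomial (Fin n) k) : rename e (polD k n f) = polD k n (rename e f) := by
  have hX : ∀ j, polD k n (X j) = X j ^ 2 := fun j => mkDerivation_X _ _ _
  induction f using MvPolynomial.induction_on with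
  | C r => simp
  | add f g hf hg => simp only [map_add, hf, hg]
  | mul_X f j hf =>
    have h1 : rename e (f * X j) = rename e f * X (e j) := by rw [map_mul, rename_X]
    rw [h1, Derivation.leibniz, Derivation.leibniz, hX, hX, smul_eq_mul, smul_eq_mul,
      smul_eq_mul, smul_eq_mul, map_add, map_mul, map_mul, map_pow, rename_X, hf]

/-- The differential `x_i ↦ x_i ^ 2` on the symmetric polynomials. -/
noncomputable def symD (k : Type u) [Field k] (n : ℕ) : Module.End k (Sym k n) where
  toFun f := ⟨polD k n f, fun e => by rw [rename_polD, f.2 e]⟩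
  map_add' f g := Subtype.ext (map_add (polD k n) f.1 g.1)
  map_smul' c f := Subtype.ext ((polD k n).map_smul c f.1)

/-- The map `U_{n,s} ⊗ Sym_n ⟶ k[x_1, …, x_n]`, `u ⊗ f ↦ f u`. -/
noncomputable def uMul (k : Type u) [Field k] (n : ℕ) (s : Equiv.Perm (Fin n)) :
    U k n s ⊗[k] Sym k n →ₗ[k] MvPolynomial (Fin n) k :=
  LinearMap.mul' k (MvPolynomial (Fin n) k) ∘ₗ
    TensorProduct.map (U k n s).subtype (Sym k n).val.toLinearMap

/-- The action of `END_k(V) ⊗ R` on `V ⊗ R`: `(φ ⊗ r) (v ⊗ f) = φ v ⊗ r f`. -/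
noncomputable def matAct (k V R : Type*) [Field k] [AddCommGroup V] [Module k V] [CommRing R]
    [Algebra k R] : Module.End k V ⊗[k] R →ₗ[k] Module.End k (V ⊗[k] R) :=
  TensorProduct.homTensorHomMap (.id k) V R V R ∘ₗ (Algebra.lmul k R).toLinearMap.lTensor _

/-- The parameters `α = (α_1, α_1 + a, …, α_1 + (n - 1) a)`. -/
def weights {p : ℕ} (n : ℕ) (a α₁ : ZMod p) (t : Fin n) : ZMod p := α₁ + (t.val : ZMod p) * a

/-- `Φ` is an isomorphism of `p`-DG algebras `(NH_p, ∂_a) ≅ END_k(U_{p,s}) ⊗ Sym_p`, where `dU` is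
the differential of `U_{p,s}`. -/
def IsPDGIso (p : ℕ) [Fact p.Prime] {k : Type u} [Field k] [CharP k p] (a : ZMod p)
    (s : Equiv.Perm (Fin p)) (dU : Module.End k (U k p s))
    (Φ : NilHecke k p ≃ₐ[k] Module.End k (U k p s) ⊗[k] Sym k p) : Prop :=
  (∀ m, (NilHecke.gr k p m).map Φ.toLinearMap = tensorGr (endGr (uGr k p s)) (symGr k p) m) ∧
    ∀ w, Φ ((nilHeckePDG p k p a).d w) = tensorD (hd dU dU) (symD k p) (Φ w)

/-- `Φ` is compatible with the map `u ⊗ f ↦ f u` and with the action of `NH_p` on polynomials, where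
`x_i` acts by multiplication and `δ_i` by the divided difference
`f ↦ (f - s_i f) / (x_i - x_{i+1})`. -/
def IsPolynomialAction (p : ℕ) {k : Type u} [Field k] (s : Equiv.Perm (Fin p))
    (Φ : NilHecke k p ≃ₐ[k] Module.End k (U k p s) ⊗[k] Sym k p) : Prop :=
  (∀ i t, uMul k p s (matAct k _ _ (Φ (NilHecke.x i)) t) = X i * uMul k p s t) ∧
    ∀ i t, (X (NilHecke.lo i) - X (NilHecke.hi i)) *
        uMul k p s (matAct k _ _ (Φ (NilHecke.δ i)) t) =
      uMul k p s t - rename (Equiv.swap (NilHecke.lo i) (NilHecke.hi i)) (uMul k p s t)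

end Matrices

end PDG

namespace PDG

namespace NilHecke

open MvPolynomial

variable {k : Type u} [Field k] {n : ℕ}

/-! ### Divided differences and the polynomial representation -/

/-! The nilHecke algebra acts on polynomials by multiplications and divided differences, and this
action commutes with symmetric polynomials. Let D be the longest divided difference, `longest k n
n`. Every δ_i kills D from the left, so Pol·D is a left ideal on which w acts on the coefficients
through the polynomial representation (`mul_pol_mul_longest`). Commutators with the x_j strip D down
to 1, so Pol·D·NH is the whole algebra (`one_mem_span`). Writing 1 as a sum of terms f·D·w gives
both faithfulness (`polRep_injective`) and the fact that every Sym-linear endomorphism of Pol is in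
the image (`exists_polRep_eq`). No basis of NH is needed.

A Vandermonde argument and division of the polynomial with roots x_1, …, x_n by its linear factors
show that the staircase monomials, for any order of the variables, are a basis of Pol over Sym
(`uMul_bijective`). Hence NH = End_Sym(Pol) = Hom_k(U, Pol) = END(U) ⊗ Sym (`matIso`). Because
successive entries of α differ by a, the action satisfies ∂_α(w f) = ∂_a(w) f + w ∂_α(f)
(`twistD_polRep`); so `matIso` carries ∂_a to the tensor product differential as soon as U is
∂_α-stable.

The operator ∂_α sends x^b to the sum of the (b_t + α_t) x_t x^b. For a ≠ 0 and p strands, α takes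
every value of F_p exactly once, and s is the order of the variables with α_{s(t)} = t for t = 1, …,
p. The coefficient then vanishes at the top step b_{s(t)} = p - t, so U is stable. For the variable
with index s(1) the coefficients below the top step are 1, …, p - 1, all invertible, so U is free
over H on the monomials without this variable (`isFreeGradedH_U`).

A free H-module has a contraction φ with ∑ d^(p-1-j) φ d^j = 1. In characteristic p this sum is the
(p-1)-st power of the commutator differential applied to φ (`homotopy_sum`), so φ ⊗ 1 corresponds to
an element y of NH_p of degree 2 - 2p with ∂^(p-1) y = 1. Adding strands gives such a y for all n ≥
p. Multiplication by y contracts every p-DG module over k, which makes the derived category a point,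
and the exact triangle M → M → M → M[1] then gives [M] = 0. -/

/-- Modulo x_i - x_j the swap is the identity on the variables, hence on all polynomials. The
induction uses the twisted Leibniz rule for f - s f. -/
theorem sub_dvd_sub_swap (i j : Fin n) (f : MvPolynomial (Fin n) k) :
    (X i - X j : MvPolynomial (Fin n) k) ∣ f - rename (Equiv.swap i j) f := by
  induction f using MvPolynomial.induction_on with
  | C c => simp
  | add f g hf hg =>
    rw [map_add, add_sub_add_comm]
    exact dvd_add hf hg
  | mul_X f l hf =>
    rw [map_mul, rename_X]
    have e : f * X l - rename (Equiv.swap i j) f * X (Equiv.swap i j l) =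
        (f - rename (Equiv.swap i j) f) * X l +
          rename (Equiv.swap i j) f * (X l - X (Equiv.swap i j l)) := by ring
    rw [e]
    refine dvd_add (hf.mul_right _) (Dvd.dvd.mul_left ?_ _)
    rcases eq_or_ne l i with rfl | hi
    · rw [Equiv.swap_apply_left]
    rcases eq_or_ne l j with rfl | hj
    · rw [Equiv.swap_apply_right, dvd_sub_comm]
    · rw [Equiv.swap_apply_of_ne_of_ne hi hj, sub_self]
      exact dvd_zero _

/-- The transposition of `x_i` and `x_{i+1}`. -/
noncomputable abbrev sw (k : Type u) [Field k] {n : ℕ} (i : Fin (n - 1)) :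
    MvPolynomial (Fin n) k →ₐ[k] MvPolynomial (Fin n) k :=
  rename (Equiv.swap (lo i) (hi i))

/-- The linear form `x_i - x_{i+1}`. -/
noncomputable abbrev root (k : Type u) [Field k] {n : ℕ} (i : Fin (n - 1)) :
    MvPolynomial (Fin n) k := X (lo i) - X (hi i)

theorem X_sub_X_ne_zero {i j : Fin n} (h : i ≠ j) : (X i - X j : MvPolynomial (Fin n) k) ≠ 0 :=
  sub_ne_zero.2 fun e => h (X_injective e)

theorem root_ne_zero (i : Fin (n - 1)) : root k i ≠ 0 := X_sub_X_ne_zero (lo_ne_hi i)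

/-- The divided difference of a polynomial. -/
noncomputable def ddFun (i : Fin (n - 1)) (f : MvPolynomial (Fin n) k) : MvPolynomial (Fin n) k :=
  (sub_dvd_sub_swap (lo i) (hi i) f).choose

theorem root_mul_ddFun (i : Fin (n - 1)) (f : MvPolynomial (Fin n) k) :
    root k i * ddFun i f = f - sw k i f :=
  (sub_dvd_sub_swap (lo i) (hi i) f).choose_spec.symm

/-- The divided difference operator `f ↦ (f - s_i f) / (x_i - x_{i+1})`. -/
noncomputable def dd (i : Fin (n - 1)) : Module.End k (MvPolynomial (Fin n) k) where
  toFun := ddFun i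
  map_add' f g := mul_left_cancel₀ (root_ne_zero (k := k) i) (by
    rw [mul_add, root_mul_ddFun, root_mul_ddFun, root_mul_ddFun, map_add]; ring)
  map_smul' c f := mul_left_cancel₀ (root_ne_zero (k := k) i) (by
    rw [RingHom.id_apply, mul_smul_comm, root_mul_ddFun, root_mul_ddFun, map_smul, smul_sub])

theorem root_mul_dd (i : Fin (n - 1)) (f : MvPolynomial (Fin n) k) :
    root k i * dd i f = f - sw k i f := root_mul_ddFun i f

theorem dd_eq_of_root_mul {i : Fin (n - 1)} {f g : MvPolynomial (Fin n) k}
    (h : root k i * g = f - sw k i f) : dd i f = g :=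
  mul_left_cancel₀ (root_ne_zero (k := k) i) ((root_mul_dd i f).trans h.symm)

theorem sw_sw (i : Fin (n - 1)) (f : MvPolynomial (Fin n) k) : sw k i (sw k i f) = f := by
  rw [rename_rename]
  convert rename_id_apply f
  ext x
  simp

theorem sw_root (i : Fin (n - 1)) : sw k i (root k i) = -root k i := by
  rw [map_sub, rename_X, rename_X, Equiv.swap_apply_left, Equiv.swap_apply_right, neg_sub]

theorem sw_dd (i : Fin (n - 1)) (f : MvPolynomial (Fin n) k) : sw k i (dd i f) = dd i f := by
  apply mul_left_cancel₀ (root_ne_zero (k := k) i)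
  have h := congrArg (sw k i) (root_mul_dd i f)
  rw [map_mul, sw_root, map_sub, sw_sw] at h
  rw [root_mul_dd]
  linear_combination -h

theorem dd_eq_zero {i : Fin (n - 1)} {f : MvPolynomial (Fin n) k} (h : sw k i f = f) :
    dd i f = 0 := dd_eq_of_root_mul (by rw [h, mul_zero, sub_self])

theorem sw_eq_of_dd_eq_zero {i : Fin (n - 1)} {f : MvPolynomial (Fin n) k} (h : dd i f = 0) :
    sw k i f = f := by
  have := root_mul_dd i f
  rw [h, mul_zero] at this
  exact (sub_eq_zero.1 this.symm).symm

theorem dd_mul (i : Fin (n - 1)) (f g : MvPolynomial (Fin n) k) :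
    dd i (f * g) = dd i f * g + sw k i f * dd i g := by
  apply dd_eq_of_root_mul
  rw [map_mul]
  linear_combination g * root_mul_dd i f + sw k i f * root_mul_dd i g

theorem dd_X_lo (i : Fin (n - 1)) : dd i (X (lo i) : MvPolynomial (Fin n) k) = 1 :=
  dd_eq_of_root_mul (by rw [rename_X, Equiv.swap_apply_left, mul_one])

theorem dd_X_hi (i : Fin (n - 1)) : dd i (X (hi i) : MvPolynomial (Fin n) k) = -1 :=
  dd_eq_of_root_mul (by rw [rename_X, Equiv.swap_apply_right]; ring)

theorem dd_X_of_ne {i : Fin (n - 1)} {l : Fin n} (h₁ : l ≠ lo i) (h₂ : l ≠ hi i) :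
    dd i (X l : MvPolynomial (Fin n) k) = 0 :=
  dd_eq_zero (by rw [rename_X, Equiv.swap_apply_of_ne_of_ne h₁ h₂])

theorem dd_X_mul_of_ne {i : Fin (n - 1)} {l : Fin n} (h₁ : l ≠ lo i) (h₂ : l ≠ hi i)
    (f : MvPolynomial (Fin n) k) : dd i (X l * f) = X l * dd i f := by
  rw [dd_mul, dd_X_of_ne h₁ h₂, zero_mul, zero_add, rename_X, Equiv.swap_apply_of_ne_of_ne h₁ h₂]

/-- Multiplying by both roots turns each side into f - s_i f - s_j f + s_i s_j f, which is symmetric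
in i and j because the two swaps commute. -/
theorem dd_comm {i j : Fin (n - 1)} (h : i.val + 1 < j.val ∨ j.val + 1 < i.val)
    (f : MvPolynomial (Fin n) k) : dd i (dd j f) = dd j (dd i f) := by
  have hs : ∀ g : MvPolynomial (Fin n) k, sw k i (sw k j g) = sw k j (sw k i g) := by
    intro g
    rw [rename_rename, rename_rename]
    congr 2
    rw [← Equiv.Perm.coe_mul, ← Equiv.Perm.coe_mul]
    congr 1
    apply Equiv.Perm.Disjoint.commute
    intro x
    by_cases hx : x = lo i ∨ x = hi i
    · right
      apply Equiv.swap_apply_of_ne_of_ne <;>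
        rcases hx with rfl | rfl <;> simp only [lo, hi, ne_eq, Fin.mk.injEq] <;> omega
    · left
      rw [not_or] at hx
      exact Equiv.swap_apply_of_ne_of_ne hx.1 hx.2
  have hr : ∀ {i j : Fin (n - 1)}, (i.val + 1 < j.val ∨ j.val + 1 < i.val) →
      sw k i (root k j) = root k j := by
    intro i j h
    rw [map_sub, rename_X, rename_X, Equiv.swap_apply_of_ne_of_ne, Equiv.swap_apply_of_ne_of_ne] <;>
      simp only [lo, hi, ne_eq, Fin.mk.injEq] <;> omega
  have key : ∀ {i j : Fin (n - 1)}, (i.val + 1 < j.val ∨ j.val + 1 < i.val) →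
      root k i * root k j * dd i (dd j f) = f - sw k i f - sw k j f + sw k i (sw k j f) := by
    intro i j h
    have h1 := root_mul_dd i (dd j f)
    have h2 := root_mul_dd j f
    have h3 := congrArg (sw k i) h2
    rw [map_mul, hr h, map_sub] at h3
    linear_combination root k j * h1 + h2 - h3
  apply mul_left_cancel₀ (mul_ne_zero (root_ne_zero (k := k) i) (root_ne_zero j))
  rw [key h, mul_comm (root k i), key h.symm, hs]
  ring

/-- Multiplying by the three roots x_i - x_{i+1}, x_{i+1} - x_{i+2} and their sum turns each side
into the alternating sum of f over the copy of S_3 generated by the two swaps. Its last term is s_i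
s_j s_i f = s_j s_i s_j f, so the sum is symmetric in i and j. -/
theorem dd_braid {i j : Fin (n - 1)} (h : i.val + 1 = j.val) (f : MvPolynomial (Fin n) k) :
    dd i (dd j (dd i f)) = dd j (dd i (dd j f)) := by
  have e : lo j = hi i := Fin.ext h.symm
  have n1 : lo i ≠ hi i := lo_ne_hi i
  have n2 : hi i ≠ hi j := by simp only [hi, ne_eq, Fin.mk.injEq]; omega
  have n3 : lo i ≠ hi j := by simp only [lo, hi, ne_eq, Fin.mk.injEq]; omega
  have hs : sw k i (sw k j (sw k i f)) = sw k j (sw k i (sw k j f)) := by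
    simp only [rename_rename, e]
    congr 2
    ext x
    simp only [Function.comp_apply, Equiv.swap_apply_def]
    split_ifs <;> simp_all
  have r1 : sw k i (root k j) = X (lo i) - X (hi j) := by
    rw [map_sub, rename_X, rename_X, e, Equiv.swap_apply_right,
      Equiv.swap_apply_of_ne_of_ne n3.symm n2.symm]
  have r2 : sw k j (root k i) = X (lo i) - X (hi j) := by
    rw [map_sub, rename_X, rename_X, e, Equiv.swap_apply_left, Equiv.swap_apply_of_ne_of_ne n1 n3]
  have r3 : sw k i (X (lo i) - X (hi j)) = root k j := by
    rw [map_sub, rename_X, rename_X, Equiv.swap_apply_left,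
      Equiv.swap_apply_of_ne_of_ne n3.symm n2.symm, root, e]
  have r4 : sw k j (X (lo i) - X (hi j)) = root k i := by
    rw [map_sub, rename_X, rename_X, e, Equiv.swap_apply_right, Equiv.swap_apply_of_ne_of_ne n1 n3]
  -- Here q is the third root. The hypotheses are symmetric enough for `key` to apply to (i, j) and
  -- to (j, i).
  have key : ∀ {i j : Fin (n - 1)} {q : MvPolynomial (Fin n) k}, sw k i (root k j) = q →
      sw k j (root k i) = q → sw k i q = root k j → q = root k i + root k j →
      root k i * root k j * q * dd i (dd j (dd i f)) =
        f - sw k i f - sw k j f + sw k j (sw k i f) + sw k i (sw k j f) -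
          sw k i (sw k j (sw k i f)) := by
    intro i j q h1 h2 h3 hq
    have a1 := root_mul_dd i f
    have a2 := root_mul_dd j (dd i f)
    have a3 := congrArg (sw k j) a1
    rw [map_mul, h2, map_sub] at a3
    have a4 := root_mul_dd i (dd j (dd i f))
    have a5 := congrArg (sw k i) a2
    rw [map_mul, h1, map_sub, sw_dd] at a5
    have a6 := congrArg (sw k i) a3
    rw [map_mul, h3, map_sub] at a6
    linear_combination
      root k j * q * a4 + q * a2 - a3 - root k j * a5 + a6 + a1 + dd i f * hq
  apply mul_left_cancel₀ (mul_ne_zero (mul_ne_zero (root_ne_zero (k := k) i) (root_ne_zero j))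
    (X_sub_X_ne_zero n3))
  have hq : X (lo i) - X (hi j) = root k i + root k j := by rw [root, root, e]; ring
  rw [key r1 r2 r3 hq, mul_comm (root k i), key r2 r1 r4 (hq.trans (add_comm _ _)), hs]
  ring

theorem satisfies_dd : Satisfies (n := n) (B := Module.End k (MvPolynomial (Fin n) k))
    (fun i => LinearMap.mulLeft k (X i)) dd where
  δ_sq i := LinearMap.ext fun f => by
    rw [Module.End.mul_apply, dd_eq_zero (sw_dd i f), LinearMap.zero_apply]
  braid i j h := LinearMap.ext fun f => by
    simp only [Module.End.mul_apply]
    exact dd_braid h f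
  δ_comm i j h := LinearMap.ext fun f => by
    simp only [Module.End.mul_apply]
    exact dd_comm h f
  x_δ_comm i j h₁ h₂ := LinearMap.ext fun f => by
    simp only [Module.End.mul_apply, LinearMap.mulLeft_apply]
    exact (dd_X_mul_of_ne h₁ h₂ f).symm
  x_comm i j := LinearMap.ext fun f => by
    simp only [Module.End.mul_apply, LinearMap.mulLeft_apply]
    exact mul_left_comm (X i) (X j) f
  x_δ i := LinearMap.ext fun f => by
    simp only [Module.End.mul_apply, LinearMap.mulLeft_apply, LinearMap.sub_apply,
      Module.End.one_apply]
    rw [dd_mul, dd_X_hi, rename_X, Equiv.swap_apply_right]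
    ring
  δ_x i := LinearMap.ext fun f => by
    simp only [Module.End.mul_apply, LinearMap.mulLeft_apply, LinearMap.sub_apply,
      Module.End.one_apply]
    rw [dd_mul, dd_X_lo, rename_X, Equiv.swap_apply_left]
    ring

/-- The polynomial representation of the nilHecke algebra. -/
noncomputable def polRep (k : Type u) [Field k] (n : ℕ) :
    NilHecke k n →ₐ[k] Module.End k (MvPolynomial (Fin n) k) := lift satisfies_dd

theorem polRep_x (i : Fin n) (f : MvPolynomial (Fin n) k) : polRep k n (x i) f = X i * f := by
  rw [polRep, lift_x]; rfl

theorem polRep_δ (i : Fin (n - 1)) : polRep k n (δ i) = dd i := lift_δ _ i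

/-- Induction on the number of generators. -/
theorem induction_on {P : NilHecke k n → Prop} (w : NilHecke k n)
    (smul_one : ∀ c : k, P (c • 1)) (add : ∀ v w, P v → P w → P (v + w))
    (x_mul : ∀ i w, P w → P (x i * w)) (δ_mul : ∀ i w, P w → P (δ i * w)) : P w := by
  have hw : w ∈ ⨆ d, gr k n d := iSup_gr (k := k) (n := n) ▸ Submodule.mem_top
  have h0 : P 0 := by simpa using smul_one 0
  have hl : ∀ (l : List (NHGen n)) (c : k), P (c • (l.map gen).prod) := by
    intro l c
    induction l with
    | nil => exact smul_one c
    | cons g l ih =>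
      rw [List.map_cons, List.prod_cons, ← mul_smul_comm]
      cases g with
      | x i => exact x_mul i _ ih
      | δ i => exact δ_mul i _ ih
  induction hw using Submodule.iSup_induction' with
  | mem d w hw =>
    obtain ⟨_, c, v, rfl⟩ := Submodule.mem_span_set'.1 hw
    refine Finset.sum_induction _ P add h0 fun i _ => ?_
    obtain ⟨l, -, e⟩ := (v i).2
    rw [e]
    exact hl l _
  | zero => exact h0
  | add v w _ _ hv hw => exact add v w hv hw

/-- The subalgebra generated by the `x_i` is a quotient of the polynomial ring. -/
theorem exists_polynomial_subst (k : Type u) [Field k] (n : ℕ) :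
    ∃ φ : MvPolynomial (Fin n) k →ₐ[k] NilHecke k n, ∀ i, φ (X i) = x i := by
  let S : Subalgebra k (NilHecke k n) := Algebra.adjoin k (Set.range fun j => x j)
  have hS : ∀ a b : S, a * b = b * a := by
    have := Algebra.isMulCommutative_adjoin k (s := Set.range fun j => (x j : NilHecke k n))
      (by rintro _ ⟨i, rfl⟩ _ ⟨j, rfl⟩; exact x_comm i j)
    exact fun a b => this.is_comm.comm a b
  let _ : CommRing S := { (inferInstance : Ring S) with mul_comm := hS }
  refine ⟨S.val.comp (aeval fun i => (⟨x i, Algebra.subset_adjoin ⟨i, rfl⟩⟩ : S)), fun i => ?_⟩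
  rw [AlgHom.comp_apply, aeval_X]
  rfl

/-- The embedding of the polynomial ring into the nilHecke algebra. -/
noncomputable def pol (k : Type u) [Field k] (n : ℕ) : MvPolynomial (Fin n) k →ₐ[k] NilHecke k n :=
  (exists_polynomial_subst k n).choose

theorem pol_X (i : Fin n) : pol k n (X i) = x i := (exists_polynomial_subst k n).choose_spec i

theorem polRep_pol (f g : MvPolynomial (Fin n) k) : polRep k n (pol k n f) g = f * g := by
  have : (polRep k n).comp (pol k n) = Algebra.lmul k (MvPolynomial (Fin n) k) := by
    apply MvPolynomial.algHom_ext
    intro i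
    rw [AlgHom.comp_apply, pol_X]
    exact LinearMap.ext fun g => polRep_x i g
  exact congrArg (fun F => F f g) this

/-- The operator form of the twisted Leibniz rule, now inside the abstract algebra: crossings can be
moved to the right of polynomials. -/
theorem δ_mul_pol (i : Fin (n - 1)) (f : MvPolynomial (Fin n) k) :
    δ i * pol k n f = pol k n (sw k i f) * δ i + pol k n (dd i f) := by
  induction f using MvPolynomial.induction_on with
  | C c =>
    rw [dd_eq_zero (rename_C _ c), map_zero, add_zero, rename_C, ← algebraMap_eq, AlgHom.commutes]
    exact (Algebra.commutes c _).symm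
  | add f g hf hg => simp only [map_add, mul_add, add_mul, hf, hg]; abel
  | mul_X f l hf =>
    have hX : δ i * x l = pol k n (sw k i (X l)) * δ i + pol k n (dd i (X l)) := by
      rw [rename_X, pol_X]
      rcases eq_or_ne l (lo i) with rfl | h₁
      · rw [Equiv.swap_apply_left, dd_X_lo, map_one, δ_mul_lo]
      rcases eq_or_ne l (hi i) with rfl | h₂
      · rw [Equiv.swap_apply_right, dd_X_hi, map_neg, map_one, δ_mul_hi, sub_eq_add_neg]
      · rw [Equiv.swap_apply_of_ne_of_ne h₁ h₂, dd_X_of_ne h₁ h₂, map_zero, add_zero,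
          x_δ_comm l i h₁ h₂]
    rw [map_mul, ← mul_assoc, hf, pol_X, add_mul, mul_assoc, hX, dd_mul, map_mul, map_mul, map_add,
      map_mul, map_mul, pol_X, mul_add, mul_assoc]
    abel

/-! ### The longest divided difference -/

/-- The generator `δ_i`, with `δ_i = 0` for `i` out of range. -/
noncomputable def δN (k : Type u) [Field k] (n i : ℕ) : NilHecke k n :=
  if h : i < n - 1 then δ ⟨i, h⟩ else 0

theorem δN_of_lt {i : ℕ} (h : i < n - 1) : δN k n i = δ ⟨i, h⟩ := dif_pos h

theorem δN_of_le {i : ℕ} (h : n - 1 ≤ i) : δN k n i = 0 := dif_neg (not_lt.2 h)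

theorem δN_sq (i : ℕ) : δN k n i * δN k n i = 0 := by
  rcases lt_or_ge i (n - 1) with h | h
  · rw [δN_of_lt h, δ_sq]
  · rw [δN_of_le h, zero_mul]

theorem δN_braid (i : ℕ) :
    δN k n (i + 1) * (δN k n i * δN k n (i + 1)) = δN k n i * (δN k n (i + 1) * δN k n i) := by
  rcases lt_or_ge (i + 1) (n - 1) with h | h
  · rw [δN_of_lt h, δN_of_lt (Nat.lt_of_succ_lt h), ← mul_assoc, ← mul_assoc]
    exact (braid _ _ rfl).symm
  · rw [δN_of_le h, zero_mul, zero_mul, mul_zero]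

theorem δN_comm {i j : ℕ} (h : i + 1 < j) : δN k n i * δN k n j = δN k n j * δN k n i := by
  rcases lt_or_ge j (n - 1) with hj | hj
  · rw [δN_of_lt hj, δN_of_lt (lt_trans (Nat.lt_of_succ_lt h) hj)]
    exact δ_comm _ _ (Or.inl h)
  · rw [δN_of_le hj, zero_mul, mul_zero]

/-- The product `δ_j δ_{j+1} ⋯` of `l` factors. -/
noncomputable def chain (k : Type u) [Field k] (n : ℕ) : ℕ → ℕ → NilHecke k n
  | _, 0 => 1
  | j, l + 1 => δN k n j * chain k n (j + 1) l

/-- The longest divided difference on the first `m` strands. -/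
noncomputable def longest (k : Type u) [Field k] (n : ℕ) : ℕ → NilHecke k n
  | 0 => 1
  | m + 1 => chain k n 0 m * longest k n m

theorem δN_mul_chain_comm {i j : ℕ} (l : ℕ) (h : i + 1 < j) :
    δN k n i * chain k n j l = chain k n j l * δN k n i := by
  induction l generalizing j with
  | zero => rw [chain, mul_one, one_mul]
  | succ l ih => rw [chain, ← mul_assoc, δN_comm h, mul_assoc, ih (by omega), mul_assoc]

/-- A crossing slides through the chain and drops its index by one: it commutes with the first
factors, meets a braid relation, and commutes with the rest. -/
theorem δN_mul_chain {i j l : ℕ} (h₁ : j ≤ i) (h₂ : i + 1 < j + l) :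
    δN k n (i + 1) * chain k n j l = chain k n j l * δN k n i := by
  induction l generalizing j with
  | zero => omega
  | succ l ih =>
    rcases h₁.eq_or_lt with rfl | h₁
    · obtain ⟨l, rfl⟩ : ∃ l', l = l' + 1 := ⟨l - 1, by omega⟩
      rw [chain, chain, mul_assoc, mul_assoc, ← δN_mul_chain_comm l (by omega), ← mul_assoc (δN k n j),
        ← mul_assoc (δN k n (j + 1)), δN_braid, mul_assoc, mul_assoc]
    · rw [chain, ← mul_assoc, ← δN_comm (by omega), mul_assoc, ih (by omega) (by omega), mul_assoc]

/-- For i = 0 the leading factor δ_0 of the chain is squared. Otherwise δ_i slides through the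
chain, becomes δ_{i-1}, and meets the longest element on fewer strands. -/
theorem δN_mul_longest {i m : ℕ} (h : i + 1 < m) : δN k n i * longest k n m = 0 := by
  induction m generalizing i with
  | zero => omega
  | succ m ih =>
    rw [longest, ← mul_assoc]
    cases i with
    | zero =>
      obtain ⟨m, rfl⟩ : ∃ m', m = m' + 1 := ⟨m - 1, by omega⟩
      rw [chain, ← mul_assoc, δN_sq, zero_mul, zero_mul]
    | succ i => rw [δN_mul_chain (Nat.zero_le _) (by omega), mul_assoc, ih (by omega), mul_zero]

theorem x_mul_δN_comm {q : Fin n} {i : ℕ} (h : i + 1 < q) :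
    x q * δN k n i = δN k n i * x q := by
  rw [δN_of_lt (by omega)]
  apply x_δ_comm <;> simp only [lo, hi, ne_eq, Fin.ext_iff] <;> omega

theorem x_mul_chain_comm {q : Fin n} {j l : ℕ} (h : j + l < q) :
    x q * chain k n j l = chain k n j l * x q := by
  induction l generalizing j with
  | zero => rw [chain, mul_one, one_mul]
  | succ l ih =>
    rw [chain, ← mul_assoc, x_mul_δN_comm (by omega), mul_assoc, ih (by omega), mul_assoc]

theorem x_mul_longest_comm {q : Fin n} {m : ℕ} (h : m ≤ q) :
    x q * longest k n m = longest k n m * x q := by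
  induction m with
  | zero => rw [longest, mul_one, one_mul]
  | succ m ih =>
    rw [longest, ← mul_assoc, x_mul_chain_comm (by omega), mul_assoc, ih (by omega), mul_assoc]

theorem x_mul_δN {j : ℕ} (h : j + 1 < n) :
    x ⟨j, Nat.lt_of_succ_lt h⟩ * δN k n j = δN k n j * x ⟨j + 1, h⟩ + 1 := by
  have hj : j < n - 1 := by omega
  have := x_δ (k := k) (⟨j, hj⟩ : Fin (n - 1))
  rw [δN_of_lt hj, ← this]
  exact (add_sub_cancel _ _).symm

/-- Moving x_j to the right across δ_j, δ_{j+1}, … turns it into x_m and produces one correction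
term for each crossing. Only the first correction survives: in the others, a crossing δ with both
strands among the first m reaches `longest k n m` and kills it. -/
theorem x_mul_chain_mul_longest {j l m : ℕ} (hm : m < n) (h : j + (l + 1) = m) :
    x ⟨j, by omega⟩ * (chain k n j (l + 1) * longest k n m) =
      chain k n j (l + 1) * longest k n m * x ⟨m, hm⟩ + chain k n (j + 1) l * longest k n m := by
  induction l generalizing j with
  | zero =>
    subst h
    simp only [chain, mul_one, one_mul]
    rw [← mul_assoc, x_mul_δN hm, add_mul, one_mul, mul_assoc, mul_assoc]
    congr 2
    exact x_mul_longest_comm le_rfl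
  | succ l ih =>
    have e : δN k n j * (chain k n (j + 1 + 1) l * longest k n m) = 0 := by
      rw [← mul_assoc, δN_mul_chain_comm l (by omega), mul_assoc, δN_mul_longest (by omega),
        mul_zero]
    rw [chain, mul_assoc, ← mul_assoc (x _), x_mul_δN (by omega), add_mul, one_mul, mul_assoc,
      ih (by omega), mul_add, e, add_zero, mul_assoc, mul_assoc, mul_assoc]

/-- The two-sided ideal generated by the longest divided difference is the whole algebra. -/
theorem one_mem_of_longest_mem (I : Submodule k (NilHecke k n))
    (hl : ∀ v w, w ∈ I → v * w ∈ I) (hr : ∀ v w, w ∈ I → w * v ∈ I) (h : longest k n n ∈ I) :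
    1 ∈ I := by
  have step : ∀ m, m < n → longest k n (m + 1) ∈ I → longest k n m ∈ I := by
    intro m hm h
    have key : ∀ l j, j + l = m → chain k n j l * longest k n m ∈ I := by
      intro l j e
      induction j generalizing l with
      | zero => obtain rfl : l = m := by omega
                exact h
      | succ j ih =>
        have h1 := ih (l + 1) (by omega)
        -- The difference x_j z - z x_m lies in I and is z without its leftmost crossing. Repeating
        -- this exhausts the chain.
        have h2 := sub_mem (hl (x ⟨j, by omega⟩) _ h1) (hr (x ⟨m, hm⟩) _ h1)
        rwa [x_mul_chain_mul_longest hm (by omega), add_sub_cancel_left] at h2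
    have := key 0 m (by omega)
    rwa [chain, one_mul] at this
  have down : ∀ m, m ≤ n → longest k n m ∈ I → 1 ∈ I := by
    intro m
    induction m with
    | zero => exact fun _ h => h
    | succ m ih => exact fun hm h => ih (by omega) (step m hm h)
  exact down n le_rfl h

/-! ### Faithfulness of the polynomial representation and its image -/

theorem δ_mul_longest (i : Fin (n - 1)) : δ i * longest k n n = 0 := by
  have := δN_mul_longest (k := k) (n := n) (i := i.val) (m := n) (by omega)
  rwa [δN_of_lt i.2] at this

/-- The left ideal Pol·D is a copy of the polynomial representation: when a crossing is moved past
the coefficient, the term in which it reaches D vanishes and only the divided difference of the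
coefficient remains. -/
theorem mul_pol_mul_longest (w : NilHecke k n) (f : MvPolynomial (Fin n) k) :
    w * (pol k n f * longest k n n) = pol k n (polRep k n w f) * longest k n n := by
  induction w using induction_on with
  | smul_one c => rw [map_smul, map_one, smul_mul_assoc, one_mul, LinearMap.smul_apply, map_smul,
      smul_mul_assoc, Module.End.one_apply]
  | add v w hv hw => rw [add_mul, hv, hw, map_add, LinearMap.add_apply, map_add, add_mul]
  | x_mul i w hw =>
    rw [mul_assoc, hw, map_mul, Module.End.mul_apply, polRep_x, map_mul, pol_X, mul_assoc]
  | δ_mul i w hw =>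
    rw [mul_assoc, hw, map_mul, Module.End.mul_apply, polRep_δ, ← mul_assoc, δ_mul_pol, add_mul,
      mul_assoc, δ_mul_longest, mul_zero, zero_add]

/-- By `mul_pol_mul_longest` this span is already closed under left multiplication, so it is a
two-sided ideal containing D. -/
theorem one_mem_span :
    1 ∈ Submodule.span k {z | ∃ (f : MvPolynomial (Fin n) k) (w : NilHecke k n),
      z = pol k n f * longest k n n * w} := by
  apply one_mem_of_longest_mem
  · intro v w hw
    induction hw using Submodule.span_induction with
    | mem w h =>
      obtain ⟨f, w, rfl⟩ := h
      rw [← mul_assoc, mul_pol_mul_longest]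
      exact Submodule.subset_span ⟨_, _, rfl⟩
    | zero => rw [mul_zero]; exact zero_mem _
    | add a b _ _ ha hb => rw [mul_add]; exact add_mem ha hb
    | smul c a _ ha => rw [mul_smul_comm]; exact Submodule.smul_mem _ _ ha
  · intro v w hw
    induction hw using Submodule.span_induction with
    | mem w h =>
      obtain ⟨f, w, rfl⟩ := h
      rw [mul_assoc]
      exact Submodule.subset_span ⟨_, _, rfl⟩
    | zero => rw [zero_mul]; exact zero_mem _
    | add a b _ _ ha hb => rw [add_mul]; exact add_mem ha hb
    | smul c a _ ha => rw [smul_mul_assoc]; exact Submodule.smul_mem _ _ ha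
  · exact Submodule.subset_span ⟨1, 1, by rw [map_one, one_mul, mul_one]⟩

/-- The polynomial representation is faithful. -/
theorem polRep_injective : Function.Injective (polRep k n) := by
  rw [injective_iff_map_eq_zero]
  intro z hz
  -- If z acts by zero, then z f D = (z·f) D = 0 for every polynomial f, so z kills the span that
  -- contains 1.
  suffices h : ∀ w ∈ _, z * w = 0 from (mul_one z).symm.trans (h 1 one_mem_span)
  intro w hw
  induction hw using Submodule.span_induction with
  | mem w h =>
    obtain ⟨f, w, rfl⟩ := h
    rw [← mul_assoc, mul_pol_mul_longest, hz, LinearMap.zero_apply, map_zero, zero_mul, zero_mul]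
  | zero => rw [mul_zero]
  | add a b _ _ ha hb => rw [mul_add, ha, hb, add_zero]
  | smul c a _ ha => rw [mul_smul_comm, ha, smul_zero]

theorem isSymmetric_of_sw {f : MvPolynomial (Fin n) k} (h : ∀ i, sw k i f = f) :
    f.IsSymmetric := by
  cases n with
  | zero => intro e; rw [Subsingleton.elim e 1]; exact rename_id_apply f
  | succ n =>
    intro e
    have he : e ∈ Submonoid.closure
        (Set.range fun i : Fin n => Equiv.swap i.castSucc i.succ) := by
      rw [Equiv.Perm.mclosure_swap_castSucc_succ]; trivial
    induction he using Submonoid.closure_induction with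
    | mem e he =>
      obtain ⟨i, rfl⟩ := he
      exact h i
    | one => exact rename_id_apply f
    | mul a b _ _ ha hb => rw [Equiv.Perm.coe_mul, ← rename_rename, hb, ha]

theorem sw_of_isSymmetric {f : MvPolynomial (Fin n) k} (h : f.IsSymmetric) (i : Fin (n - 1)) :
    sw k i f = f := h _

theorem polRep_mul_symmetric (w : NilHecke k n) {f : MvPolynomial (Fin n) k} (hf : f.IsSymmetric)
    (g : MvPolynomial (Fin n) k) : polRep k n w (f * g) = f * polRep k n w g := by
  induction w using induction_on with
  | smul_one c => simp
  | add v w hv hw => simp only [map_add, LinearMap.add_apply, hv, hw, mul_add]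
  | x_mul i w hw =>
    simp only [map_mul, Module.End.mul_apply, hw, polRep_x]
    ring
  | δ_mul i w hw =>
    simp only [map_mul, Module.End.mul_apply, hw, polRep_δ]
    rw [dd_mul, sw_of_isSymmetric hf, dd_eq_zero (sw_of_isSymmetric hf i), zero_mul, zero_add]

/-- All δ_i annihilate D on the left, and a polynomial killed by all divided differences is
invariant under the adjacent transpositions, which generate S_n. -/
theorem polRep_longest_isSymmetric (f : MvPolynomial (Fin n) k) :
    (polRep k n (longest k n n) f).IsSymmetric := by
  apply isSymmetric_of_sw
  intro i
  apply sw_eq_of_dd_eq_zero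
  rw [← polRep_δ, ← Module.End.mul_apply, ← map_mul, δ_mul_longest, map_zero, LinearMap.zero_apply]

/-- Every endomorphism of the polynomial ring over the symmetric polynomials comes from the
nilHecke algebra. -/
theorem exists_polRep_eq (ψ : Module.End k (MvPolynomial (Fin n) k))
    (hψ : ∀ f g : MvPolynomial (Fin n) k, f.IsSymmetric → ψ (f * g) = f * ψ g) :
    ∃ z, polRep k n z = ψ := by
  suffices h : ∀ w ∈ _, ∃ z, polRep k n z = ψ * polRep k n w by
    simpa using h 1 one_mem_span
  intro w hw
  induction hw using Submodule.span_induction with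
  | mem w h =>
    obtain ⟨f, w, rfl⟩ := h
    -- The element D w g is symmetric, so ψ(f · D w g) = ψ(f) · D w g: composing with ψ only changes
    -- the left coefficient f.
    refine ⟨pol k n (ψ f) * longest k n n * w, LinearMap.ext fun g => ?_⟩
    simp only [map_mul, Module.End.mul_apply, polRep_pol]
    rw [mul_comm f, hψ _ _ (polRep_longest_isSymmetric _), mul_comm]
  | zero => exact ⟨0, by simp⟩
  | add a b _ _ ha hb =>
    obtain ⟨y, hy⟩ := ha
    obtain ⟨z, hz⟩ := hb
    exact ⟨y + z, by rw [map_add, map_add, hy, hz, mul_add]⟩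
  | smul c a _ ha =>
    obtain ⟨y, hy⟩ := ha
    exact ⟨c • y, by rw [map_smul, map_smul, hy, mul_smul_comm]⟩

end NilHecke

end PDG

namespace PDG

namespace Staircase

/-! ### The staircase basis of a splitting algebra -/

section Abstract

variable {R A : Type*} [CommRing R] [CommRing A] [Algebra R A] (y : ℕ → A) (n : ℕ)

/-- The subalgebra generated by the first `t` elements. -/
def level (R : Type*) {A : Type*} [CommRing R] [CommRing A] [Algebra R A] (y : ℕ → A) (t : ℕ) :
    Subalgebra R A := Algebra.adjoin R {f | ∃ j < t, f = y j}

variable {y} in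
theorem mem_level {j t : ℕ} (h : j < t) : y j ∈ level R y t :=
  Algebra.subset_adjoin ⟨j, h, rfl⟩

variable {y} in
theorem level_mono {t t' : ℕ} (h : t ≤ t') : level R y t ≤ level R y t' :=
  Algebra.adjoin_mono fun _ ⟨j, hj, e⟩ => ⟨j, hj.trans_le h, e⟩

/-- The first `n` elements are distinct and permuted by the `R`-algebra endomorphisms. -/
def Exchangeable (R : Type*) {A : Type*} [CommRing R] [CommRing A] [Algebra R A] (y : ℕ → A)
    (n : ℕ) : Prop :=
  (∀ i < n, ∀ j < n, y i = y j → i = j) ∧ ∀ i < n, ∀ j < n, ∃ σ : A →ₐ[R] A,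
    σ (y i) = y j ∧ ∀ l, l ≠ i → l ≠ j → σ (y l) = y l

variable {y n}

/-- The powers of the next element, up to the height of the staircase, are independent. -/
theorem linearIndependent_pow [IsDomain A] (hy : Exchangeable R y n) (t : ℕ) :
    LinearIndependent (level R y t) fun b : Fin (n - t) => y t ^ b.val := by
  rw [Fintype.linearIndependent_iff]
  intro g hg
  have hv : (fun b => (g b : A)) = 0 := by
    -- Exchanging y_t with y_{t+j} fixes the coefficients, which involve only earlier elements. The
    -- polynomial with coefficients g, which has n - t of them, therefore vanishes at the n - t
    -- distinct points y_t, …, y_{n-1}, and the Vandermonde matrix is injective.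
    refine Matrix.eq_zero_of_forall_index_sum_mul_pow_eq_zero
      (f := fun j : Fin (n - t) => y (t + j.val)) ?_ ?_
    · intro i j h
      have := hy.1 _ (by omega) _ (by omega) h
      exact Fin.ext (by omega)
    · intro j
      have hj := j.2
      obtain ⟨σ, h1, h2⟩ := hy.2 t (by omega) (t + j.val) (by omega)
      have hσ : ∀ f ∈ level R y t, σ f = f := by
        intro f hf
        induction hf using Algebra.adjoin_induction with
        | mem f h =>
          obtain ⟨l, hl, rfl⟩ := h
          exact h2 l (by omega) (by omega)
        | algebraMap r => exact σ.commutes r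
        | add f g _ _ hf hg => rw [map_add, hf, hg]
        | mul f g _ _ hf hg => rw [map_mul, hf, hg]
      have h := congrArg σ hg
      rw [map_sum, map_zero] at h
      rw [← h]
      refine Finset.sum_congr rfl fun b _ => ?_
      rw [Algebra.smul_def, map_mul, map_pow, h1]
      congr 1
      exact (hσ _ (g b).2).symm
  exact fun i => Subtype.ext (congrFun hv i)

open Polynomial in
/-- The monic polynomial whose roots are the elements from the `t`-th on. -/
noncomputable def tailPoly (y : ℕ → A) (n t : ℕ) : A[X] := ∏ j ∈ Finset.Ico t n, (X - C (y j))

theorem tailPoly_monic (t : ℕ) : (tailPoly y n t).Monic :=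
  Polynomial.monic_prod_of_monic _ _ fun _ _ => Polynomial.monic_X_sub_C _

theorem natDegree_tailPoly_le (t : ℕ) : (tailPoly y n t).natDegree ≤ n - t := by
  nontriviality A
  rw [tailPoly, Polynomial.natDegree_prod_of_monic _ _ fun _ _ => Polynomial.monic_X_sub_C _]
  simp

theorem tailPoly_eq {t : ℕ} (ht : t < n) :
    tailPoly y n t = (Polynomial.X - Polynomial.C (y t)) * tailPoly y n (t + 1) := by
  rw [tailPoly, Finset.prod_eq_prod_Ico_succ_bot ht]
  rfl

theorem tailPoly_eval {t : ℕ} (ht : t < n) : (tailPoly y n t).eval (y t) = 0 := by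
  rw [tailPoly_eq ht, Polynomial.eval_mul]
  simp

/-- Synthetic division by X - y_t: comparing coefficients of X^(m+1) expresses the m-th coefficient
of the quotient through its (m+1)-st one, y_t and a coefficient of the dividend. The recursion runs
down from m ≥ n, where the coefficient is zero. -/
theorem coeff_tailPoly_mem (h0 : ∀ m, (tailPoly y n 0).coeff m ∈ level R y 0) {t : ℕ} (ht : t ≤ n)
    (m : ℕ) : (tailPoly y n t).coeff m ∈ level R y t := by
  induction t generalizing m with
  | zero => exact h0 m
  | succ t ih =>
    have key : ∀ d m, n - m = d → (tailPoly y n (t + 1)).coeff m ∈ level R y (t + 1) := by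
      intro d
      induction d with
      | zero =>
        intro m hm
        rw [Polynomial.coeff_eq_zero_of_natDegree_lt]
        · exact zero_mem _
        · have := natDegree_tailPoly_le (y := y) (n := n) (t + 1)
          omega
      | succ d ihd =>
        intro m hm
        have h := congrArg (fun P => P.coeff (m + 1)) (tailPoly_eq (y := y) (n := n) (t := t) ht)
        simp only [sub_mul, Polynomial.coeff_sub, Polynomial.coeff_X_mul,
          Polynomial.coeff_C_mul] at h
        rw [← sub_add_cancel ((tailPoly y n (t + 1)).coeff m)
          (y t * (tailPoly y n (t + 1)).coeff (m + 1)), ← h]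
        exact add_mem (level_mono (Nat.le_succ t) (ih (by omega) _))
          (mul_mem (mem_level (Nat.lt_succ_self t)) (ihd _ (by omega)))
    exact key _ m rfl

/-- The staircase monomials in the first `t` elements. -/
def mono (y : ℕ → A) (n t : ℕ) (c : ∀ i : Fin t, Fin (n - i.val)) : A :=
  ∏ i, y i.val ^ (c i).val

theorem mono_succ (t : ℕ) (c : ∀ i : Fin (t + 1), Fin (n - i.val)) :
    mono y n (t + 1) c = mono y n t (fun i => c i.castSucc) * y t ^ (c (Fin.last t)).val :=
  Fin.prod_univ_castSucc _

theorem mono_mem_level (t : ℕ) (c : ∀ i : Fin t, Fin (n - i.val)) : mono y n t c ∈ level R y t :=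
  Subalgebra.prod_mem _ fun i _ => pow_mem (mem_level i.2) _

/-- Adjoining one element at a time: monomials independent over R and lying in `level R y t`, times
powers of y_t independent over that level, are independent over R. -/
theorem linearIndependent_mono [IsDomain A] [FaithfulSMul R A] (hy : Exchangeable R y n) (t : ℕ) :
    LinearIndependent R (mono y n t) := by
  induction t with
  | zero =>
    rw [Fintype.linearIndependent_iff]
    intro g hg c
    rw [Fintype.sum_unique, mono, Finset.univ_eq_empty, Finset.prod_empty,
      ← Algebra.algebraMap_eq_smul_one] at hg
    rw [Subsingleton.elim c default]
    exact FaithfulSMul.algebraMap_injective R A (hg.trans (map_zero _).symm)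
  | succ t ih =>
    have h1 : LinearIndependent R
        fun c => (⟨mono y n t c, mono_mem_level t c⟩ : level R y t) :=
      LinearIndependent.of_comp (level R y t).val.toLinearMap ih
    have h2 := (linearIndependent_smul h1 (linearIndependent_pow hy t)).comp
      (fun c : ∀ i : Fin (t + 1), Fin (n - i.val) =>
        (fun i : Fin t => c i.castSucc, c (Fin.last t))) ?_
    · convert h2 using 1
      funext c
      exact mono_succ t c
    · intro c c' h
      rw [Prod.mk.injEq] at h
      funext i
      refine Fin.lastCases h.2 (fun i => ?_) i
      exact congrFun h.1 i

/-- The element y_t is a root of `tailPoly y n t`, which is monic of degree at most n - t with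
coefficients in `level R y t`. So powers y_t^b with b < n - t span the next level over the current
one. -/
theorem level_le_span_mono (h0 : ∀ m, (tailPoly y n 0).coeff m ∈ level R y 0) {t : ℕ}
    (ht : t ≤ n) :
    (level R y t).toSubmodule ≤ Submodule.span R (Set.range (mono y n t)) := by
  classical
  nontriviality A
  induction t with
  | zero =>
    intro f hf
    have h0 : level R y 0 = ⊥ := by simp [level]
    rw [Subalgebra.mem_toSubmodule, h0, Algebra.mem_bot] at hf
    obtain ⟨r, rfl⟩ := hf
    rw [Algebra.algebraMap_eq_smul_one]
    exact Submodule.smul_mem _ _ (Submodule.subset_span ⟨fun i => i.elim0, by simp [mono]⟩)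
  | succ t ih =>
    obtain ⟨q, hq, hd, hm⟩ := Polynomial.lifts_and_natDegree_eq_and_monic
      (f := algebraMap (level R y t) A) (p := tailPoly y n t)
      ((Polynomial.lifts_iff_coeff_lifts _).2 fun m =>
        ⟨⟨_, coeff_tailPoly_mem h0 (by omega) m⟩, rfl⟩) (tailPoly_monic t)
    have hspan := Submodule.span_range_natDegree_eq_adjoin hm (x := y t) (by
      rw [Polynomial.aeval_def, Polynomial.eval₂_eq_eval_map, hq, tailPoly_eval ht])
    have hle : level R y (t + 1) ≤
        (Algebra.adjoin (level R y t) {y t}).restrictScalars R := by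
      refine Algebra.adjoin_le ?_
      rintro _ ⟨j, hj, rfl⟩
      rcases (Nat.lt_succ_iff.1 hj).eq_or_lt with rfl | hj
      · exact (Algebra.subset_adjoin (Set.mem_singleton _) :
          y j ∈ Algebra.adjoin (level R y j) {y j})
      · exact (Algebra.adjoin (level R y t) {y t}).algebraMap_mem ⟨_, mem_level hj⟩
    intro f hf
    have hf' : f ∈ Submodule.span (level R y t)
        ((fun b => y t ^ b) '' (Finset.range q.natDegree : Set ℕ)) := by
      rw [← Finset.coe_image, hspan]; exact hle hf
    clear hf
    have hmul : ∀ g ∈ Submodule.span R (Set.range (mono y n t)), ∀ b < n - t,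
        g * y t ^ b ∈ Submodule.span R (Set.range (mono y n (t + 1))) := by
      intro g hg b hb
      induction hg using Submodule.span_induction with
      | mem g h =>
        obtain ⟨c, rfl⟩ := h
        refine Submodule.subset_span ⟨Fin.snoc (α := fun i => Fin (n - i.val)) c ⟨b, hb⟩, ?_⟩
        rw [mono_succ]
        simp
      | zero => rw [zero_mul]; exact zero_mem _
      | add f g _ _ hf hg => rw [add_mul]; exact add_mem hf hg
      | smul r f _ hf => rw [smul_mul_assoc]; exact Submodule.smul_mem _ _ hf
    obtain ⟨g, rfl⟩ := (Submodule.mem_span_image_finset_iff_exists_fun _).1 hf'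
    refine Submodule.sum_mem _ fun b _ => ?_
    rw [Algebra.smul_def]
    have hdeg := natDegree_tailPoly_le (y := y) (n := n) t
    exact hmul _ (ih (by omega) (g b).2) b (by have := Finset.mem_range.1 b.2; omega)

end Abstract

/-! ### The staircase in the polynomial ring over the symmetric polynomials -/

open MvPolynomial

variable {k : Type u} [Field k] {n : ℕ} (s : Equiv.Perm (Fin n))

/-- The variables in the order given by `s`. -/
noncomputable def var (k : Type u) [Field k] (j : ℕ) : MvPolynomial (Fin n) k :=
  if h : j < n then X (s ⟨j, h⟩) else 0

theorem var_of_lt {j : ℕ} (h : j < n) : var s k j = X (s ⟨j, h⟩) := dif_pos h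

/-- The required endomorphisms are the swaps of two variables; they are linear over Sym because
symmetric polynomials are fixed. -/
theorem exchangeable_var : Exchangeable (Sym k n) (var s k) n := by
  constructor
  · intro i hi j hj h
    rw [var_of_lt s hi, var_of_lt s hj] at h
    simpa using s.injective (X_injective h)
  · intro i hi j hj
    refine ⟨{ rename (Equiv.swap (s ⟨i, hi⟩) (s ⟨j, hj⟩)) with commutes' := fun r => r.2 _ },
      ?_, fun l h₁ h₂ => ?_⟩
    · change rename _ (var s k i) = _
      rw [var_of_lt s hi, var_of_lt s hj, rename_X, Equiv.swap_apply_left]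
    · change rename _ (var s k l) = _
      rcases lt_or_ge l n with hl | hl
      · rw [var_of_lt s hl, rename_X, Equiv.swap_apply_of_ne_of_ne] <;>
          rw [s.injective.ne_iff, ne_eq, Fin.mk.injEq] <;> assumption
      · rw [var, dif_neg (not_lt.2 hl), map_zero]

/-- The full product of the X - x_j is invariant under permutations of the variables, so its
coefficients are symmetric. -/
theorem coeff_tailPoly_var_mem (m : ℕ) :
    (tailPoly (var s k) n 0).coeff m ∈ level (Sym k n) (var s k) 0 := by
  refine (level (Sym k n) (var s k) 0).algebraMap_mem
    (⟨(tailPoly (var s k) n 0).coeff m, fun e => ?_⟩ : Sym k n)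
  have h0 : tailPoly (var s k) n 0 = ∏ j : Fin n, (Polynomial.X - Polynomial.C (X j)) := by
    rw [tailPoly, Nat.Ico_zero_eq_range, ← Fin.prod_univ_eq_prod_range
      (fun j => Polynomial.X - Polynomial.C (var s k j))]
    exact Fintype.prod_equiv s _ _ fun j => by rw [var_of_lt s j.2]
  have h : (tailPoly (var s k) n 0).map
      (rename e : MvPolynomial (Fin n) k →ₐ[k] MvPolynomial (Fin n) k).toRingHom =
        tailPoly (var s k) n 0 := by
    rw [h0, Polynomial.map_prod]
    exact Fintype.prod_equiv e _ _ fun j => by simp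
  conv_rhs => rw [← h]
  rw [Polynomial.coeff_map]
  rfl

theorem level_var : level (Sym k n) (var s k) n = ⊤ := by
  rw [eq_top_iff]
  intro f _
  induction f using MvPolynomial.induction_on with
  | C c => exact (level (Sym k n) (var s k) n).algebraMap_mem (algebraMap k _ c)
  | add f g hf hg => exact add_mem (hf trivial) (hg trivial)
  | mul_X f i hf =>
    refine mul_mem (hf trivial) ?_
    have := mem_level (R := Sym k n) (y := var s k) (s.symm i).2
    rwa [var_of_lt s (s.symm i).2, Fin.eta, Equiv.apply_symm_apply] at this

end Staircase

/-! ### The decomposition of Pol as the tensor product of U and Sym -/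

section

open MvPolynomial

variable {k : Type u} [Field k] {n : ℕ}

/-- The exponents of the monomials in `U_{n,s}`. -/
def stairs (n : ℕ) (s : Equiv.Perm (Fin n)) : Set (Fin n →₀ ℕ) :=
  {b | ∀ t : Fin n, b (s t) ≤ n - (t.val + 1)}

theorem U_eq_restrictSupport (s : Equiv.Perm (Fin n)) :
    U k n s = restrictSupport k (stairs n s) := by
  apply le_antisymm
  · refine Submodule.span_le.2 ?_
    rintro _ ⟨b, hb, rfl⟩
    exact (monomial_mem_restrictSupport k).2 (Or.inl hb)
  · rw [restrictSupport_eq_span]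
    refine Submodule.span_le.2 ?_
    rintro _ ⟨b, hb, rfl⟩
    exact Submodule.subset_span ⟨b, hb, rfl⟩

/-- The basis of `U_{n,s}` that consists of monomials. -/
noncomputable def basisU (k : Type u) [Field k] {n : ℕ} (s : Equiv.Perm (Fin n)) :
    Module.Basis (stairs n s) k (U k n s) :=
  (basisRestrictSupport k (stairs n s)).map (LinearEquiv.ofEq _ _ (U_eq_restrictSupport s).symm)

theorem basisU_repr (s : Equiv.Perm (Fin n)) (f : U k n s) (b : stairs n s) :
    (basisU k s).repr f b = coeff b.1 f.1 := rfl

theorem basisU_apply (s : Equiv.Perm (Fin n)) (b : stairs n s) :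
    (basisU k s b : MvPolynomial (Fin n) k) = monomial b.1 1 := by
  have h : monomial b.1 1 ∈ U k n s := Submodule.subset_span ⟨b.1, b.2, rfl⟩
  suffices e : basisU k s b = ⟨monomial b.1 1, h⟩ by rw [e]
  apply (basisU k s).repr.injective
  ext b'
  rw [Module.Basis.repr_self, basisU_repr, coeff_monomial, Finsupp.single_apply]
  simp only [Subtype.ext_iff]

theorem uMul_tmul (s : Equiv.Perm (Fin n)) (f : U k n s) (g : Sym k n) :
    uMul k n s (f ⊗ₜ g) = f.1 * g.1 := rfl

/-- The monomials in `U_{n,s}` correspond to the staircase. -/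
noncomputable def stairsEquiv (s : Equiv.Perm (Fin n)) : stairs n s ≃ ∀ i : Fin n, Fin (n - i.val) where
  toFun b i := ⟨b.1 (s i), by have := b.2 i; omega⟩
  invFun c := ⟨Finsupp.equivFunOnFinite.symm fun j => (c (s.symm j)).val, fun t => by
    have := (c t).2
    have e : s.symm (s t) = t := s.symm_apply_apply t
    simp only [Finsupp.equivFunOnFinite_symm_apply_apply]
    rw [e]
    omega⟩
  left_inv b := Subtype.ext (Finsupp.ext fun j => by simp)
  right_inv c := by
    funext i
    have e : s.symm (s i) = i := s.symm_apply_apply i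
    apply Fin.ext
    simp only [Finsupp.equivFunOnFinite_symm_apply_apply]
    rw [e]

theorem mono_var (s : Equiv.Perm (Fin n)) (b : stairs n s) :
    Staircase.mono (Staircase.var s k) n n (stairsEquiv s b) = monomial b.1 1 := by
  rw [monomial_eq, C_1, one_mul, Finsupp.prod_fintype _ _ fun _ => pow_zero _]
  exact Fintype.prod_equiv s _ _ fun i => by rw [Staircase.var_of_lt s i.2]; rfl

/-- In the monomial basis of U, the map sends a family of symmetric coefficients to their
combination of staircase monomials. Injectivity is independence over Sym, and surjectivity is
spanning. -/
theorem uMul_bijective (s : Equiv.Perm (Fin n)) : Function.Bijective (uMul k n s) := by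
  let e := TensorProduct.equivFinsuppOfBasisLeft (N := Sym k n) (basisU k s)
  have he : ∀ g : stairs n s →₀ Sym k n, uMul k n s (e.symm g) =
      Finsupp.linearCombination (Sym k n) (Staircase.mono (Staircase.var s k) n n)
        (g.mapDomain (stairsEquiv s)) := by
    intro g
    induction g using Finsupp.induction_linear with
    | zero => simp
    | add f g hf hg => rw [map_add, map_add, hf, hg, Finsupp.mapDomain_add, map_add]
    | single b r =>
      rw [Finsupp.mapDomain_single, Finsupp.linearCombination_single, mono_var,
        TensorProduct.equivFinsuppOfBasisLeft_symm_apply, Finsupp.sum_single_index (by simp),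
        uMul_tmul, basisU_apply, mul_comm]
      rfl
  have h1 : Function.Bijective fun g : stairs n s →₀ Sym k n => uMul k n s (e.symm g) := by
    simp only [he]
    refine Function.Bijective.comp ⟨Staircase.linearIndependent_mono
      (Staircase.exchangeable_var s) n, fun f => ?_⟩
      (by
        convert (Finsupp.domCongr (M := Sym k n) (stairsEquiv s)).bijective using 1
        funext g
        exact (Finsupp.equivMapDomain_eq_mapDomain _ _).symm)
    have h := Staircase.level_le_span_mono (Staircase.coeff_tailPoly_var_mem s) le_rfl
      (x := f) (by rw [Staircase.level_var]; trivial)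
    rwa [← Finsupp.range_linearCombination] at h
  exact (Function.Bijective.of_comp_iff _ e.symm.bijective).1 h1

end

end PDG

namespace PDG

section

open MvPolynomial NilHecke

variable {k : Type u} [Field k] {n : ℕ}

/-! ### The matrix presentation -/

instance (s : Equiv.Perm (Fin n)) : Finite (stairs n s) := Finite.of_equiv _ (stairsEquiv s).symm

instance (s : Equiv.Perm (Fin n)) : Module.Finite k (U k n s) := .of_basis (basisU k s)

/-- The decomposition of the polynomial ring as an equivalence. -/
noncomputable def uEquiv (k : Type u) [Field k] {n : ℕ} (s : Equiv.Perm (Fin n)) :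
    U k n s ⊗[k] Sym k n ≃ₗ[k] MvPolynomial (Fin n) k :=
  LinearEquiv.ofBijective (uMul k n s) (uMul_bijective s)

theorem matAct_tmul {V R : Type*} [AddCommGroup V] [Module k V] [CommRing R] [Algebra k R]
    (φ : Module.End k V) (r : R) (v : V) (f : R) :
    matAct k V R (φ ⊗ₜ r) (v ⊗ₜ f) = φ v ⊗ₜ (r * f) := rfl

theorem matAct_one {V R : Type*} [AddCommGroup V] [Module k V] [CommRing R] [Algebra k R] :
    matAct k V R 1 = 1 := by
  apply TensorProduct.ext'
  intro v f
  rw [Algebra.TensorProduct.one_def, matAct_tmul, one_mul]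
  rfl

theorem matAct_mul {V R : Type*} [AddCommGroup V] [Module k V] [CommRing R] [Algebra k R]
    (S T : Module.End k V ⊗[k] R) : matAct k V R (S * T) = matAct k V R S * matAct k V R T := by
  induction S using TensorProduct.induction_on with
  | zero => rw [zero_mul, map_zero, zero_mul]
  | add S S' hS hS' => rw [add_mul, map_add, map_add, add_mul, hS, hS']
  | tmul φ r =>
    induction T using TensorProduct.induction_on with
    | zero => rw [mul_zero, map_zero, mul_zero]
    | add T T' hT hT' => rw [mul_add, map_add, map_add, mul_add, hT, hT']
    | tmul ψ r' =>
      apply TensorProduct.ext'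
      intro v f
      rw [Algebra.TensorProduct.tmul_mul_tmul, Module.End.mul_apply, matAct_tmul, matAct_tmul,
        matAct_tmul, mul_assoc, Module.End.mul_apply]

theorem matAct_tmul_one {V R : Type*} [AddCommGroup V] [Module k V] [Module.Finite k V]
    [CommRing R] [Algebra k R] (T : Module.End k V ⊗[k] R) (v : V) :
    matAct k V R T (v ⊗ₜ 1) = rTensorHomEquivHomRTensor k V V R T v := by
  rw [← LinearEquiv.coe_coe, rTensorHomEquivHomRTensor_toLinearMap]
  induction T using TensorProduct.induction_on with
  | zero => simp
  | add S T hS hT => rw [map_add, LinearMap.add_apply, hS, hT, map_add, LinearMap.add_apply]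
  | tmul φ r =>
    rw [matAct_tmul, mul_one]
    rfl

/-- The values on the v ⊗ 1 suffice: for finite-dimensional V they realise the isomorphism of END(V)
⊗ R with Hom(V, V ⊗ R). -/
theorem matAct_injective {V R : Type*} [AddCommGroup V] [Module k V] [Module.Finite k V]
    [CommRing R] [Algebra k R] : Function.Injective (matAct k V R) := fun S T h => by
  apply (rTensorHomEquivHomRTensor k V V R).injective
  ext v
  rw [← matAct_tmul_one, ← matAct_tmul_one, h]

theorem matAct_ext {s : Equiv.Perm (Fin n)} {S T : Module.End k (U k n s) ⊗[k] Sym k n}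
    (h : ∀ t, uMul k n s (matAct k _ _ S t) = uMul k n s (matAct k _ _ T t)) : S = T :=
  matAct_injective (LinearMap.ext fun t => (uMul_bijective s).1 (h t))

/-- Elements of the nilHecke algebra are determined by their action on `U_{n,s}`. -/
theorem polRep_eq_zero_of_U (s : Equiv.Perm (Fin n)) {w : NilHecke k n}
    (h : ∀ u : U k n s, polRep k n w u.1 = 0) : w = 0 := by
  apply polRep_injective
  rw [map_zero]
  apply LinearMap.ext
  intro f
  obtain ⟨t, rfl⟩ := (uMul_bijective s).2 f
  induction t using TensorProduct.induction_on with
  | zero => simp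
  | add S T hS hT => rw [map_add, map_add, hS, hT]; simp
  | tmul u g =>
    rw [uMul_tmul, mul_comm, polRep_mul_symmetric w g.2, h, mul_zero, LinearMap.zero_apply]

theorem uMul_matAct_tmul (s : Equiv.Perm (Fin n)) (T : Module.End k (U k n s) ⊗[k] Sym k n)
    (u : U k n s) (f : Sym k n) : uMul k n s (matAct k _ _ T (u ⊗ₜ f)) =
      f.1 * uMul k n s (rTensorHomEquivHomRTensor k _ _ _ T u) := by
  rw [← matAct_tmul_one]
  induction T using TensorProduct.induction_on with
  | zero => simp
  | add S T hS hT => simp only [map_add, LinearMap.add_apply, hS, hT, mul_add]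
  | tmul φ r =>
    rw [matAct_tmul, matAct_tmul, uMul_tmul, uMul_tmul, mul_one]
    change _ * (r.1 * f.1) = _
    ring

/-- The restriction of the polynomial representation to `U_{n,s}`. -/
noncomputable def restrictU (k : Type u) [Field k] {n : ℕ} (s : Equiv.Perm (Fin n)) :
    NilHecke k n →ₗ[k] (U k n s →ₗ[k] MvPolynomial (Fin n) k) :=
  LinearMap.lcomp k _ (U k n s).subtype ∘ₗ (polRep k n).toLinearMap

/-- Since Pol is U ⊗ Sym, a Sym-linear endomorphism of Pol is the same as a k-linear map from U to
Pol. Faithfulness gives injectivity; for surjectivity the Sym-linear extension ψ of a given map is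
realised by `exists_polRep_eq`. -/
theorem restrictU_bijective (s : Equiv.Perm (Fin n)) : Function.Bijective (restrictU k s) := by
  constructor
  · rw [injective_iff_map_eq_zero]
    intro w hw
    exact polRep_eq_zero_of_U s fun u => LinearMap.congr_fun hw u
  · intro φ
    let ψ : Module.End k (MvPolynomial (Fin n) k) :=
      LinearMap.mul' k _ ∘ₗ TensorProduct.map φ (Sym k n).val.toLinearMap ∘ₗ
        (uEquiv k s).symm.toLinearMap
    have hψ : ∀ (u : U k n s) (g : Sym k n), ψ (u.1 * g.1) = φ u * g.1 := by
      intro u g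
      have e : (uEquiv k s).symm (u.1 * g.1) = u ⊗ₜ g :=
        (uEquiv k s).symm_apply_eq.2 (uMul_tmul s u g).symm
      simp only [ψ, LinearMap.comp_apply, LinearEquiv.coe_coe, e]
      rfl
    obtain ⟨w, hw⟩ := exists_polRep_eq ψ fun f g hf => by
      obtain ⟨t, rfl⟩ := (uMul_bijective s).2 g
      induction t using TensorProduct.induction_on with
      | zero => simp
      | add S T hS hT => simp only [map_add, mul_add, hS, hT]
      | tmul u g =>
        rw [uMul_tmul, hψ]
        have := hψ u (⟨f, hf⟩ * g)
        change ψ (u.1 * (f * g.1)) = φ u * (f * g.1) at this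
        rw [mul_left_comm, this]
        ring
    refine ⟨w, LinearMap.ext fun u => ?_⟩
    change polRep k n w u.1 = φ u
    rw [hw]
    have := hψ u 1
    change ψ (u.1 * 1) = φ u * 1 at this
    rwa [mul_one, mul_one] at this

/-- The linear isomorphism between the nilHecke algebra and the matrices over the symmetric
polynomials. -/
noncomputable def matLin (k : Type u) [Field k] {n : ℕ} (s : Equiv.Perm (Fin n)) :
    NilHecke k n ≃ₗ[k] Module.End k (U k n s) ⊗[k] Sym k n :=
  LinearEquiv.ofBijective _ (restrictU_bijective s) ≪≫ₗ
    LinearEquiv.congrRight (uEquiv k s).symm ≪≫ₗ (rTensorHomEquivHomRTensor k _ _ _).symm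

/-- This characterises `matLin`: through `uMul`, the matrix action is the polynomial representation.
As elements are determined by their action (`matAct_ext`), multiplicativity and compatibility with
the differentials can be checked on polynomials. -/
theorem uMul_matAct_matLin (s : Equiv.Perm (Fin n)) (w : NilHecke k n)
    (t : U k n s ⊗[k] Sym k n) :
    uMul k n s (matAct k _ _ (matLin k s w) t) = polRep k n w (uMul k n s t) := by
  induction t using TensorProduct.induction_on with
  | zero => simp
  | add S T hS hT => simp only [map_add, hS, hT]
  | tmul u f =>
    rw [uMul_matAct_tmul, uMul_tmul, mul_comm u.1, polRep_mul_symmetric w f.2, matLin,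
      LinearEquiv.trans_apply, LinearEquiv.trans_apply, LinearEquiv.apply_symm_apply]
    congr 1
    exact (uEquiv k s).apply_symm_apply _

/-- The isomorphism between the nilHecke algebra and the matrices over the symmetric
polynomials. -/
noncomputable def matIso (k : Type u) [Field k] {n : ℕ} (s : Equiv.Perm (Fin n)) :
    NilHecke k n ≃ₐ[k] Module.End k (U k n s) ⊗[k] Sym k n :=
  AlgEquiv.ofLinearEquiv (matLin k s)
    (matAct_ext fun t => by
      rw [uMul_matAct_matLin, matAct_one, map_one]; rfl)
    fun v w => matAct_ext fun t => by
      rw [uMul_matAct_matLin, matAct_mul, Module.End.mul_apply, uMul_matAct_matLin,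
        uMul_matAct_matLin, map_mul, Module.End.mul_apply]

theorem uMul_matAct_matIso (s : Equiv.Perm (Fin n)) (w : NilHecke k n)
    (t : U k n s ⊗[k] Sym k n) :
    uMul k n s (matAct k _ _ (matIso k s w) t) = polRep k n w (uMul k n s t) :=
  uMul_matAct_matLin s w t

theorem isPolynomialAction_matIso (p : ℕ) (s : Equiv.Perm (Fin p)) :
    IsPolynomialAction p s (matIso k s) := by
  constructor
  · intro i t
    rw [uMul_matAct_matIso, polRep_x]
  · intro i t
    rw [uMul_matAct_matIso, polRep_δ]
    exact root_mul_dd i _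

/-! ### The differential -/

section Differential

variable {p : ℕ} [Fact p.Prime] [CharP k p]

omit [Fact p.Prime] in
theorem sub_sw_linear {c : Fin n → k} (i : Fin (n - 1)) :
    ∑ t, C (c t) * X t - sw k i (∑ t, C (c t) * X t) =
      C (c (lo i) - c (hi i)) * root k i := by
  rw [map_sum, ← Finset.sum_sub_distrib, Finset.sum_eq_add (lo i) (hi i) (lo_ne_hi i)]
  · simp only [map_mul, rename_C, rename_X, Equiv.swap_apply_left, Equiv.swap_apply_right, map_sub]
    ring
  · intro t _ ht
    rw [map_mul, rename_C, rename_X, Equiv.swap_apply_of_ne_of_ne ht.1 ht.2, sub_self]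
  · simp
  · simp

theorem polD_X (i : Fin n) : polD k n (X i) = X i ^ 2 := mkDerivation_X _ _ _

theorem twistD_mul (α : Fin n → ZMod p) (f g : MvPolynomial (Fin n) k) :
    twistD p k α (f * g) = twistD p k α f * g + f * polD k n g := by
  rw [twistD_apply, twistD_apply, Derivation.leibniz, smul_eq_mul, smul_eq_mul]
  ring

/-- The source of the formula for ∂_a(δ_i). After multiplication by x_i - x_{i+1} it is a polynomial
identity, obtained by differentiating the definition of the divided difference. The inputs are that
∂ commutes with s_i and that G = ∑ α_t x_t satisfies G - s_i G = -a (x_i - x_{i+1}). -/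
theorem twistD_dd (a : ZMod p) {α : Fin n → ZMod p} (i : Fin (n - 1))
    (h : α (lo i) - α (hi i) = -a) (f : MvPolynomial (Fin n) k) :
    twistD p k α (dd i f) =
      polRep k n (dδ (ZMod.castHom (dvd_refl p) k a) i) f + dd i (twistD p k α f) := by
  have hc := congrArg (ZMod.castHom (dvd_refl p) k) h
  rw [map_sub, map_neg] at hc
  have hG := sub_sw_linear (c := fun t => ZMod.castHom (dvd_refl p) k (α t)) i
  rw [hc] at hG
  have h1 := root_mul_dd i (twistD p k α f)
  rw [twistD_apply, twistD_apply] at *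
  generalize ZMod.castHom (dvd_refl p) k a = c at hG ⊢
  generalize ∑ t, C (ZMod.castHom (dvd_refl p) k (α t)) * X t = G at hG h1 ⊢
  have h2 := root_mul_dd i f
  have h3 := congrArg (polD k n) h2
  rw [Derivation.leibniz, map_sub, map_sub, polD_X, polD_X, smul_eq_mul, smul_eq_mul,
    ← rename_polD] at h3
  rw [map_add (sw k i), map_mul (sw k i)] at h1
  have h4 : polRep k n (dδ c i) f =
      C c * f - C (c + 1) * (X (lo i) * dd i f) + C (c - 1) * (X (hi i) * dd i f) := by
    rw [dδ]
    simp only [map_add, map_sub, map_smul, map_mul, LinearMap.add_apply, LinearMap.sub_apply,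
      LinearMap.smul_apply, Module.End.mul_apply, polRep_x, polRep_δ, smul_eq_C_mul,
      Algebra.algebraMap_eq_smul_one, map_one, Module.End.one_apply]
  apply mul_left_cancel₀ (root_ne_zero (k := k) i)
  rw [h4, mul_add (root k i), mul_add (root k i), h1]
  simp only [map_add, map_sub, map_one, map_neg] at hG ⊢
  linear_combination h3 + (G + C c * root k i) * h2 - sw k i f * hG

/-- Pol(α) is a p-DG module over (NH_n, ∂_a). By the Leibniz rule it is enough to treat generators,
and `twistD_dd` is the only case that constrains α. -/
theorem twistD_polRep (a : ZMod p) {α : Fin n → ZMod p}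
    (h : ∀ i, α (lo i) - α (hi i) = -a) (w : NilHecke k n) (f : MvPolynomial (Fin n) k) :
    twistD p k α (polRep k n w f) =
      polRep k n (diff (ZMod.castHom (dvd_refl p) k a) w) f + polRep k n w (twistD p k α f) := by
  induction w using NilHecke.induction_on with
  | smul_one c => simp [diff_one]
  | add v w hv hw =>
    simp only [map_add, LinearMap.add_apply, hv, hw]
    abel
  | x_mul i w hw =>
    rw [diff_mul, diff_x, map_mul, Module.End.mul_apply, polRep_x, mul_comm, twistD_mul, hw, polD_X]
    simp only [map_add, map_mul, LinearMap.add_apply, Module.End.mul_apply, polRep_x, pow_two]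
    ring
  | δ_mul i w hw =>
    rw [diff_mul, diff_δ, map_mul, Module.End.mul_apply, polRep_δ, twistD_dd a i (h i), hw]
    simp only [map_add, map_mul, LinearMap.add_apply, Module.End.mul_apply, polRep_δ]
    abel

theorem matAct_tensorD {s : Equiv.Perm (Fin n)} (dU : Module.End k (U k n s))
    (T : Module.End k (U k n s) ⊗[k] Sym k n) (t : U k n s ⊗[k] Sym k n) :
    matAct k _ _ (tensorD (hd dU dU) (symD k n) T) t =
      tensorD dU (symD k n) (matAct k _ _ T t) - matAct k _ _ T (tensorD dU (symD k n) t) := by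
  have hD : ∀ {V W : Type u} [AddCommGroup V] [Module k V] [AddCommGroup W] [Module k W]
      (dV : Module.End k V) (dW : Module.End k W) (v : V) (w : W),
      tensorD dV dW (v ⊗ₜ w) = dV v ⊗ₜ w + v ⊗ₜ dW w := fun _ _ _ _ => rfl
  have hS : ∀ r f : Sym k n, symD k n (r * f) = symD k n r * f + r * symD k n f := by
    intro r f
    apply Subtype.ext
    change polD k n (r.1 * f.1) = polD k n r.1 * f.1 + r.1 * polD k n f.1
    rw [Derivation.leibniz, smul_eq_mul, smul_eq_mul]
    ring
  induction T using TensorProduct.induction_on with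
  | zero => simp
  | add S T hS hT => simp only [map_add, LinearMap.add_apply, hS, hT]; abel
  | tmul φ r =>
    induction t using TensorProduct.induction_on with
    | zero => simp
    | add S T hS hT => simp only [map_add, hS, hT]; abel
    | tmul u f =>
      rw [hD, hD, map_add, LinearMap.add_apply, map_add]
      simp only [matAct_tmul, hD, hS, hd_apply, TensorProduct.tmul_add, TensorProduct.sub_tmul]
      abel

/-- The multiplication map intertwines the differentials because Pol(α) is a p-DG module over Pol,
hence over Sym. -/
theorem uMul_tensorD {s : Equiv.Perm (Fin n)} {α : Fin n → ZMod p}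
    (hs : ∀ u ∈ U k n s, twistD p k α u ∈ U k n s) (t : U k n s ⊗[k] Sym k n) :
    uMul k n s (tensorD ((twistD p k α).restrict hs) (symD k n) t) =
      twistD p k α (uMul k n s t) := by
  induction t using TensorProduct.induction_on with
  | zero => simp
  | add S T hS hT => simp only [map_add, hS, hT]
  | tmul u f =>
    rw [uMul_tmul, twistD_mul]
    rfl

/-- Both sides act on Pol(α) as the commutator of ∂_α with the action of w. -/
theorem matIso_diff (a : ZMod p) {s : Equiv.Perm (Fin n)} {α : Fin n → ZMod p}
    (h : ∀ i, α (lo i) - α (hi i) = -a)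
    (hs : ∀ u ∈ U k n s, twistD p k α u ∈ U k n s) (w : NilHecke k n) :
    matIso k s (diff (ZMod.castHom (dvd_refl p) k a) w) =
      tensorD (hd ((twistD p k α).restrict hs) ((twistD p k α).restrict hs)) (symD k n)
        (matIso k s w) := by
  apply matAct_ext
  intro t
  rw [uMul_matAct_matIso, matAct_tensorD, map_sub, uMul_tensorD, uMul_matAct_matIso,
    uMul_matAct_matIso, uMul_tensorD, twistD_polRep a h, add_sub_cancel_right]

theorem weights_lo_sub_hi (a α₁ : ZMod p) (i : Fin (n - 1)) :
    weights n a α₁ (lo i) - weights n a α₁ (hi i) = -a := by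
  simp only [weights, lo, hi, Nat.cast_add, Nat.cast_one]
  ring

end Differential

end

end PDG

namespace PDG

section

open MvPolynomial NilHecke

variable {k : Type u} [Field k] {n : ℕ}

/-! ### The gradings -/

/-- The grading of the polynomial ring with `deg x_i = 2`. -/
noncomputable def polGr (k : Type u) [Field k] (n : ℕ) (m : ℤ) :
    Submodule k (MvPolynomial (Fin n) k) :=
  Submodule.span k {f | ∃ b : Fin n →₀ ℕ, 2 * (b.degree : ℤ) = m ∧ f = monomial b 1}

theorem mem_polGr {m : ℤ} {f : MvPolynomial (Fin n) k} :
    f ∈ polGr k n m ↔ ∀ b ∈ f.support, 2 * (b.degree : ℤ) = m := by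
  have h : polGr k n m = restrictSupport k {b : Fin n →₀ ℕ | 2 * (b.degree : ℤ) = m} := by
    apply le_antisymm
    · refine Submodule.span_le.2 ?_
      rintro _ ⟨b, hb, rfl⟩
      exact (monomial_mem_restrictSupport k).2 (Or.inl hb)
    · rw [restrictSupport_eq_span]
      refine Submodule.span_le.2 ?_
      rintro _ ⟨b, hb, rfl⟩
      exact Submodule.subset_span ⟨b, hb, rfl⟩
  rw [h]
  rfl

theorem mem_balancedGr {m : ℤ} {f : MvPolynomial (Fin n) k} :
    f ∈ balancedGr k n m ↔ f ∈ polGr k n (m - (n : ℤ) * (1 - n) / 2) := by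
  rw [balancedGr, polGr]
  simp only [eq_sub_iff_add_eq]

theorem monomial_mem_polGr (b : Fin n →₀ ℕ) : monomial b (1 : k) ∈ polGr k n (2 * b.degree) :=
  Submodule.subset_span ⟨b, rfl, rfl⟩

theorem mul_mem_polGr {i j : ℤ} {f g : MvPolynomial (Fin n) k} (hf : f ∈ polGr k n i)
    (hg : g ∈ polGr k n j) : f * g ∈ polGr k n (i + j) := by
  have : polGr k n i * polGr k n j ≤ polGr k n (i + j) := by
    rw [polGr, polGr, Submodule.span_mul_span]
    refine Submodule.span_le.2 ?_
    rintro _ ⟨_, ⟨b, hb, rfl⟩, _, ⟨b', hb', rfl⟩, rfl⟩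
    refine Submodule.subset_span ⟨b + b', ?_, by simp [monomial_mul]⟩
    rw [map_add, Nat.cast_add, mul_add, hb, hb']
  exact this (Submodule.mul_mem_mul hf hg)

theorem one_mem_polGr : (1 : MvPolynomial (Fin n) k) ∈ polGr k n 0 :=
  Submodule.subset_span ⟨0, by simp, rfl⟩

theorem X_mem_polGr (i : Fin n) : (X i : MvPolynomial (Fin n) k) ∈ polGr k n 2 :=
  Submodule.subset_span ⟨Finsupp.single i 1, by simp, rfl⟩

/-- Induction on the degree of a monomial: the twisted Leibniz rule splits off one variable, whose
divided difference is 1, -1 or 0. -/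
theorem dd_mem_polGr (i : Fin (n - 1)) {m : ℤ} {f : MvPolynomial (Fin n) k}
    (hf : f ∈ polGr k n m) : dd i f ∈ polGr k n (m - 2) := by
  have key : ∀ (N : ℕ) (b : Fin n →₀ ℕ), b.degree = N →
      dd i (monomial b (1 : k)) ∈ polGr k n (2 * N - 2) := by
    intro N
    induction N with
    | zero =>
      intro b hb
      rw [(Finsupp.degree_eq_zero_iff b).1 hb, dd_eq_zero (rename_monomial _ _ _)]
      exact zero_mem _
    | succ N ih =>
      intro b hb
      have hb0 : b ≠ 0 := by rintro rfl; simp at hb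
      obtain ⟨l, hl⟩ := Finsupp.ne_iff.1 hb0
      obtain ⟨b', rfl⟩ : ∃ b', b = Finsupp.single l 1 + b' :=
        ⟨b - Finsupp.single l 1, (add_tsub_cancel_of_le (by
          rw [Finsupp.single_le_iff]; exact Nat.one_le_iff_ne_zero.2 hl)).symm⟩
      have hd : b'.degree = N := by
        rw [map_add, Finsupp.degree_single] at hb
        omega
      rw [← one_mul (1 : k), ← monomial_mul, dd_mul]
      have h1 : dd i (monomial (Finsupp.single l 1) (1 : k)) ∈ polGr k n 0 := by
        change dd i (X l) ∈ _
        rcases eq_or_ne l (lo i) with rfl | h₁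
        · rw [dd_X_lo]; exact one_mem_polGr
        rcases eq_or_ne l (hi i) with rfl | h₂
        · rw [dd_X_hi]; exact neg_mem one_mem_polGr
        · rw [dd_X_of_ne h₁ h₂]; exact zero_mem _
      refine add_mem ?_ ?_
      · have := mul_mem_polGr h1 (monomial_mem_polGr (k := k) b')
        rw [hd] at this
        convert this using 2
        push_cast
        ring
      · have h2 : sw k i (monomial (Finsupp.single l 1) (1 : k)) ∈ polGr k n 2 := by
          rw [rename_monomial, Finsupp.mapDomain_single]
          exact X_mem_polGr _
        convert mul_mem_polGr h2 (ih b' hd) using 2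
        push_cast
        ring
  induction hf using Submodule.span_induction with
  | mem f h =>
    obtain ⟨b, rfl, rfl⟩ := h
    exact key _ b rfl
  | zero => rw [map_zero]; exact zero_mem _
  | add f g _ _ hf hg => rw [map_add]; exact add_mem hf hg
  | smul c f _ hf => rw [map_smul]; exact Submodule.smul_mem _ _ hf

theorem polRep_mem_polGr {d m : ℤ} {w : NilHecke k n} (hw : w ∈ gr k n d)
    {f : MvPolynomial (Fin n) k} (hf : f ∈ polGr k n m) : polRep k n w f ∈ polGr k n (d + m) := by
  induction hw using Submodule.span_induction with
  | mem w h =>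
    obtain ⟨l, rfl, rfl⟩ := h
    induction l with
    | nil => simpa using hf
    | cons g l ih =>
      simp only [List.map_cons, List.prod_cons, List.sum_cons, map_mul, Module.End.mul_apply]
      cases g with
      | x i =>
        rw [polRep_x, add_assoc]
        exact mul_mem_polGr (X_mem_polGr i) ih
      | δ i =>
        rw [polRep_δ]
        convert dd_mem_polGr i ih using 2
        simp only [degree]
        ring
  | zero => rw [map_zero]; exact zero_mem _
  | add v w _ _ hv hw => rw [map_add]; exact add_mem hv hw
  | smul c w _ hw => rw [map_smul]; exact Submodule.smul_mem _ _ hw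

/-- Elements of the nilHecke algebra that act homogeneously on `U_{n,s}` are homogeneous. -/
theorem mem_gr_of_polRep (s : Equiv.Perm (Fin n)) {m : ℤ} {w : NilHecke k n}
    (h : ∀ b : stairs n s, polRep k n w (monomial b.1 1) ∈ polGr k n (m + 2 * b.1.degree)) :
    w ∈ gr k n m := by
  classical
  obtain ⟨c, hc, rfl⟩ := (Submodule.mem_iSup_iff_exists_finsupp _ _).1
    (iSup_gr (k := k) (n := n) ▸ Submodule.mem_top : w ∈ ⨆ d, gr k n d)
  -- On a monomial x^b the component c_d contributes the part of degree d + 2|b|. By hypothesis the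
  -- total lies in degree m + 2|b|, so c_d kills U when d ≠ m and is zero by `restrictU_bijective`.
  have h0 : ∀ d, d ≠ m → c d = 0 := by
    intro d hd
    apply (restrictU_bijective s).1
    rw [map_zero]
    apply (basisU k s).ext
    intro b
    change polRep k n (c d) (basisU k s b).1 = 0
    rw [basisU_apply]
    have hmem : ∀ e, polRep k n (c e) (monomial b.1 1) ∈ polGr k n (e + 2 * b.1.degree) :=
      fun e => polRep_mem_polGr (hc e) (monomial_mem_polGr b.1)
    ext b'
    by_contra hb'
    rw [coeff_zero] at hb'
    have h1 := mem_polGr.1 (hmem d) b' (mem_support_iff.2 hb')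
    have h2 : coeff b' (polRep k n (c.sum fun _ v => v) (monomial b.1 1)) =
        coeff b' (polRep k n (c d) (monomial b.1 1)) := by
      rw [Finsupp.sum, map_sum, LinearMap.sum_apply, coeff_sum]
      refine Finset.sum_eq_single d (fun e _ he => ?_) fun hd => ?_
      · by_contra h3
        have := mem_polGr.1 (hmem e) b' (mem_support_iff.2 h3)
        omega
      · rw [Finsupp.notMem_support_iff.1 hd]
        simp
    have h3 := mem_polGr.1 (h b) b' (mem_support_iff.2 (h2 ▸ hb'))
    omega
  rw [Finsupp.sum, Finset.sum_eq_single m (fun d _ hd => h0 d hd)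
    fun hm => Finsupp.notMem_support_iff.1 hm]
  exact hc m

/-- The preimage of φ ⊗ f sends x^b to f φ(x^b), which has the right degree. The balancing shift n(1
- n)/2 occurs in source and target of φ and cancels. -/
theorem tensorGr_le (s : Equiv.Perm (Fin n)) (m : ℤ) :
    tensorGr (endGr (uGr k n s)) (symGr k n) m ≤ (gr k n m).map (matIso k s).toLinearMap := by
  refine Submodule.span_le.2 ?_
  rintro _ ⟨i, j, rfl, φ, hφ, f, hf, rfl⟩
  refine ⟨(matIso k s).symm (φ ⊗ₜ f), mem_gr_of_polRep s fun b => ?_,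
    (matIso k s).apply_symm_apply _⟩
  have h := uMul_matAct_matIso s ((matIso k s).symm (φ ⊗ₜ f)) (basisU k s b ⊗ₜ 1)
  rw [AlgEquiv.apply_symm_apply, matAct_tmul, uMul_tmul, uMul_tmul, mul_one, basisU_apply] at h
  change _ = polRep k n _ (_ * 1) at h
  rw [mul_one] at h
  rw [← h]
  have h1 := hφ (2 * b.1.degree + (n : ℤ) * (1 - n) / 2) (basisU k s b) (by
    change (basisU k s b).1 ∈ balancedGr k n _
    rw [mem_balancedGr, add_sub_cancel_right, basisU_apply]
    exact monomial_mem_polGr _)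
  have h2 := mem_balancedGr.1 h1
  have e : i + j + 2 * (b.1.degree : ℤ) =
      2 * b.1.degree + (n : ℤ) * (1 - n) / 2 + i - (n : ℤ) * (1 - n) / 2 + j := by ring
  rw [e]
  exact mul_mem_polGr h2 hf

/-- U is finite-dimensional with a homogeneous basis, so the matrix units `E b' b` are homogeneous
and span. -/
theorem iSup_endGr (s : Equiv.Perm (Fin n)) : ⨆ m, endGr (uGr k n s) m = ⊤ := by
  classical
  have := Fintype.ofFinite (stairs n s)
  rw [eq_top_iff]
  intro φ _
  let E : stairs n s → stairs n s → Module.End k (U k n s) := fun b' b =>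
    ((basisU k s).coord b).smulRight (basisU k s b')
  have e : φ = ∑ b, ∑ b', (basisU k s).repr (φ (basisU k s b)) b' • E b' b := by
    apply (basisU k s).ext
    intro c
    simp only [E, LinearMap.sum_apply, LinearMap.smul_apply, LinearMap.smulRight_apply,
      Module.Basis.coord_apply, Module.Basis.repr_self, Finsupp.single_apply, ite_smul, one_smul,
      zero_smul, smul_ite, smul_zero]
    rw [Finset.sum_comm]
    simp only [Finset.sum_ite_eq, Finset.mem_univ, if_true, (basisU k s).sum_repr]
  rw [e]
  refine Submodule.sum_mem _ fun b _ => Submodule.sum_mem _ fun b' _ => Submodule.smul_mem _ _ ?_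
  refine Submodule.mem_iSup_of_mem (2 * b'.1.degree - 2 * b.1.degree) fun i u hu => ?_
  simp only [E, LinearMap.smulRight_apply, Module.Basis.coord_apply]
  rw [basisU_repr]
  by_cases h0 : coeff b.1 u.1 = 0
  · rw [h0, zero_smul]; exact zero_mem _
  refine Submodule.smul_mem _ _ ?_
  have h1 := mem_polGr.1 (mem_balancedGr.1 hu) b.1 (mem_support_iff.2 h0)
  change (basisU k s b').1 ∈ balancedGr k n _
  rw [mem_balancedGr, basisU_apply]
  convert monomial_mem_polGr b'.1 using 2
  linarith

theorem isSymmetric_homogeneousComponent {f : MvPolynomial (Fin n) k} (hf : f.IsSymmetric) (d : ℕ) :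
    (homogeneousComponent d f).IsSymmetric := by
  intro e
  rw [rename_homogeneousComponent, hf e]

/-- The homogeneous components of a symmetric polynomial are symmetric. -/
theorem iSup_symGr : ⨆ m, symGr k n m = ⊤ := by
  rw [eq_top_iff]
  intro f _
  have e : f = ∑ d ∈ Finset.range (f.1.totalDegree + 1),
      (⟨homogeneousComponent d f.1, isSymmetric_homogeneousComponent f.2 d⟩ : Sym k n) := by
    apply Subtype.ext
    rw [AddSubmonoidClass.coe_finsetSum]
    exact (sum_homogeneousComponent f.1).symm
  rw [e]
  refine Submodule.sum_mem _ fun d _ => Submodule.mem_iSup_of_mem (2 * (d : ℤ)) ?_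
  change homogeneousComponent d f.1 ∈ polGr k n _
  rw [mem_polGr]
  intro b hb
  rw [mem_support_iff, coeff_homogeneousComponent] at hb
  by_contra h
  exact hb (if_neg fun e => h (by rw [e]))

theorem iSup_tensorGr {V W : Type*} [AddCommGroup V] [Module k V] [AddCommGroup W] [Module k W]
    {gV : ℤ → Submodule k V} {gW : ℤ → Submodule k W} (hV : ⨆ m, gV m = ⊤) (hW : ⨆ m, gW m = ⊤) :
    ⨆ m, tensorGr gV gW m = ⊤ := by
  rw [eq_top_iff, ← TensorProduct.span_tmul_eq_top, Submodule.span_le]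
  rintro _ ⟨v, w, rfl⟩
  have hv : v ∈ ⨆ m, gV m := hV ▸ Submodule.mem_top
  have hw : w ∈ ⨆ m, gW m := hW ▸ Submodule.mem_top
  change v ⊗ₜ w ∈ ⨆ m, tensorGr gV gW m
  induction hv using Submodule.iSup_induction' with
  | mem i v hv =>
    induction hw using Submodule.iSup_induction' with
    | mem j w hw =>
      exact Submodule.mem_iSup_of_mem (i + j) (Submodule.subset_span ⟨i, j, rfl, v, hv, w, hw, rfl⟩)
    | zero => rw [TensorProduct.tmul_zero]; exact zero_mem _
    | add a b _ _ ha hb => rw [TensorProduct.tmul_add]; exact add_mem ha hb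
  | zero => rw [TensorProduct.zero_tmul]; exact zero_mem _
  | add a b _ _ ha hb => rw [TensorProduct.add_tmul]; exact add_mem ha hb

/-- A decomposition admits no proper refinement from below: intersect G i with the full supremum of
the G' and apply the modular law; independence removes the other summands. This turns one inclusion
of gradings into equality. -/
theorem eq_of_le_of_iSupIndep {ι α : Type*} [CompleteLattice α] [IsModularLattice α]
    {G G' : ι → α} (hle : ∀ i, G' i ≤ G i) (hG : iSupIndep G) (hG' : ⨆ i, G' i = ⊤) (i : ι) :
    G' i = G i := by
  refine le_antisymm (hle i) ?_
  calc G i = (G' i ⊔ ⨆ (j) (_ : j ≠ i), G' j) ⊓ G i := by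
        rw [← iSup_split_single, hG', top_inf_eq]
    _ = G' i ⊔ (⨆ (j) (_ : j ≠ i), G' j) ⊓ G i := sup_inf_assoc_of_le _ (hle i)
    _ ≤ G' i ⊔ (⨆ (j) (_ : j ≠ i), G j) ⊓ G i :=
        sup_le_sup_left (inf_le_inf_right _ (iSup₂_mono fun j _ => hle j)) _
    _ = G' i := by rw [inf_comm, (hG i).eq_bot, sup_bot_eq]

theorem map_matIso_gr (s : Equiv.Perm (Fin n)) (m : ℤ) :
    (gr k n m).map (matIso k s).toLinearMap = tensorGr (endGr (uGr k n s)) (symGr k n) m := by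
  have hind : iSupIndep (gr k n) :=
    ((DirectSum.isInternal_submodule_iff_iSupIndep_and_iSup_eq_top _).1 gr_internal).1
  have h := eq_of_le_of_iSupIndep
    (G' := fun m => (tensorGr (endGr (uGr k n s)) (symGr k n) m).map
      (matIso k s).symm.toLinearMap) (fun m => ?_) hind ?_ m
  · rw [← h, ← Submodule.map_comp]
    convert Submodule.map_id _
    exact LinearMap.ext fun t => (matIso k s).apply_symm_apply t
  · rintro _ ⟨t, ht, rfl⟩
    obtain ⟨w, hw, rfl⟩ := tensorGr_le s m ht
    exact (congrArg (· ∈ gr k n m) ((matIso k s).symm_apply_apply w)).mpr hw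
  · have h := iSup_tensorGr (V := Module.End k (U k n s)) (W := Sym k n) (iSup_endGr s) iSup_symGr
    rw [← Submodule.map_iSup, h, Submodule.map_top]
    exact LinearMap.range_eq_top.2 (matIso k s).symm.surjective

end

end PDG

namespace PDG

section FreeStaircase

open MvPolynomial

variable {p : ℕ} [Fact p.Prime] {k : Type u} [Field k] [CharP k p]

/-! ### The staircase as a free module over `k[∂]/(∂ᵖ)` -/

theorem twistD_monomial {n : ℕ} (α : Fin n → ZMod p) (b : Fin n →₀ ℕ) :
    twistD p k α (monomial b 1) =
      ∑ t, ((b t : k) + ZMod.castHom (dvd_refl p) k (α t)) •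
        monomial (b + Finsupp.single t 1) 1 := by
  have h : (monomial b 1 : MvPolynomial (Fin n) k) = ∏ t, X t ^ b t := by
    rw [monomial_eq, C_1, one_mul, Finsupp.prod_fintype _ _ fun _ => pow_zero _]
  rw [twistD_apply, h, polD_prod_pow, ← mul_add, ← Finset.sum_add_distrib, Finset.mul_sum, ← h]
  refine Finset.sum_congr rfl fun t _ => ?_
  have hX : (monomial (b + Finsupp.single t 1) 1 : MvPolynomial (Fin n) k) =
      monomial b 1 * X t := by rw [X, monomial_mul, one_mul]
  rw [hX, smul_eq_C_mul, C_add]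
  ring

/-- Since a ≠ 0, the p weights form an arithmetic progression through all of F_p. Sorting the
variables so that the weights become 1, …, p is what makes U stable and free. -/
theorem exists_perm_weights {a : ZMod p} (ha : a ≠ 0) (α₁ : ZMod p) :
    ∃ s : Equiv.Perm (Fin p), ∀ t, weights p a α₁ (s t) = ((t.val + 1 : ℕ) : ZMod p) := by
  have hcast : ∀ i j : Fin p, ((i.val : ℕ) : ZMod p) = (j.val : ℕ) → i = j := by
    intro i j h
    rw [ZMod.natCast_eq_natCast_iff', Nat.mod_eq_of_lt i.2, Nat.mod_eq_of_lt j.2] at h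
    exact Fin.ext h
  have hcard : Fintype.card (Fin p) = Fintype.card (ZMod p) := by
    rw [Fintype.card_fin, ZMod.card]
  have h1 : Function.Bijective (weights p a α₁) := by
    refine (Fintype.bijective_iff_injective_and_card _).2 ⟨fun i j h => hcast i j ?_, hcard⟩
    exact mul_right_cancel₀ ha (add_left_cancel h)
  have h2 : Function.Bijective fun t : Fin p => ((t.val + 1 : ℕ) : ZMod p) := by
    refine (Fintype.bijective_iff_injective_and_card _).2 ⟨fun i j h => hcast i j ?_, hcard⟩
    simpa using h
  refine ⟨(Equiv.ofBijective _ h2).trans (Equiv.ofBijective _ h1).symm, fun t => ?_⟩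
  exact (Equiv.ofBijective _ h1).apply_symm_apply _

variable {s : Equiv.Perm (Fin p)} {α : Fin p → ZMod p}

/-- A monomial can leave the staircase only by raising an exponent that is already maximal. There
b_{s(i)} + (i + 1) = p, so the coefficient of that term of ∂_α is zero. -/
theorem add_single_mem_stairs (hα : ∀ t, α (s t) = ((t.val + 1 : ℕ) : ZMod p)) {b : Fin p →₀ ℕ}
    (hb : b ∈ stairs p s) {t : Fin p} (ht : (b t : k) + ZMod.castHom (dvd_refl p) k (α t) ≠ 0) :
    b + Finsupp.single t 1 ∈ stairs p s := by
  intro i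
  rw [Finsupp.add_apply]
  have hi := hb i
  by_cases h : s i = t
  · subst h
    rw [Finsupp.single_eq_same]
    by_contra h
    have e : b (s i) + (i.val + 1) = p := by omega
    rw [hα, map_natCast, ← Nat.cast_add, e, CharP.cast_eq_zero] at ht
    exact ht rfl
  · rw [Finsupp.single_eq_of_ne (by exact h)]
    exact hi

theorem twistD_mem_U (hα : ∀ t, α (s t) = ((t.val + 1 : ℕ) : ZMod p)) :
    ∀ u ∈ U k p s, twistD p k α u ∈ U k p s := by
  intro u hu
  induction hu using Submodule.span_induction with
  | mem u h =>
    obtain ⟨b, hb, rfl⟩ := h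
    rw [twistD_monomial]
    refine Submodule.sum_mem _ fun t _ => ?_
    by_cases h0 : (b t : k) + ZMod.castHom (dvd_refl p) k (α t) = 0
    · rw [h0, zero_smul]; exact zero_mem _
    · exact Submodule.smul_mem _ _
        (Submodule.subset_span ⟨_, add_single_mem_stairs hα hb h0, rfl⟩)
  | zero => rw [map_zero]; exact zero_mem _
  | add f g _ _ hf hg => rw [map_add]; exact add_mem hf hg
  | smul c f _ hf => rw [map_smul]; exact Submodule.smul_mem _ _ hf

/-- The index `z` of the variable whose exponents run from `0` to `p - 1`. -/
def top (s : Equiv.Perm (Fin p)) : Fin p := s ⟨0, (Fact.out : p.Prime).pos⟩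

/-- The exponents of the monomials that do not involve the variable of index `top s`. -/
def bottom (s : Equiv.Perm (Fin p)) : Set (Fin p →₀ ℕ) := {b | b ∈ stairs p s ∧ b (top s) = 0}

theorem add_single_top_mem_stairs {b : Fin p →₀ ℕ} (hb : b ∈ bottom s) {i : ℕ} (hi : i < p) :
    b + Finsupp.single (top s) i ∈ stairs p s := by
  intro t
  rw [Finsupp.add_apply]
  by_cases h : s t = top s
  · have ht : t.val = 0 := congrArg Fin.val (s.injective h)
    rw [h, hb.2, Finsupp.single_eq_same]
    omega
  · rw [Finsupp.single_eq_of_ne (by exact h)]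
    exact hb.1 t

/-- Splitting off the exponent of the variable of index `top s`. -/
noncomputable def bottomEquiv (s : Equiv.Perm (Fin p)) : bottom s × Fin p ≃ stairs p s where
  toFun x := ⟨x.1.1 + Finsupp.single (top s) x.2.val, add_single_top_mem_stairs x.1.2 x.2.2⟩
  invFun b := (⟨b.1.erase (top s), fun t => by
      rw [Finsupp.erase_apply]
      split_ifs
      · exact Nat.zero_le _
      · exact b.2 t, Finsupp.erase_same⟩,
    ⟨b.1 (top s), by have := b.2 ⟨0, (Fact.out : p.Prime).pos⟩
                     have hp := (Fact.out : p.Prime).pos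
                     change b.1 (top s) ≤ p - (0 + 1) at this
                     omega⟩)
  left_inv x := by
    obtain ⟨⟨b, hb⟩, i⟩ := x
    refine Prod.ext (Subtype.ext (Finsupp.ext fun t => ?_)) (Fin.ext ?_)
    · simp only [Finsupp.erase_apply, Finsupp.add_apply]
      split_ifs with h
      · rw [h, hb.2]
      · rw [Finsupp.single_eq_of_ne h, add_zero]
    · simp [hb.2]
  right_inv b := by
    refine Subtype.ext (Finsupp.ext fun t => ?_)
    simp only [Finsupp.erase_apply, Finsupp.add_apply]
    split_ifs with h
    · rw [h, Finsupp.single_eq_same, zero_add]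
    · rw [Finsupp.single_eq_of_ne h, add_zero]

/-- The variable z of index `top s` has weight 1, so differentiating z^i x^b, with x^b free of z,
gives (i + 1) z^(i+1) x^b plus terms with the same power of z. For i + 1 < p the leading coefficient
is invertible; thus the ∂^i x^b generate triangularly, and there are exactly dim U of them. -/
theorem isFreeGradedH_U (hα : ∀ t, α (s t) = ((t.val + 1 : ℕ) : ZMod p)) :
    IsFreeGradedH p (uGr k p s) ((twistD p k α).restrict (twistD_mem_U hα)) := by
  classical
  set D := (twistD p k α).restrict (twistD_mem_U hα)
  have hpow : ∀ (i : ℕ) (u : U k p s), ((D ^ i) u).1 = (twistD p k α ^ i) u.1 := by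
    intro i u
    induction i with
    | zero => rfl
    | succ i ih =>
      rw [pow_succ', pow_succ', Module.End.mul_apply, Module.End.mul_apply, ← ih]
      rfl
  have hDp : D ^ p = 0 := by
    apply LinearMap.ext
    intro u
    apply Subtype.ext
    rw [hpow, twistD_pow]
    rfl
  let e : bottom s → U k p s := fun b => basisU k s ⟨b.1, b.2.1⟩
  let v : bottom s × Fin p → U k p s := fun x => (D ^ x.2.val) (e x.1)
  let W := Submodule.span k (Set.range v)
  have hW : ∀ u ∈ W, D u ∈ W := by
    intro u hu
    induction hu using Submodule.span_induction with
    | mem u h =>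
      obtain ⟨x, rfl⟩ := h
      change D ((D ^ x.2.val) (e x.1)) ∈ W
      rw [← Module.End.mul_apply, ← pow_succ']
      by_cases h : x.2.val + 1 < p
      · exact Submodule.subset_span ⟨(x.1, ⟨x.2.val + 1, h⟩), rfl⟩
      · rw [show x.2.val + 1 = p by omega, hDp]
        exact zero_mem _
    | zero => rw [map_zero]; exact zero_mem _
    | add f g _ _ hf hg => rw [map_add]; exact add_mem hf hg
    | smul c f _ hf => rw [map_smul]; exact Submodule.smul_mem _ _ hf
  -- The induction on the exponent of z runs over all b at once, because the lower terms of the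
  -- derivative keep this exponent but change b.
  have key : ∀ (i : ℕ) (hi : i < p) (b : bottom s), basisU k s (bottomEquiv s (b, ⟨i, hi⟩)) ∈ W := by
    intro i
    induction i with
    | zero =>
      intro hi b
      have : bottomEquiv s (b, ⟨0, hi⟩) = ⟨b.1, b.2.1⟩ := Subtype.ext (by simp [bottomEquiv])
      rw [this]
      exact Submodule.subset_span ⟨(b, ⟨0, hi⟩), rfl⟩
    | succ i ih =>
      intro hi b
      have h1 := hW _ (ih (by omega) b)
      have hz : ((i + 1 : ℕ) : k) ≠ 0 := fun h =>
        Nat.not_dvd_of_pos_of_lt (Nat.succ_pos i) hi ((CharP.cast_eq_zero_iff k p _).1 h)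
      have hcz : (((b.1 + Finsupp.single (top s) i) (top s) : ℕ) : k) +
          ZMod.castHom (dvd_refl p) k (α (top s)) = ((i + 1 : ℕ) : k) := by
        rw [Finsupp.add_apply, b.2.2, Finsupp.single_eq_same, top, hα, map_natCast]
        push_cast
        ring
      let g : Fin p → U k p s := fun t =>
        if h : ((b.1 + Finsupp.single (top s) i) t : k) + ZMod.castHom (dvd_refl p) k (α t) = 0
        then 0 else (((b.1 + Finsupp.single (top s) i) t : k) + ZMod.castHom (dvd_refl p) k (α t)) •
          basisU k s ⟨_, add_single_mem_stairs hα (bottomEquiv s (b, ⟨i, by omega⟩)).2 h⟩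
      have hg : D (basisU k s (bottomEquiv s (b, ⟨i, by omega⟩))) = ∑ t, g t := by
        apply Subtype.ext
        change twistD p k α (basisU k s _).1 = _
        rw [basisU_apply, twistD_monomial, AddSubmonoidClass.coe_finsetSum]
        refine Finset.sum_congr rfl fun t _ => ?_
        simp only [g]
        split_ifs with h
        · exact (congrArg (· • _) h).trans (zero_smul _ _)
        · rw [Submodule.coe_smul, basisU_apply]
          rfl
      have hgz : g (top s) = ((i + 1 : ℕ) : k) • basisU k s (bottomEquiv s (b, ⟨i + 1, hi⟩)) := by
        refine (dif_neg (by rw [hcz]; exact hz)).trans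
          (congrArg₂ (· • ·) hcz (congrArg _ (Subtype.ext ?_)))
        simp only [bottomEquiv, Equiv.coe_fn_mk, add_assoc, ← Finsupp.single_add]
      have hgt : ∀ t, t ≠ top s → g t ∈ W := by
        intro t ht
        simp only [g]
        split_ifs with h
        · exact zero_mem _
        · refine Submodule.smul_mem _ _ ?_
          have hbt : b.1 + Finsupp.single t 1 ∈ bottom s := by
            refine ⟨add_single_mem_stairs (k := k) hα b.2.1 ?_, ?_⟩
            · rwa [Finsupp.add_apply, Finsupp.single_eq_of_ne ht, add_zero] at h
            · rw [Finsupp.add_apply, b.2.2, Finsupp.single_eq_of_ne ht.symm, add_zero]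
          have := ih (by omega) ⟨_, hbt⟩
          convert this using 2
          apply Subtype.ext
          exact add_right_comm _ _ _
      rw [hg, ← Finset.add_sum_erase _ _ (Finset.mem_univ (top s)), hgz] at h1
      have h2 := sub_mem h1 (Submodule.sum_mem W fun t (ht : t ∈ Finset.univ.erase (top s)) =>
        hgt t (Finset.ne_of_mem_erase ht))
      rw [add_sub_cancel_right] at h2
      have h3 := Submodule.smul_mem W ((i + 1 : ℕ) : k)⁻¹ h2
      rwa [smul_smul, inv_mul_cancel₀ hz, one_smul] at h3
  have hspan : ⊤ ≤ W := by
    rw [← (basisU k s).span_eq, Submodule.span_le]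
    rintro _ ⟨b, rfl⟩
    have := key _ ((bottomEquiv s).symm b).2.2 ((bottomEquiv s).symm b).1
    rwa [Fin.eta, Prod.mk.eta, Equiv.apply_symm_apply] at this
  have : Finite (bottom s × Fin p) := Finite.of_equiv _ (bottomEquiv s).symm
  have := Fintype.ofFinite (bottom s × Fin p)
  have := Fintype.ofFinite (stairs p s)
  -- Counting replaces a proof of linear independence: a spanning family of the right size is a
  -- basis.
  have hcard : Fintype.card (bottom s × Fin p) = Module.finrank k (U k p s) := by
    rw [Module.finrank_eq_card_basis (basisU k s)]
    exact Fintype.card_congr (bottomEquiv s)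
  refine ⟨hDp, bottom s, fun b => 2 * (b.1.degree : ℤ) + (p : ℤ) * (1 - p) / 2, e,
    basisOfTopLeSpanOfCardEqFinrank v hspan hcard, fun b => ?_, fun b i => ?_⟩
  · change (basisU k s ⟨b.1, b.2.1⟩).1 ∈ balancedGr k p _
    rw [mem_balancedGr, add_sub_cancel_right, basisU_apply]
    exact monomial_mem_polGr _
  · rw [coe_basisOfTopLeSpanOfCardEqFinrank]

end FreeStaircase

end PDG

namespace PDG

/-! ### Acyclicity from an element `y` with `∂ᵖ⁻¹ y = 1` -/

section Contractible

open PDGModule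

variable {p : ℕ} {k : Type u} [Field k] {A : PDGAlgebra p k} [Fact p.Prime] [CharP k p]

/-- If `∂ᵖ⁻¹ y = 1`, then multiplication with `y` contracts every `p`-DG module. -/
theorem homotopy_of_d_pow_eq_one {y : A.carrier} (hy : (A.d ^ (p - 1)) y = 1) (M : PDGModule A)
    (m : M.carrier) :
    ∑ j ∈ Finset.range p, (M.d ^ (p - 1 - j)) (y • (M.d ^ j) m) = m := by
  have key : ∀ (j : ℕ) (r : A.carrier), (hd M.d M.d ^ j) (Algebra.lsmul k k M.carrier r) =
      Algebra.lsmul k k M.carrier ((A.d ^ j) r) := by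
    intro j
    induction j with
    | zero => intro r; rfl
    | succ j ih =>
      intro r
      rw [pow_succ', Module.End.mul_apply, ih, pow_succ', Module.End.mul_apply]
      ext x
      rw [hd_apply]
      simp [M.leibniz]
  have h := homotopy_sum p M.d M.d (Algebra.lsmul k k M.carrier y) m
  rw [key, hy] at h
  simpa using h

/-- Multiplication by y is k-linear of degree 2 - 2p, though in general not A-linear;
quasi-isomorphisms ask only for k-linear homotopies. So every p-DG module is contractible over k,
and the zero map back serves as homotopy inverse. -/
theorem isQuasiIso_zero_of_d_pow_eq_one {y : A.carrier} (hdeg : y ∈ A.gr (2 - 2 * p))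
    (hy : (A.d ^ (p - 1)) y = 1) (M N : PDGModule A) : IsQuasiIso (0 : M ⟶ N) := by
  have h : ∀ M : PDGModule A, NullHomotopic k M M (fun m => 0 - m) := by
    intro M
    refine ⟨-Algebra.lsmul k k M.carrier y, fun i m hm => ?_, fun m => ?_⟩
    · rw [add_comm]
      exact neg_mem (M.smul_mem hdeg hm)
    · have := homotopy_of_d_pow_eq_one hy M m
      simp only [LinearMap.neg_apply, Algebra.lsmul_coe, map_neg, Finset.sum_neg_distrib, this,
        zero_sub]
  refine ⟨0, fun i _ _ => zero_mem _, fun n => by simp, h M, ?_⟩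
  obtain ⟨g, hg, hh⟩ := h N
  exact ⟨g, hg, fun n => (congrArg (· - n) (map_zero (Hom.lin (0 : M ⟶ N)))).trans (hh n)⟩

omit [Fact p.Prime] [CharP k p] in
theorem unique_hom_zero (M : PDGModule A) (f g : PDGModule.zero A ⟶ M) : f = g := by
  apply PDGModule.Hom.ext
  apply LinearMap.ext
  intro m
  have : m = 0 := Subsingleton.elim (α := PUnit) _ _
  rw [this, map_zero, map_zero]

omit [Fact p.Prime] [CharP k p] in
variable (A) in
/-- If all zero morphisms are quasi-isomorphisms, the derived category is trivial. -/
theorem exists_equivalence_punit (h : ∀ M N : PDGModule A, IsQuasiIso (0 : M ⟶ N)) :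
    Nonempty (DerivedCat A ≌ Discrete PUnit.{1}) := by
  let K : HomotopyCat A ⥤ Discrete PUnit.{1} := (Functor.const _).obj ⟨⟨⟩⟩
  have hK : (quasiIso A).IsInvertedBy K := fun _ _ _ _ => inferInstanceAs (IsIso (𝟙 _))
  let G : DerivedCat A ⥤ Discrete PUnit.{1} := Localization.Construction.lift K hK
  let Z : HomotopyCat A := (toHomotopyCat A).obj (PDGModule.zero A)
  let F : Discrete PUnit.{1} ⥤ DerivedCat A := (Functor.const _).obj ((toDerivedCat A).obj Z)
  -- The zero module has exactly one map to each object, and it is a quasi-isomorphism. It becomes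
  -- invertible in the localization, and uniqueness makes it natural, so the identity functor is
  -- isomorphic to a constant one.
  let z : ∀ X : HomotopyCat A, Z ⟶ X := fun X => (toHomotopyCat A).map (0 : PDGModule.zero A ⟶ X.as)
  have hz : ∀ X : HomotopyCat A, quasiIso A (z X) := fun X => ⟨0, rfl, h _ _⟩
  have huniq : ∀ (X : HomotopyCat A) (f g : Z ⟶ X), f = g := by
    intro X f g
    obtain ⟨f, rfl⟩ := (toHomotopyCat A).map_surjective (X := PDGModule.zero A) (Y := X.as) f
    obtain ⟨g, rfl⟩ := (toHomotopyCat A).map_surjective (X := PDGModule.zero A) (Y := X.as) g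
    rw [unique_hom_zero _ f g]
  have : ∀ X, IsIso ((toDerivedCat A).map (z X)) := fun X =>
    Localization.inverts (toDerivedCat A) (quasiIso A) _ (hz X)
  let τ : toDerivedCat A ⋙ G ⋙ F ≅ toDerivedCat A ⋙ 𝟭 _ :=
    NatIso.ofComponents (fun X => asIso ((toDerivedCat A).map (z X))) (by
      intro X Y f
      change 𝟙 _ ≫ (toDerivedCat A).map (z Y) = (toDerivedCat A).map (z X) ≫ (toDerivedCat A).map f
      rw [Category.id_comp, ← Functor.map_comp]
      congr 1
      exact huniq _ _ _)
  exact ⟨CategoryTheory.Equivalence.mk G F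
    (Localization.liftNatIso (toDerivedCat A) (quasiIso A) (toDerivedCat A ⋙ 𝟭 _)
      (toDerivedCat A ⋙ G ⋙ F) (𝟭 _) (G ⋙ F) τ.symm)
    (Functor.punitExt _ _)⟩

-- In a category equivalent to a point every sextuple is isomorphic to a standard triangle, so M → M
-- → M → M[1] with arbitrary maps is exact. Its relation reads [M] = [M] + [M].
variable (A) in
theorem subsingleton_K0_of_punit (e : DerivedCat A ≌ Discrete PUnit.{1}) :
    Subsingleton (K0 A) := by
  have hsub : ∀ X Y : DerivedCat A, Subsingleton (X ⟶ Y) := fun X Y =>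
    ⟨fun f g => e.functor.map_injective (Subsingleton.elim _ _)⟩
  have hiso : ∀ X Y : DerivedCat A, Nonempty (X ≅ Y) := fun X Y =>
    ⟨e.functor.preimageIso (eqToIso (Subsingleton.elim _ _))⟩
  have hexact : ∀ T : Sextuple (derivedShift A), IsExactDerived T := by
    intro T
    refine ⟨⟨(toHomotopyCat A).map (𝟙 (zero A)), (toHomotopyCat A).map (lam (zero A)),
      (toHomotopyCat A).map (lamBar (zero A))⟩, ?_, ?_⟩
    · refine ⟨zero A, zero A, hTens (zero A), 𝟙 _, lam _, 𝟙 _, lamBar _,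
        IsPushout.of_horiz_isIso ⟨by simp⟩, unique_hom_zero _ _ _, Category.id_comp _,
        Iso.refl _, Iso.refl _, Iso.refl _, ?_, ?_, ?_⟩
      · simp
      · simp
      · simp
    · exact ⟨(hiso _ _).some, (hiso _ _).some, (hiso _ _).some, (hsub _ _).elim _ _,
        (hsub _ _).elim _ _, (hsub _ _).elim _ _⟩
  refine QuotientAddGroup.subsingleton_iff.2 ((AddSubgroup.eq_top_iff' _).2 fun r => ?_)
  induction r using FreeAbelianGroup.induction_on with
  | zero => exact zero_mem _
  | of x =>
    obtain ⟨⟨M, hM⟩, rfl⟩ := Quotient.exists_rep x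
    have f : M ⟶ (derivedShift A).obj M := (hiso _ _).some.hom
    have h := AddSubgroup.subset_closure (k := {r : FreeK0 A | ∃ (T : Sextuple (derivedShift A))
      (_ : IsExactDerived T) (hX : isCompact A T.X) (hY : isCompact A T.Y) (hZ : isCompact A T.Z),
      r = symbol hY - (symbol hX + symbol hZ)})
      ⟨⟨𝟙 M, 𝟙 M, f⟩, hexact _, hM, hM, hM, rfl⟩
    rw [sub_add_cancel_left] at h
    exact neg_mem_iff.1 h
  | neg x hx => exact neg_mem hx
  | add x y hx hy => exact add_mem hx hy

end Contractible

/-! ### The contracting element of the nilHecke algebra -/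

section NilHecke

variable {p : ℕ} {k : Type u} [Field k]

/-- A graded free module over `k[∂]/(∂ᵖ)` is contractible. -/
theorem IsFreeGradedH.exists_contraction {V : Type*} [AddCommGroup V] [Module k V]
    {gr : ℤ → Submodule k V} (hgr : iSupIndep gr) {d : Module.End k V}
    (hd2 : ∀ i, ∀ v ∈ gr i, d v ∈ gr (i + 2)) (h : IsFreeGradedH p gr d) :
    ∃ φ ∈ endGr gr (2 - 2 * p), ∀ v, ∑ j ∈ Finset.range p, (d ^ (p - 1 - j)) (φ ((d ^ j) v)) = v := by
  classical
  obtain ⟨hdp, ι, deg, e, b, he, hb⟩ := h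
  have hmem : ∀ j i, (d ^ i) (e j) ∈ gr (deg j + 2 * (i : ℕ)) := by
    intro j i
    induction i with
    | zero => simpa using he j
    | succ i ih =>
      rw [pow_succ', Module.End.mul_apply]
      convert hd2 _ _ ih using 2
      push_cast
      ring
  -- Only independence of the grading is given. Comparing it with the spans of basis vectors of
  -- fixed degree shows that each graded piece is spanned by the basis vectors in it, so degrees can
  -- be checked on the basis.
  have hspan : ∀ i, Submodule.span k {v | ∃ x, deg x.1 + 2 * (x.2.val : ℤ) = i ∧ v = b x} = gr i := by
    refine eq_of_le_of_iSupIndep (fun i => Submodule.span_le.2 ?_) hgr ?_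
    · rintro _ ⟨⟨j, i⟩, rfl, rfl⟩
      rw [hb]
      exact hmem j i
    · rw [eq_top_iff, ← b.span_eq, Submodule.span_le]
      rintro _ ⟨x, rfl⟩
      exact Submodule.mem_iSup_of_mem _ (Submodule.subset_span ⟨x, rfl, rfl⟩)
  -- The contraction sends the last vector d^(p-1) e of each string back to e and kills the others.
  -- Its degree is therefore 2 - 2p.
  let φ : Module.End k V := b.constr k fun x => if x.2.val + 1 = p then e x.1 else 0
  have hφ : ∀ j i, φ ((d ^ i) (e j)) = if i + 1 = p then e j else 0 := by
    intro j i
    rcases lt_or_ge i p with hi | hi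
    · have h1 := hb j ⟨i, hi⟩
      simp only at h1
      rw [← h1, b.constr_basis]
    · rw [← Nat.sub_add_cancel hi, pow_add, hdp, mul_zero, LinearMap.zero_apply, map_zero,
        if_neg (by omega)]
  refine ⟨φ, fun i v hv => ?_, fun v => ?_⟩
  · rw [← hspan] at hv
    induction hv using Submodule.span_induction with
    | mem v h =>
      obtain ⟨⟨j, l⟩, rfl, rfl⟩ := h
      rw [hb, hφ]
      split_ifs with hl
      · convert he j using 2
        simp only
        omega
      · exact zero_mem _
    | zero => rw [map_zero]; exact zero_mem _
    | add v w _ _ hv hw => rw [map_add]; exact add_mem hv hw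
    | smul c v _ hv => rw [map_smul]; exact Submodule.smul_mem _ _ hv
  · suffices h : ∑ j ∈ Finset.range p, d ^ (p - 1 - j) * φ * d ^ j = 1 by
      simpa using LinearMap.congr_fun h v
    apply b.ext
    rintro ⟨j, i⟩
    have hi := i.2
    -- On d^i e only the summand that first reaches d^(p-1) e survives; it then returns d^i e.
    rw [LinearMap.sum_apply, Finset.sum_eq_single (p - 1 - i.val)]
    · rw [hb, Module.End.mul_apply, Module.End.mul_apply, ← Module.End.mul_apply (d ^ (p - 1 - i.val)),
        ← pow_add, hφ, if_pos (by omega), Module.End.one_apply]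
      congr 2
      omega
    · intro l hl hne
      rw [Finset.mem_range] at hl
      rw [hb, Module.End.mul_apply, Module.End.mul_apply, ← Module.End.mul_apply (d ^ l),
        ← pow_add, hφ, if_neg (by omega), map_zero]
    · intro h
      exact absurd (Finset.mem_range.2 (by omega)) h

/-! ### Adding strands -/

open NilHecke in
theorem satisfies_castLE {m n : ℕ} (h : m ≤ n) :
    Satisfies (n := m) (B := NilHecke k n) (fun i => x (Fin.castLE h i))
      (fun i => δ (Fin.castLE (Nat.sub_le_sub_right h 1) i)) where
  δ_sq _ := δ_sq _
  braid _ _ hij := braid _ _ hij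
  δ_comm _ _ hij := δ_comm _ _ hij
  x_δ_comm _ _ h₁ h₂ := x_δ_comm _ _
    (fun e => h₁ (Fin.castLE_injective h e)) (fun e => h₂ (Fin.castLE_injective h e))
  x_comm _ _ := x_comm _ _
  x_δ i := x_δ (Fin.castLE (Nat.sub_le_sub_right h 1) i)
  δ_x i := δ_x (Fin.castLE (Nat.sub_le_sub_right h 1) i)

open NilHecke in
/-- Adding strands on the right. -/
noncomputable def addStrands (k : Type u) [Field k] {m n : ℕ} (h : m ≤ n) :
    NilHecke k m →ₐ[k] NilHecke k n := NilHecke.lift (satisfies_castLE h)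

open NilHecke in
theorem addStrands_mem_gr {m n : ℕ} (h : m ≤ n) {d : ℤ} {w : NilHecke k m} (hw : w ∈ gr k m d) :
    addStrands k h w ∈ gr k n d := by
  induction hw using Submodule.span_induction with
  | mem w h' =>
    obtain ⟨l, rfl, rfl⟩ := h'
    induction l with
    | nil => simpa using one_mem_gr
    | cons g l ih =>
      simp only [List.map_cons, List.prod_cons, List.sum_cons, map_mul]
      refine mul_mem_gr ?_ ih
      cases g with
      | x i => rw [addStrands, lift_x]; exact x_mem_gr _
      | δ i => rw [addStrands, lift_δ]; exact δ_mem_gr _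
  | zero => rw [map_zero]; exact zero_mem _
  | add v w _ _ hv hw => rw [map_add]; exact add_mem hv hw
  | smul c w _ hw => rw [map_smul]; exact Submodule.smul_mem _ _ hw

-- The formulas for ∂_a on generators involve only the strands on which the generator lives and do
-- not depend on n.
open NilHecke in
theorem addStrands_diff {m n : ℕ} (h : m ≤ n) (c : k) (w : NilHecke k m) :
    addStrands k h (diff c w) = diff c (addStrands k h w) := by
  induction w using NilHecke.induction_on with
  | smul_one r => simp [diff_one]
  | add v w hv hw => simp only [map_add, hv, hw]
  | x_mul i w hw =>
    have e : addStrands k h (x i) = x (Fin.castLE h i) := lift_x _ i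
    rw [diff_mul, diff_x, map_add, map_mul, map_mul, map_mul, map_pow, hw, e, diff_mul, diff_x]
  | δ_mul i w hw =>
    have e : ∀ i, addStrands k h (x i) = x (Fin.castLE h i) := fun i => lift_x _ i
    have e' : addStrands k h (δ i) = δ (Fin.castLE (Nat.sub_le_sub_right h 1) i) := lift_δ _ i
    rw [diff_mul, diff_δ, map_add, map_mul, map_mul, map_mul, hw, e', diff_mul, diff_δ]
    congr 2
    simp only [dδ, map_add, map_sub, map_smul, map_mul, AlgHom.commutes, e, e']
    rfl

end NilHecke

end PDG

/-! ### The contracting element for n ≥ p -/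

namespace PDG

open MvPolynomial

variable {p : ℕ} [Fact p.Prime] {k : Type u} [Field k] [CharP k p]

omit [Fact p.Prime] [CharP k p] in
theorem iSupIndep_uGr {n : ℕ} (s : Equiv.Perm (Fin n)) : iSupIndep (uGr k n s) := by
  rw [iSupIndep_iff_finsetSum_eq_zero_imp_eq_zero]
  intro t v hv h0 i hi
  apply Subtype.ext
  ext b
  by_contra hb
  have hmem : ∀ j ∈ t, (v j).1 ∈ polGr k n (j - (n : ℤ) * (1 - n) / 2) := fun j hj =>
    mem_balancedGr.1 (hv j hj)
  have h1 := mem_polGr.1 (hmem i hi) b (mem_support_iff.2 hb)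
  have h2 := congrArg (fun u : U k n s => coeff b u.1) h0
  simp only [AddSubmonoidClass.coe_finsetSum, coeff_sum] at h2
  rw [Finset.sum_eq_single_of_mem i hi] at h2
  · exact hb h2
  · intro j hj hne
    by_contra h3
    have := mem_polGr.1 (hmem j hj) b (mem_support_iff.2 h3)
    omega

theorem twistD_mem_polGr {n : ℕ} (α : Fin n → ZMod p) {m : ℤ} {f : MvPolynomial (Fin n) k}
    (hf : f ∈ polGr k n m) : twistD p k α f ∈ polGr k n (m + 2) := by
  induction hf using Submodule.span_induction with
  | mem f h =>
    obtain ⟨b, rfl, rfl⟩ := h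
    rw [twistD_monomial]
    refine Submodule.sum_mem _ fun t _ => Submodule.smul_mem _ _ (Submodule.subset_span ⟨_, ?_, rfl⟩)
    rw [map_add, Finsupp.degree_single]
    push_cast
    ring
  | zero => rw [map_zero]; exact zero_mem _
  | add f g _ _ hf hg => rw [map_add]; exact add_mem hf hg
  | smul c f _ hf => rw [map_smul]; exact Submodule.smul_mem _ _ hf

/-- The nilHecke algebra on `p` strands contains a contracting element. -/
theorem exists_contracting_nilHecke {a : ZMod p} (ha : a ≠ 0) :
    ∃ y ∈ NilHecke.gr k p (2 - 2 * p),
      (NilHecke.diff (ZMod.castHom (dvd_refl p) k a) ^ (p - 1)) y = 1 := by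
  obtain ⟨s, hα⟩ := exists_perm_weights ha 0
  have hs := twistD_mem_U (k := k) hα
  -- The initial weight 0 is an arbitrary choice; ∂_a depends only on the difference a of successive
  -- weights.
  set dU := (twistD p k (weights p a 0)).restrict hs
  obtain ⟨φ, hφ, hsum⟩ := (isFreeGradedH_U (k := k) hα).exists_contraction (iSupIndep_uGr s)
    fun i v hv => by
      change twistD p k (weights p a 0) v.1 ∈ balancedGr k p (i + 2)
      rw [mem_balancedGr, add_sub_right_comm]
      exact twistD_mem_polGr _ (mem_balancedGr.1 hv)
  obtain ⟨y, hy, hy'⟩ : φ ⊗ₜ 1 ∈ (NilHecke.gr k p (2 - 2 * p)).map (matIso k s).toLinearMap := by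
    rw [map_matIso_gr]
    exact Submodule.subset_span ⟨2 - 2 * p, 0, add_zero _, φ, hφ, 1, one_mem_polGr, rfl⟩
  refine ⟨y, hy, (matIso k s).injective ?_⟩
  -- The differential of Sym kills 1, so iterating the tensor product differential on φ ⊗ 1 only
  -- iterates the commutator with `dU` on φ.
  have key : ∀ j : ℕ, matIso k s ((NilHecke.diff (ZMod.castHom (dvd_refl p) k a) ^ j) y) =
      ((hd dU dU ^ j) φ) ⊗ₜ 1 := by
    intro j
    induction j with
    | zero => exact hy'
    | succ j ih =>
      rw [pow_succ', Module.End.mul_apply, matIso_diff a (weights_lo_sub_hi a 0) hs, ih, pow_succ',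
        Module.End.mul_apply]
      have h1 : symD k p 1 = 0 := Subtype.ext (polD k p).map_one_eq_zero
      change _ ⊗ₜ _ + _ ⊗ₜ symD k p 1 = _
      rw [h1, TensorProduct.tmul_zero, add_zero]
      rfl
  rw [key, map_one, Algebra.TensorProduct.one_def]
  congr 1
  apply LinearMap.ext
  intro u
  -- In characteristic p the (p-1)-st power of the commutator is the homotopy sum, which is the
  -- identity because φ is a contraction.
  rw [← homotopy_sum p dU dU φ u]
  exact hsum u

/-- The map that adds n - p strands is a unital graded homomorphism commuting with ∂_a, so it
carries the element found for p strands to one for n strands. -/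
theorem exists_contracting_nilHeckePDG {a : ZMod p} (ha : a ≠ 0) {n : ℕ} (hn : p ≤ n) :
    ∃ y ∈ (nilHeckePDG p k n a).gr (2 - 2 * p), ((nilHeckePDG p k n a).d ^ (p - 1)) y = 1 := by
  obtain ⟨y, hy, h⟩ := exists_contracting_nilHecke (k := k) ha
  refine ⟨addStrands k hn y, addStrands_mem_gr hn hy, ?_⟩
  have key : ∀ j : ℕ, (NilHecke.diff (ZMod.castHom (dvd_refl p) k a) ^ j) (addStrands k hn y) =
      addStrands k hn ((NilHecke.diff (ZMod.castHom (dvd_refl p) k a) ^ j) y) := by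
    intro j
    induction j with
    | zero => rfl
    | succ j ih =>
      rw [pow_succ', Module.End.mul_apply, ih, pow_succ', Module.End.mul_apply, addStrands_diff]
  exact (key _).trans ((congrArg _ h).trans (map_one _))

end PDG

/-! ### The theorem -/

theorem mainTheorem4 (p : ℕ) [Fact p.Prime] (k : Type u) [Field k] [CharP k p] (a : ZMod p)
    (ha : a ≠ 0) :
    (∀ n : ℕ, p ≤ n →
      (PDG.PDGModule.regular (PDG.nilHeckePDG p k n a)).IsAcyclic ∧
      Nonempty (PDG.DerivedCat (PDG.nilHeckePDG p k n a) ≌ Discrete PUnit.{1}) ∧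
      Subsingleton (PDG.K0 (PDG.nilHeckePDG p k n a))) ∧
    ∀ α₁ : ZMod p, ∃ (s : Equiv.Perm (Fin p))
      (hs : ∀ u ∈ PDG.U k p s, PDG.twistD p k (PDG.weights p a α₁) u ∈ PDG.U k p s),
      PDG.IsFreeGradedH p (PDG.uGr k p s) ((PDG.twistD p k (PDG.weights p a α₁)).restrict hs) ∧
      Function.Bijective (PDG.uMul k p s) ∧
      ∃ Φ : PDG.NilHecke k p ≃ₐ[k] Module.End k (PDG.U k p s) ⊗[k] PDG.Sym k p,
        PDG.IsPDGIso p a s ((PDG.twistD p k (PDG.weights p a α₁)).restrict hs) Φ ∧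
        PDG.IsPolynomialAction p s Φ := by
  constructor
  · intro n hn
    obtain ⟨y, hy, h⟩ := PDG.exists_contracting_nilHeckePDG (k := k) ha hn
    have hq := PDG.isQuasiIso_zero_of_d_pow_eq_one hy h
    have he := PDG.exists_equivalence_punit _ hq
    exact ⟨hq _ _, he, PDG.subsingleton_K0_of_punit _ he.some⟩
  · intro α₁
    obtain ⟨s, hα⟩ := PDG.exists_perm_weights ha α₁
    exact ⟨s, PDG.twistD_mem_U hα, PDG.isFreeGradedH_U hα, PDG.uMul_bijective s, PDG.matIso k s,
      ⟨PDG.map_matIso_gr s, PDG.matIso_diff a (PDG.weights_lo_sub_hi a α₁) _⟩,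
      PDG.isPolynomialAction_matIso p s⟩
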